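/- **Setting.** Let $\mathcal X$ be a countable set, the vertex set of a connected undirected graph (without loops) with uniformly bounded degrees; write $x\sim y$ for neighbours and $d$ for the graph distance. Let $L$ be the generator of a Markov process on $\mathcal X$: $L(x,y)\ge 0$ for $x\ne y$, $L(x,x)=-\sum_{y\neq x}L(x,y)$, and $L(x,y)>0$ if and only if $x\sim y$. Let $m$ be a measure on $\mathcal X$ with $0<m(x)<\infty$ for all $x$ which is reversible: $m(x)L(x,y)=m(y)L(y,x)$. For $\gamma>0$ let $L^\gamma(x,y)=\gamma^{d(x,y)}L(x,y)$ for $x\ne y$, $L^\gamma(x,x)=-\sum_{y\ne x}L^\gamma(x,y)$, let $P^\gamma_t=e^{tL^\gamma}=\sum_k \frac{t^k}{k!}(L^\gamma)^k$, and let $R^\gamma$ be the Markov path measure with generator $L^\gamma$ and initial measure $m$ on the space $\Omega$ of right-continuous piecewise constant paths $[0,1]\to\mathcal X$ with finitely many jumps. The relative entropy is $H(q|r)=\int\log\frac{dq}{dr}\,dq\in(-\infty,\infty]$ if $q\ll r$, and $+\infty$ otherwise. Assume that $\sup_x m(x)<\infty$ and $\inf_x m(x)>0$; that $\sup_x|L(x,x)|\le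 S$ for some $S\ge1$; that $L(x,y)\ge I$ whenever $x\sim y$, for some $I\in(0,1]$; and that for every $x$ there is $\gamma_o\in(0,1]$ with $\sum_y\gamma_o^{d(x,y)}<\infty$. Let $\nu_0,\nu_1$ be probability measures on $\mathcal X$ with finite support, and let $(\gamma_k)_{k\in\mathbb N}$ be positive numbers converging to $0$. For $\gamma\in\{\gamma_k\}$ let $\widehat Q^\gamma$ be the minimizer of $H(Q|R^\gamma)$ over the probability measures $Q$ on $\Omega$ with laws $Q_0=\nu_0$ and $Q_1=\nu_1$ at times $0$ and $1$; let $f^\gamma,g^\gamma\ge0$ be functions integrable with respect to every $P_1^\gamma(x,\cdot)$ that solve the Schrödinger system $$f^\gamma(x)\,P_1^\gamma g^\gamma(x)=\frac{\nu_0(x)}{m(x)},\qquad g^\gamma(y)\,P_1^\gamma f^\gamma(y)=\frac{\nu_1(y)}{m(y)}\qquad(x,y\in\mathcal X),$$ and put $$\varphi_\gamma(t)=\int \log(P^\gamma_tf^\gamma)\,P^\gamma_tf^\gamma\,P^\gamma_{1-t}g^\gamma\,dm,\qquad \psi_\gamma(t)=\int \log(P^\gamma_{1-t}g^\gamma)\,P^\gamma_{1-t}g^\gamma\,P^\gamma_{t}f^\gamma\,dm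 .$$ Let $(\widehat Q^0_t)_{t\in[0,1]}$ be the Schrödinger bridge at zero temperature from $\nu_0$ to $\nu_1$: for each $t\in[0,1]$, $\widehat Q^0_t$ is the weak limit of the laws $\widehat Q^{\gamma_k}_t$ at time $t$ as $k\to\infty$. **Lemma.** Let $\varphi_0,\psi_0$ be real functions, continuous on $[0,1]$ and twice differentiable on $(0,1)$, such that for every $t\in(0,1)$ $$\liminf_{k\to\infty}\varphi_{\gamma_k}''(t)\ge\varphi_0''(t)\quad\text{and}\quad\liminf_{k\to\infty}\psi_{\gamma_k}''(t)\ge\psi_0''(t).$$ For $t\in(0,1)$ let $K_t(u)=\frac{2u}{t}\mathbf 1_{u\le t}+\frac{2(1-u)}{1-t}\mathbf 1_{u\ge t}$, $u\in[0,1]$. Then for every $t\in(0,1)$ the functions $\varphi_0''K_t$ and $\psi_0''K_t$ are Lebesgue integrable on $[0,1]$, and $$H(\widehat Q^0_t|m)\le(1-t)H(\nu_0|m)+tH(\nu_1|m)-\frac{t(1-t)}2\,C_t(\nu_0,\nu_1)$$ with $$C_t(\nu_0,\nu_1)=\int_0^1\varphi_0''(u)K_t(u)\,du+\int_0^1\psi_0''(u)K_t(u)\,du$$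 $$=\frac{2}{t(1-t)}\Big[(1-t)\varphi_0(0)+t\varphi_0(1)-\varphi_0(t)+(1-t)\psi_0(0)+t\psi_0(1)-\psi_0(t)\Big].$$ -/

import Mathlib

open MeasureTheory Filter Topology

noncomputable section

namespace SchrodingerBridge

/-! ### Relative entropy -/

open scoped Classical in
/-- The relative entropy `H(q | r) = ∫ log (dq/dr) dq ∈ (-∞, ∞]`, equal to `∞` when `q` is not
absolutely continuous with respect to `r`. It is used for probability measures `q` carried by a set
of finite `r`-measure; then the negative part of `log (dq/dr)` is `q`-integrable, so that the
integral is `∞` exactly when `log (dq/dr)` is not `q`-integrable. -/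
def relEntropy {Y : Type*} [MeasurableSpace Y] (q r : Measure Y) : EReal :=
  if q ≪ r ∧ Integrable (llr q r) q then ((∫ y, llr q r y ∂q : ℝ) : EReal) else ⊤

/-! ### Generators and semigroups on a countable set -/

/-- The entries `A^k(x, y)` of the powers of an infinite matrix `A`. -/
def matPow {X : Type*} [DecidableEq X] (A : X → X → ℝ) : ℕ → X → X → ℝ
  | 0 => fun x y => if x = y then 1 else 0
  | k + 1 => fun x y => ∑' z, A x z * matPow A k z y

/-- The semigroup `e^{tA} = ∑ₖ (t^k / k!) A^k`, entrywise. -/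
def semigroup {X : Type*} [DecidableEq X] (A : X → X → ℝ) (t : ℝ) (x y : X) : ℝ :=
  ∑' k : ℕ, t ^ k / (k.factorial : ℝ) * matPow A k x y

/-- The action of the semigroup on functions: `(e^{tA} f)(x) = ∑_y f(y) e^{tA}(x, y)`. -/
def semigroupApply {X : Type*} [DecidableEq X] (A : X → X → ℝ) (t : ℝ) (f : X → ℝ) (x : X) : ℝ :=
  ∑' y, f y * semigroup A t x y

/-- The generator `L^γ` at temperature `γ`: `L^γ(x, y) = γ^{d(x, y)} L(x, y)` off the diagonal, where
`d` is the graph distance, with rows summing to zero. -/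
def slowGenerator {X : Type*} [DecidableEq X] (G : SimpleGraph X) (L : X → X → ℝ) (γ : ℝ)
    (x y : X) : ℝ :=
  if x = y then - ∑' z, (if z = x then 0 else γ ^ G.dist x z * L x z)
  else γ ^ G.dist x y * L x y

/-- `(X, d, m, L)`: a connected graph with bounded degrees, and the generator `L` of a
nearest-neighbour Markov process on it that is reversible for the measure `m`, which charges every
vertex. -/
structure IsGraphSpace {X : Type*} [DecidableEq X] [MeasurableSpace X] (G : SimpleGraph X)
    (m : Measure X) (L : X → X → ℝ) : Prop where
  connected : G.Connected
  bounded_degree : ∃ D : ℕ, ∀ x, (G.neighborSet x).encard ≤ D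
  offDiag_nonneg : ∀ x y, x ≠ y → 0 ≤ L x y
  pos_iff_adj : ∀ x y, 0 < L x y ↔ G.Adj x y
  diag : ∀ x, L x x = - ∑' y, (if y = x then 0 else L x y)
  mass_ne_zero : ∀ x, m {x} ≠ 0
  mass_ne_top : ∀ x, m {x} ≠ ⊤
  reversible : ∀ x y, m.real {x} * L x y = m.real {y} * L y x

/-- The boundedness and summability assumptions on `(X, d, m, L)`. -/
structure IsUniformlyBounded {X : Type*} [MeasurableSpace X] (G : SimpleGraph X)
    (m : Measure X) (L : X → X → ℝ) : Prop where
  mass_le : ∃ M : ℝ, ∀ x, m.real {x} ≤ M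
  le_mass : ∃ c : ℝ, 0 < c ∧ ∀ x, c ≤ m.real {x}
  diag_le : ∃ S : ℝ, 1 ≤ S ∧ ∀ x, |L x x| ≤ S
  le_rate : ∃ I : ℝ, 0 < I ∧ I ≤ 1 ∧ ∀ x y, G.Adj x y → I ≤ L x y
  summable_pow_dist : ∀ x, ∃ γ₀ : ℝ, 0 < γ₀ ∧ γ₀ ≤ 1 ∧ Summable fun y => γ₀ ^ G.dist x y

/-! ### Path space and path measures -/

/-- `ω : [0, 1] → X` is right-continuous and piecewise constant with finitely many jumps: there is a
finite set `s` of times such that `ω` is constant on every `[a, b]` with no point of `s` in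
`(a, b]`. -/
def IsStepPath {X : Type*} (ω : unitInterval → X) : Prop :=
  ∃ s : Finset unitInterval, ∀ a b : unitInterval, a ≤ b → (∀ u ∈ s, ¬ (a < u ∧ u ≤ b)) → ω a = ω b

/-- The path space `Ω`, with the σ-algebra generated by the cylindrical sets (Mathlib's subtype
σ-algebra in the product `X^{[0, 1]}`). -/
abbrev PathSpace (X : Type*) : Type _ := {ω : unitInterval → X // IsStepPath ω}

theorem measurable_eval {X : Type*} [MeasurableSpace X] (t : unitInterval) :
    Measurable fun ω : PathSpace X => ω.1 t :=
  (measurable_pi_apply t).comp measurable_subtype_coe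

/-- The law `Q_t` on `X` of a path at time `t` under `Q`. -/
def marginal {X : Type*} [MeasurableSpace X] (Q : ProbabilityMeasure (PathSpace X))
    (t : unitInterval) : ProbabilityMeasure X :=
  Q.map (measurable_eval t).aemeasurable

/-- `R` is the Markov path measure with generator `A` and initial measure `m`, characterized by its
finite-dimensional distributions. -/
def IsMarkovPathMeasure {X : Type*} [DecidableEq X] [MeasurableSpace X] (m : Measure X)
    (A : X → X → ℝ) (R : Measure (PathSpace X)) : Prop :=
  ∀ (n : ℕ) (τ : Fin (n + 1) → unitInterval) (x : Fin (n + 1) → X), StrictMono τ → τ 0 = 0 →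
    R {ω | ∀ i, ω.1 (τ i) = x i} =
      m {x 0} * ∏ i : Fin n,
        ENNReal.ofReal (semigroup A ((τ i.succ : ℝ) - τ i.castSucc) (x i.castSucc) (x i.succ))

/-- `Q` solves the dynamic Schrödinger problem: it minimizes `H(· | R)` among the probability
measures on the path space with law `ν₀` at time `0` and law `ν₁` at time `1`. -/
def IsSchrodingerMinimizer {X : Type*} [MeasurableSpace X] (R : Measure (PathSpace X))
    (ν₀ ν₁ : ProbabilityMeasure X) (Q : ProbabilityMeasure (PathSpace X)) : Prop :=
  marginal Q 0 = ν₀ ∧ marginal Q 1 = ν₁ ∧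
    ∀ Q' : ProbabilityMeasure (PathSpace X), marginal Q' 0 = ν₀ → marginal Q' 1 = ν₁ →
      relEntropy (Q : Measure (PathSpace X)) R ≤ relEntropy (Q' : Measure (PathSpace X)) R

/-- `(f, g)` is a non-negative solution of the Schrödinger system `f · P₁ g = h₀`, `g · P₁ f = h₁`,
where `P_t = e^{tA}`, and `h₀`, `h₁` are the densities of `ν₀`, `ν₁` with respect to `m`; the
functions `f` and `g` are integrable with respect to every `P₁(x, ·)`. -/
structure IsSchrodingerSystem {X : Type*} [DecidableEq X] [MeasurableSpace X] (m : Measure X)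
    (A : X → X → ℝ) (ν₀ ν₁ : Measure X) (f g : X → ℝ) : Prop where
  nonneg_left : ∀ x, 0 ≤ f x
  nonneg_right : ∀ x, 0 ≤ g x
  summable_left : ∀ x, Summable fun y => f y * semigroup A 1 x y
  summable_right : ∀ x, Summable fun y => g y * semigroup A 1 x y
  eq_left : ∀ x, f x * semigroupApply A 1 g x = ν₀.real {x} / m.real {x}
  eq_right : ∀ y, g y * semigroupApply A 1 f y = ν₁.real {y} / m.real {y}

/-- `t ↦ Q₀(t)` is the Schrödinger bridge at zero temperature along the bridges `Q k` (whose
temperatures tend to zero): at each time it is the weak limit of the laws of the bridges. -/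
def IsZeroTemperatureBridge {X : Type*} [TopologicalSpace X] [MeasurableSpace X]
    [OpensMeasurableSpace X] (Q : ℕ → ProbabilityMeasure (PathSpace X))
    (Q₀ : unitInterval → ProbabilityMeasure X) : Prop :=
  ∀ t, Tendsto (fun k => marginal (Q k) t) atTop (𝓝 (Q₀ t))

/-! ### The two halves of the entropy, the tent kernel and the cost -/

/-- `φ(t) = ∫ log(P_t f) · P_t f · P_{1-t} g dm`, with `P_t = e^{tA}`. -/
def entropyPhi {X : Type*} [DecidableEq X] [MeasurableSpace X] (m : Measure X) (A : X → X → ℝ)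
    (f g : X → ℝ) (t : ℝ) : ℝ :=
  ∫ z, Real.log (semigroupApply A t f z) * semigroupApply A t f z * semigroupApply A (1 - t) g z ∂m

/-- `ψ(t) = ∫ log(P_{1-t} g) · P_{1-t} g · P_t f dm`, with `P_t = e^{tA}`. -/
def entropyPsi {X : Type*} [DecidableEq X] [MeasurableSpace X] (m : Measure X) (A : X → X → ℝ)
    (f g : X → ℝ) (t : ℝ) : ℝ :=
  ∫ z, Real.log (semigroupApply A (1 - t) g z) * semigroupApply A (1 - t) g z *
    semigroupApply A t f z ∂m

/-- The tent kernel `K_t(u) = (2u/t) 1_{u ≤ t} + (2(1-u)/(1-t)) 1_{u ≥ t}`. -/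
def tent (t u : ℝ) : ℝ :=
  (if u ≤ t then 2 * u / t else 0) + (if t ≤ u then 2 * (1 - u) / (1 - t) else 0)

/-- The cost `C_t = ∫₀¹ φ₀''(u) K_t(u) du + ∫₀¹ ψ₀''(u) K_t(u) du`. -/
def cost (φ₀ ψ₀ : ℝ → ℝ) (t : ℝ) : ℝ :=
  (∫ u in (0 : ℝ)..1, deriv (deriv φ₀) u * tent t u) +
    ∫ u in (0 : ℝ)..1, deriv (deriv ψ₀) u * tent t u

end SchrodingerBridge

end

/-! At positive temperature the bridge is f(X₀)g(X₁)R, so its law at time t has density P_t f ·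
P_{1-t} g and H(Q^γ_t|m) = φ_γ(t) + ψ_γ(t). Integrating twice, the deficit (1-t)H(ν₀|m) + tH(ν₁|m) -
H(Q^γ_t|m) is t(1-t)/2 times the integral of (φ_γ'' + ψ_γ'')K_t. The limit γ → 0 is then Fatou's
lemma, which needs two facts: (a) φ_γ''K_t and ψ_γ''K_t are bounded below uniformly in γ; (b)
H(Q^γ_t|m) converges to H(Q^0_t|m).

(a) Edges have length one, so L^γ = γL, and L = N - λ with N a non-negative kernel. By
reversibility, φ_γ is up to constants and an affine term the function t ↦ ℓ(e^{(1-t)T}(F log F)),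
where T = γN, F = e^{tT}f, and ℓ is the pairing with the finitely supported g. Its second derivative
is ℓ of e^{(1-t)T} applied to an expression in F. A three-point logarithmic inequality and
Cauchy-Schwarz bound that expression below by -κ(TTF + TF/t)
(`IsPositiveKernel.neg_le_second_deriv`). This bound is linear in F, so e^{(1-t)T} carries it to
time 1 and only ℓ(T^j e^T f), j = 1, 2, remain. They are at most constants times ℓ(e^T f), because
power series in γ are governed by their leading term (`IsUniformizedKernel.exists_pow_op_le`), and
the Schrödinger system normalizes ℓ(e^T f). Hence φ_γ'' ≥ -C(1 + 1/t), and the tent, vanishing at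
the ends, absorbs 1/t. Time reversal gives the same for ψ_γ.

(b) Transition weights over a distance d are at most of order γ^d, so for small γ the square roots
of the marginals have a common summable bound (`IsUniformizedKernel.exists_sqrt_marginal_le`).
Dominated convergence gives the limit of the entropies (`tendsto_relEntropy`).

Two analytic points need care. On an infinite space F has no positive lower bound, so
differentiating F log F in the uniform norm relies on `abs_deriv_mul_log_le`. And φ₀'' is not
assumed continuous or integrable, so its Taylor formula is derived from a one-sided integrable bound
(`intervalIntegrable_deriv_deriv_mul_tent`). -/

noncomputable section

set_option linter.unusedSectionVars false

namespace SchrodingerBridge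

open scoped BoundedContinuousFunction
open NormedSpace (exp)

/-! ### One-parameter semigroups of bounded operators -/

section ExpOp

variable {E : Type*} [NormedAddCommGroup E] [NormedSpace ℝ E] [CompleteSpace E]

/-- The semigroup `e^{tT}` generated by a bounded operator. -/
def expOp (T : E →L[ℝ] E) (t : ℝ) : E →L[ℝ] E := exp (t • T)

theorem hasSum_expOp_apply (T : E →L[ℝ] E) (t : ℝ) (u : E) :
    HasSum (fun k : ℕ => (t ^ k / (k.factorial : ℝ)) • (T ^ k) u) (expOp T t u) := by
  have h := (NormedSpace.exp_series_hasSum_exp' (𝕂 := ℝ) (t • T)).mapL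
    (ContinuousLinearMap.apply ℝ E u)
  have h1 : ContinuousLinearMap.apply ℝ E u (exp (t • T)) = expOp T t u := rfl
  rw [h1] at h
  convert h using 2 with k
  simp [smul_pow, smul_smul, div_eq_inv_mul]

theorem expOp_zero (T : E →L[ℝ] E) : expOp T 0 = 1 := by
  rw [expOp, zero_smul, NormedSpace.exp_zero]

theorem expOp_add (T : E →L[ℝ] E) (s t : ℝ) : expOp T (s + t) = expOp T s * expOp T t := by
  rw [expOp, add_smul, NormedSpace.exp_add_of_commute_of_mem_ball (𝕂 := ℝ)]
  · rfl
  · exact ((Commute.refl T).smul_right t).smul_left s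
  all_goals rw [NormedSpace.expSeries_radius_eq_top]; exact edist_lt_top _ _

theorem commute_expOp (T : E →L[ℝ] E) (t : ℝ) : Commute T (expOp T t) :=
  ((Commute.refl T).smul_right t).exp_right

theorem commute_expOp_apply (T : E →L[ℝ] E) (t : ℝ) (u : E) :
    T (expOp T t u) = expOp T t (T u) :=
  congrArg (fun A : E →L[ℝ] E => A u) (commute_expOp T t).eq

theorem expOp_smul (T : E →L[ℝ] E) (c t : ℝ) : expOp (c • T) t = expOp T (c * t) := by
  rw [expOp, expOp, smul_smul, mul_comm]

/-- The scalar part is central, so its exponential factors out. A uniformized generator thus gives a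
positive semigroup times a number. -/
theorem expOp_sub_smul_one (T : E →L[ℝ] E) (c t : ℝ) :
    expOp (T - c • 1) t = Real.exp (-(c * t)) • expOp T t := by
  have hc : t • (T - c • (1 : E →L[ℝ] E)) = algebraMap ℝ (E →L[ℝ] E) (-(c * t)) + t • T := by
    rw [Algebra.algebraMap_eq_smul_one, smul_sub, smul_smul, neg_smul, mul_comm c t]
    abel
  rw [expOp, hc, NormedSpace.exp_add_of_commute_of_mem_ball (𝕂 := ℝ) (Algebra.commutes _ _),
    ← NormedSpace.algebraMap_exp_comm, ← Real.exp_eq_exp_ℝ, Algebra.algebraMap_eq_smul_one,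
    smul_mul_assoc, one_mul]
  · rfl
  all_goals rw [NormedSpace.expSeries_radius_eq_top]; exact edist_lt_top _ _

theorem hasDerivAt_expOp (T : E →L[ℝ] E) (t : ℝ) :
    HasDerivAt (fun t => expOp T t) (T * expOp T t) t :=
  hasDerivAt_exp_smul_const' T t

theorem hasDerivAt_expOp_apply (T : E →L[ℝ] E) (u : E) (t : ℝ) :
    HasDerivAt (fun t => expOp T t u) (T (expOp T t u)) t := by
  simpa using (hasDerivAt_expOp T t).clm_apply (hasDerivAt_const t u)

end ExpOp

/-! ### Bounded kernels acting on bounded functions -/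

/-- The rows of `a` are absolutely summable, with a uniform bound. -/
structure IsBoundedKernel {X : Type*} (a : X → X → ℝ) (C : ℝ) : Prop where
  summable : ∀ x, Summable fun y => |a x y|
  tsum_le : ∀ x, ∑' y, |a x y| ≤ C

section BoundedKernel

variable {X : Type*} [TopologicalSpace X] {a : X → X → ℝ} {C : ℝ}

theorem IsBoundedKernel.summable_mul (h : IsBoundedKernel a C) (u : X →ᵇ ℝ) (x : X) :
    Summable fun y => a x y * u y := by
  refine Summable.of_norm_bounded ((h.summable x).mul_right ‖u‖) fun y => ?_
  rw [norm_mul, Real.norm_eq_abs (a x y)]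
  exact mul_le_mul_of_nonneg_left (u.norm_coe_le_norm y) (abs_nonneg _)

theorem IsBoundedKernel.norm_tsum_le (h : IsBoundedKernel a C) (u : X →ᵇ ℝ) (x : X) :
    ‖∑' y, a x y * u y‖ ≤ C * ‖u‖ := by
  refine (tsum_of_norm_bounded ((h.summable x).mul_right ‖u‖).hasSum fun y => ?_).trans ?_
  · rw [norm_mul, Real.norm_eq_abs (a x y)]
    exact mul_le_mul_of_nonneg_left (u.norm_coe_le_norm y) (abs_nonneg _)
  · rw [tsum_mul_right]
    exact mul_le_mul_of_nonneg_right (h.tsum_le x) (norm_nonneg _)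

variable [DiscreteTopology X]

/-- The operator `u ↦ ∑_y a(·, y) u(y)` on bounded functions. -/
def IsBoundedKernel.op (h : IsBoundedKernel a C) : (X →ᵇ ℝ) →L[ℝ] (X →ᵇ ℝ) :=
  LinearMap.mkContinuous
    { toFun := fun u => BoundedContinuousFunction.ofNormedAddCommGroupDiscrete
        (fun x => ∑' y, a x y * u y) (C * ‖u‖) (h.norm_tsum_le u)
      map_add' := fun u v => by
        ext x
        simp only [BoundedContinuousFunction.coe_ofNormedAddCommGroupDiscrete,
          BoundedContinuousFunction.coe_add, Pi.add_apply, mul_add]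
        exact (h.summable_mul u x).tsum_add (h.summable_mul v x)
      map_smul' := fun c u => by
        ext x
        simp only [BoundedContinuousFunction.coe_ofNormedAddCommGroupDiscrete,
          BoundedContinuousFunction.coe_smul, smul_eq_mul, RingHom.id_apply]
        rw [← tsum_mul_left]
        exact tsum_congr fun y => by ring }
    (max C 0) fun u => by
      refine (BoundedContinuousFunction.norm_le (by positivity)).2 fun x => ?_
      refine (h.norm_tsum_le u x).trans ?_
      exact mul_le_mul_of_nonneg_right (le_max_left _ _) (norm_nonneg _)

theorem IsBoundedKernel.op_apply (h : IsBoundedKernel a C) (u : X →ᵇ ℝ) (x : X) :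
    h.op u x = ∑' y, a x y * u y := rfl

theorem hasSum_expOp_eval (T : (X →ᵇ ℝ) →L[ℝ] (X →ᵇ ℝ)) (t : ℝ) (u : X →ᵇ ℝ) (x : X) :
    HasSum (fun k : ℕ => t ^ k / (k.factorial : ℝ) * (T ^ k) u x) (expOp T t u x) :=
  (hasSum_expOp_apply T t u).mapL (BoundedContinuousFunction.evalCLM ℝ x)

variable [DecidableEq X]

/-- The indicator function of a point, as a bounded function. -/
def pointFn (y : X) : X →ᵇ ℝ :=
  BoundedContinuousFunction.ofNormedAddCommGroupDiscrete (fun x => if x = y then 1 else 0) 1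
    fun x => by split_ifs <;> simp

theorem pointFn_apply (x y : X) : pointFn y x = if x = y then 1 else 0 := rfl

theorem IsBoundedKernel.matPow_eq (h : IsBoundedKernel a C) (k : ℕ) (x y : X) :
    matPow a k x y = (h.op ^ k) (pointFn y) x := by
  induction k generalizing x with
  | zero => rfl
  | succ k ih =>
    rw [pow_succ', mul_apply_eq_comp, h.op_apply]
    exact tsum_congr fun z => by rw [ih]

/-- Links the entrywise series to the operator exponential, so that operator calculus applies. -/
theorem IsBoundedKernel.semigroup_eq (h : IsBoundedKernel a C) (t : ℝ) (x y : X) :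
    semigroup a t x y = expOp h.op t (pointFn y) x := by
  rw [← (hasSum_expOp_eval h.op t (pointFn y) x).tsum_eq]
  exact tsum_congr fun k => by rw [h.matPow_eq]

/-- A function with finite support, as a bounded function. -/
def finiteFn (f : X → ℝ) (hf : f.support.Finite) : X →ᵇ ℝ :=
  ∑ z ∈ hf.toFinset, f z • pointFn z

theorem sum_smul_pointFn_apply (f : X → ℝ) (s : Finset X) (x : X) :
    (∑ z ∈ s, f z • pointFn z : X →ᵇ ℝ) x = if x ∈ s then f x else 0 := by
  simp [BoundedContinuousFunction.sum_apply, pointFn_apply]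

theorem finiteFn_apply (f : X → ℝ) (hf : f.support.Finite) (x : X) : finiteFn f hf x = f x := by
  rw [finiteFn, sum_smul_pointFn_apply]
  split_ifs with h
  · rfl
  · simpa using (Eq.symm (by simpa using h))

theorem IsBoundedKernel.semigroupApply_eq (h : IsBoundedKernel a C) (t : ℝ) (f : X → ℝ)
    (hf : f.support.Finite) (x : X) :
    semigroupApply a t f x = expOp h.op t (finiteFn f hf) x := by
  rw [semigroupApply, tsum_eq_sum (s := hf.toFinset)]
  · have : expOp h.op t (finiteFn f hf) = ∑ z ∈ hf.toFinset, f z • expOp h.op t (pointFn z) := by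
      simp [finiteFn, map_sum]
    rw [this, BoundedContinuousFunction.sum_apply]
    exact Finset.sum_congr rfl fun z _ => by rw [h.semigroup_eq]; rfl
  · intro z hz
    have : f z = 0 := by simpa using hz
    rw [this, zero_mul]

end BoundedKernel

/-! ### Non-negative kernels with constant row sums -/

/-- The kernel `a` is non-negative and all its rows sum to `lam`. -/
structure IsPositiveKernel {X : Type*} (a : X → X → ℝ) (lam : ℝ) : Prop where
  nonneg : ∀ x y, 0 ≤ a x y
  hasSum : ∀ x, HasSum (a x) lam

section PositiveKernel

variable {X : Type*} [TopologicalSpace X] [DiscreteTopology X] {a : X → X → ℝ} {lam : ℝ}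

theorem IsPositiveKernel.isBounded (h : IsPositiveKernel a lam) : IsBoundedKernel a lam where
  summable x := by simpa only [abs_of_nonneg (h.nonneg x _)] using (h.hasSum x).summable
  tsum_le x := by simpa only [abs_of_nonneg (h.nonneg x _)] using (h.hasSum x).tsum_eq.le

/-- The operator of a non-negative kernel. -/
def IsPositiveKernel.op (h : IsPositiveKernel a lam) : (X →ᵇ ℝ) →L[ℝ] (X →ᵇ ℝ) := h.isBounded.op

theorem IsPositiveKernel.hasSum_op (h : IsPositiveKernel a lam) (u : X →ᵇ ℝ) (x : X) :
    HasSum (fun y => a x y * u y) (h.op u x) :=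
  (h.isBounded.summable_mul u x).hasSum

theorem IsPositiveKernel.op_nonneg (h : IsPositiveKernel a lam) {u : X →ᵇ ℝ}
    (hu : ∀ x, 0 ≤ u x) (x : X) : 0 ≤ h.op u x :=
  (h.hasSum_op u x).nonneg fun y => mul_nonneg (h.nonneg x y) (hu y)

theorem IsPositiveKernel.pow_op_nonneg (h : IsPositiveKernel a lam) {u : X →ᵇ ℝ}
    (hu : ∀ x, 0 ≤ u x) (k : ℕ) : ∀ x, 0 ≤ (h.op ^ k) u x := by
  induction k with
  | zero => exact hu
  | succ k ih =>
    rw [pow_succ', mul_apply_eq_comp]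
    exact h.op_nonneg ih

theorem IsPositiveKernel.expOp_nonneg (h : IsPositiveKernel a lam) {u : X →ᵇ ℝ}
    (hu : ∀ x, 0 ≤ u x) {t : ℝ} (ht : 0 ≤ t) (x : X) : 0 ≤ expOp h.op t u x :=
  (hasSum_expOp_eval h.op t u x).nonneg fun k =>
    mul_nonneg (by positivity) (h.pow_op_nonneg hu k x)

theorem IsPositiveKernel.expOp_mono (h : IsPositiveKernel a lam) {u v : X →ᵇ ℝ}
    (huv : ∀ x, u x ≤ v x) {t : ℝ} (ht : 0 ≤ t) (x : X) : expOp h.op t u x ≤ expOp h.op t v x := by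
  have := h.expOp_nonneg (u := v - u) (fun x => sub_nonneg.2 (huv x)) ht x
  rw [map_sub] at this
  exact sub_nonneg.1 this

theorem IsPositiveKernel.abs_op_le (h : IsPositiveKernel a lam) {u : X →ᵇ ℝ} {M : ℝ}
    (hu : ∀ x, |u x| ≤ M) (x : X) : |h.op u x| ≤ lam * M := by
  have h1 := (h.hasSum x).mul_right M
  rw [abs_le]
  constructor
  · refine hasSum_le (fun y => ?_) h1.neg (h.hasSum_op u x)
    have := mul_le_mul_of_nonneg_left (abs_le.1 (hu y)).1 (h.nonneg x y)
    linarith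
  · exact hasSum_le (fun y => mul_le_mul_of_nonneg_left (abs_le.1 (hu y)).2 (h.nonneg x y))
      (h.hasSum_op u x) h1

theorem IsPositiveKernel.abs_pow_op_le (h : IsPositiveKernel a lam) {u : X →ᵇ ℝ} {M : ℝ}
    (hu : ∀ x, |u x| ≤ M) (k : ℕ) : ∀ x, |(h.op ^ k) u x| ≤ lam ^ k * M := by
  induction k with
  | zero => simpa using hu
  | succ k ih =>
    intro x
    rw [pow_succ', mul_apply_eq_comp, pow_succ', mul_assoc]
    exact h.abs_op_le ih x

end PositiveKernel

/-! ### Inequalities between moments -/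

/-- The Cauchy-Schwarz inequality for the moments of a weight on `ℕ`. -/
theorem sq_hasSum_mul_le {w r : ℕ → ℝ} (hw : ∀ k, 0 ≤ w k) {W A B : ℝ} (hW : HasSum w W)
    (hA : HasSum (fun k => r k * w k) A) (hB : HasSum (fun k => r k ^ 2 * w k) B) :
    A ^ 2 ≤ W * B := by
  -- Cauchy-Schwarz through a discriminant: the quadratic in s is the sum of (s - r_k)² w_k.
  have h : ∀ s : ℝ, 0 ≤ W * (s * s) + (-2 * A) * s + B := by
    intro s
    have := ((hW.mul_left (s * s)).add (hA.mul_left (-2 * s))).add hB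
    have h0 := this.nonneg fun k => by
      have : s * s * w k + -2 * s * (r k * w k) + r k ^ 2 * w k = (s - r k) ^ 2 * w k := by ring
      rw [this]
      exact mul_nonneg (sq_nonneg _) (hw k)
    linarith
  have := discrim_le_zero h
  rw [discrim] at this
  nlinarith

/-- The factor `2 ^ k` is what turns time t into time 2t in an exponential series. -/
theorem descFactorial_le_factorial_mul_two_pow (k j : ℕ) :
    (k.descFactorial j : ℝ) ≤ j.factorial * 2 ^ k := by
  rw [Nat.descFactorial_eq_factorial_mul_choose]
  push_cast
  have : (k.choose j : ℝ) ≤ 2 ^ k := by exact_mod_cast Nat.choose_le_two_pow k j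
  gcongr

/-- Term by term derivatives of an exponential generating series. -/
theorem hasSum_descFactorial_mul {c : ℕ → ℝ} {t S : ℝ} (j : ℕ)
    (h : HasSum (fun k : ℕ => t ^ k / (k.factorial : ℝ) * c (k + j)) S) :
    HasSum (fun k : ℕ => (k.descFactorial j : ℝ) * (t ^ k / (k.factorial : ℝ) * c k))
      (t ^ j * S) := by
  rw [← hasSum_nat_add_iff' j]
  have h0 : ∑ i ∈ Finset.range j, (i.descFactorial j : ℝ) * (t ^ i / (i.factorial : ℝ) * c i) = 0 :=
    Finset.sum_eq_zero fun i hi => by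
      rw [Nat.descFactorial_of_lt (Finset.mem_range.1 hi)]; simp
  rw [h0, sub_zero]
  suffices e : ∀ k : ℕ, ((k + j).descFactorial j : ℝ) * (t ^ (k + j) / ((k + j).factorial : ℝ) *
      c (k + j)) = t ^ j * (t ^ k / (k.factorial : ℝ) * c (k + j)) by
    rw [funext e]
    exact h.mul_left (t ^ j)
  intro k
  have hk : ((k.factorial : ℝ)) * (k + j).descFactorial j = (k + j).factorial := by
    exact_mod_cast by simpa using Nat.factorial_mul_descFactorial (Nat.le_add_left j k)
  have h1 : (k.factorial : ℝ) ≠ 0 := by positivity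
  have h2 : ((k + j).descFactorial j : ℝ) ≠ 0 := by
    intro h0
    rw [h0, mul_zero] at hk
    exact (by positivity : ((k + j).factorial : ℝ) ≠ 0) hk.symm
  rw [← hk, pow_add]
  field_simp

section PositiveKernel

variable {X : Type*} [TopologicalSpace X] [DiscreteTopology X] {a : X → X → ℝ} {lam : ℝ}

theorem hasSum_descFactorial_expOp (T : (X →ᵇ ℝ) →L[ℝ] (X →ᵇ ℝ)) (t : ℝ) (u : X →ᵇ ℝ) (x : X)
    (j : ℕ) : HasSum (fun k : ℕ => (k.descFactorial j : ℝ) *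
      (t ^ k / (k.factorial : ℝ) * (T ^ k) u x)) (t ^ j * (T ^ j) (expOp T t u) x) := by
  refine hasSum_descFactorial_mul (c := fun k => (T ^ k) u x) j ?_
  have h1 : (T ^ j) (expOp T t u) = expOp T t ((T ^ j) u) :=
    congrArg (fun A : (X →ᵇ ℝ) →L[ℝ] (X →ᵇ ℝ) => A u) ((commute_expOp T t).pow_left j).eq
  rw [h1]
  simpa only [pow_add, mul_apply_eq_comp] using hasSum_expOp_eval T t ((T ^ j) u) x

/-- Second moment inequality: `(t F')² ≤ F (t² F'' + t F')` for `F = e^{tT} u`. -/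
theorem IsPositiveKernel.sq_op_expOp_le (h : IsPositiveKernel a lam) {u : X →ᵇ ℝ}
    (hu : ∀ x, 0 ≤ u x) {t : ℝ} (ht : 0 ≤ t) (x : X) :
    (t * h.op (expOp h.op t u) x) ^ 2 ≤ expOp h.op t u x *
      (t ^ 2 * h.op (h.op (expOp h.op t u)) x + t * h.op (expOp h.op t u) x) := by
  have h0 := hasSum_expOp_eval h.op t u x
  have h1 := hasSum_descFactorial_expOp h.op t u x 1
  have h2 := hasSum_descFactorial_expOp h.op t u x 2
  rw [pow_one, pow_one] at h1
  rw [pow_two h.op, mul_apply_eq_comp] at h2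
  refine sq_hasSum_mul_le (r := fun k => (k : ℝ))
    (fun k => mul_nonneg (by positivity) (h.pow_op_nonneg hu k x)) h0 ?_ ?_
  · simpa using h1
  -- k² = k(k - 1) + k.
  · convert h2.add h1 using 2 with k
    rw [← add_mul]
    congr 1
    rcases k with _ | k
    · simp
    · simp [Nat.descFactorial]
      ring

/-- `t^j F^{(j)}(t) ≤ j! F(2t)` for `F = e^{tT} u`. -/
theorem IsPositiveKernel.pow_op_expOp_le (h : IsPositiveKernel a lam) {u : X →ᵇ ℝ}
    (hu : ∀ x, 0 ≤ u x) {t : ℝ} (ht : 0 ≤ t) (x : X) (j : ℕ) :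
    t ^ j * (h.op ^ j) (expOp h.op t u) x ≤ j.factorial * expOp h.op (2 * t) u x := by
  refine hasSum_le (fun k => ?_) (hasSum_descFactorial_expOp h.op t u x j)
    ((hasSum_expOp_eval h.op (2 * t) u x).mul_left (j.factorial : ℝ))
  have hk := h.pow_op_nonneg hu k x
  have : (j.factorial : ℝ) * ((2 * t) ^ k / k.factorial * (h.op ^ k) u x) =
      (j.factorial * 2 ^ k) * (t ^ k / k.factorial * (h.op ^ k) u x) := by
    rw [mul_pow]; ring
  rw [this]
  exact mul_le_mul_of_nonneg_right (descFactorial_le_factorial_mul_two_pow k j) (by positivity)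

/-- `F(2t)² ≤ F(t) F(4t)` for `F = e^{tT} u`. -/
theorem IsPositiveKernel.sq_expOp_two_mul_le (h : IsPositiveKernel a lam) {u : X →ᵇ ℝ}
    (hu : ∀ x, 0 ≤ u x) {t : ℝ} (ht : 0 ≤ t) (x : X) :
    expOp h.op (2 * t) u x ^ 2 ≤ expOp h.op t u x * expOp h.op (4 * t) u x := by
  refine sq_hasSum_mul_le (r := fun k => 2 ^ k)
    (fun k => mul_nonneg (by positivity) (h.pow_op_nonneg hu k x))
    (hasSum_expOp_eval h.op t u x) ?_ ?_
  · convert hasSum_expOp_eval h.op (2 * t) u x using 2 with k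
    rw [mul_pow]; ring
  · convert hasSum_expOp_eval h.op (4 * t) u x using 2 with k
    rw [mul_pow, ← pow_mul, mul_comm k 2, pow_mul]; norm_num; ring

end PositiveKernel

/-! ### The function `F log F` along a positive semigroup -/

theorem abs_mul_log_le (r : ℝ) : |r * Real.log r| ≤ 1 + r ^ 2 := by
  rw [abs_mul, ← abs_abs r, ← Real.log_abs r]
  rcases (abs_nonneg r).eq_or_lt with h | h
  · simp only [← h, zero_mul, abs_zero]
    positivity
  rw [abs_abs, ← sq_abs r]
  generalize |r| = s at *
  rcases le_total s 1 with h1 | h1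
  · have := (Real.abs_log_mul_self_lt s h h1).le
    rw [abs_mul, abs_of_pos h] at this
    nlinarith [sq_nonneg s]
  · rw [abs_of_nonneg (Real.log_nonneg h1)]
    nlinarith [Real.log_le_self h.le]

/-- Bounds for the first three derivatives of `F log F`, when the derivatives of `F` are controlled
by powers of `F`. -/
theorem abs_deriv_mul_log_le {F F₁ F₂ F₃ D K b : ℝ} (hF : 0 < F) (hD : 0 ≤ D) (hK : 1 ≤ K)
    (hb : 1 ≤ b) (hFb : F ≤ b ^ 4) (hDF : D ^ 2 ≤ F * b ^ 4) (h₁ : F₁ ^ 2 ≤ K * (F * D))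
    (h₂ : |F₂| ≤ K * D) (h₃ : |F₃| ≤ K * D) :
    |F₁ * (1 + Real.log F)| ≤ 13 * K ^ 3 * b ^ 5 ∧
    |F₂ * (1 + Real.log F) + F₁ ^ 2 / F| ≤ 13 * K ^ 3 * b ^ 5 ∧
    |F₃ * (1 + Real.log F) + 3 * F₁ * F₂ / F - F₁ ^ 3 / F ^ 2| ≤ 13 * K ^ 3 * b ^ 5 := by
  -- With F = r⁴ the hypotheses become D ≤ r²b² and |F₁| ≤ K r³b. The powers of r then cancel every
  -- denominator, and a spare factor r tames the logarithm.
  obtain ⟨r, hr, rfl⟩ : ∃ r : ℝ, 0 < r ∧ r ^ 4 = F :=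
    ⟨√√F, by positivity, by
      rw [show (4 : ℕ) = 2 * 2 from rfl, pow_mul, Real.sq_sqrt (by positivity),
        Real.sq_sqrt hF.le]⟩
  have hb0 : 0 < b := by linarith
  have hK0 : 0 < K := by linarith
  have hrb : r ≤ b := (pow_le_pow_iff_left₀ hr.le hb0.le (by norm_num)).1 hFb
  have hD' : D ≤ r ^ 2 * b ^ 2 := by
    refine (pow_le_pow_iff_left₀ hD (by positivity) (two_ne_zero)).1 (hDF.trans_eq ?_)
    ring
  have hF1 : |F₁| ≤ K * r ^ 3 * b := by
    refine abs_le_of_sq_le_sq ?_ (by positivity)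
    calc F₁ ^ 2 ≤ K * (r ^ 4 * D) := h₁
      _ ≤ K * (r ^ 4 * (r ^ 2 * b ^ 2)) := by gcongr
      _ ≤ K * (K * (r ^ 4 * (r ^ 2 * b ^ 2))) := by
        refine mul_le_mul_of_nonneg_left ?_ hK0.le
        exact le_mul_of_one_le_left (by positivity) hK
      _ = (K * r ^ 3 * b) ^ 2 := by ring
  have hF2 : |F₂| ≤ K * (r ^ 2 * b ^ 2) := h₂.trans (by gcongr)
  have hF3 : |F₃| ≤ K * (r ^ 2 * b ^ 2) := h₃.trans (by gcongr)
  -- r(1 + 4|log r|) ≤ r + 4(1 + r²) ≤ 9b², as r ≤ b and b ≥ 1.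
  have hL : r * |1 + Real.log (r ^ 4)| ≤ 9 * b ^ 2 := by
    rw [Real.log_pow]
    have h1 := abs_mul_log_le r
    rw [abs_mul, abs_of_pos hr] at h1
    have h2 : |1 + (4 : ℕ) * Real.log r| ≤ 1 + 4 * |Real.log r| := by
      refine (abs_add_le _ _).trans ?_
      rw [abs_mul]; norm_num
    have h3 := mul_le_mul_of_nonneg_left h2 hr.le
    nlinarith
  set l := |1 + Real.log (r ^ 4)| with hl
  have hl0 : 0 ≤ l := abs_nonneg _
  have hKK : K ≤ K ^ 3 := le_self_pow₀ hK (by norm_num)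
  have hKK2 : K ^ 2 ≤ K ^ 3 := pow_le_pow_right₀ hK (by norm_num)
  have hbb : b ^ 4 ≤ b ^ 5 := pow_le_pow_right₀ hb (by norm_num)
  have hA : |F₁ * (1 + Real.log (r ^ 4))| ≤ 9 * (K ^ 3 * b ^ 5) := by
    rw [abs_mul, ← hl]
    calc |F₁| * l ≤ K * r ^ 3 * b * l := by gcongr
      _ = K * r ^ 2 * b * (r * l) := by ring
      _ ≤ K * b ^ 2 * b * (9 * b ^ 2) := by gcongr
      _ = 9 * (K * b ^ 5) := by ring
      _ ≤ 9 * (K ^ 3 * b ^ 5) := by gcongr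
  have hB : ∀ G : ℝ, |G| ≤ K * (r ^ 2 * b ^ 2) →
      |G * (1 + Real.log (r ^ 4))| ≤ 9 * (K ^ 3 * b ^ 5) := by
    intro G hG
    rw [abs_mul, ← hl]
    calc |G| * l ≤ K * (r ^ 2 * b ^ 2) * l := by gcongr
      _ = K * r * b ^ 2 * (r * l) := by ring
      _ ≤ K * b * b ^ 2 * (9 * b ^ 2) := by gcongr
      _ = 9 * (K * b ^ 5) := by ring
      _ ≤ 9 * (K ^ 3 * b ^ 5) := by gcongr
  have hC : |F₁ ^ 2 / r ^ 4| ≤ K ^ 3 * b ^ 5 := by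
    rw [abs_div, abs_pow, abs_of_pos (by positivity : 0 < r ^ 4), div_le_iff₀ (by positivity)]
    calc |F₁| ^ 2 ≤ (K * r ^ 3 * b) ^ 2 := by gcongr
      _ = K ^ 2 * (r ^ 2 * b ^ 2) * r ^ 4 := by ring
      _ ≤ K ^ 3 * (b ^ 2 * b ^ 2) * r ^ 4 := by gcongr
      _ = K ^ 3 * b ^ 4 * r ^ 4 := by ring
      _ ≤ K ^ 3 * b ^ 5 * r ^ 4 := by gcongr
  have hD2 : |3 * F₁ * F₂ / r ^ 4| ≤ 3 * (K ^ 3 * b ^ 5) := by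
    rw [abs_div, abs_mul, abs_mul, abs_of_pos (by positivity : 0 < r ^ 4),
      div_le_iff₀ (by positivity), abs_of_pos (by norm_num : (0 : ℝ) < 3)]
    calc 3 * |F₁| * |F₂| ≤ 3 * (K * r ^ 3 * b) * (K * (r ^ 2 * b ^ 2)) := by gcongr
      _ = 3 * (K ^ 2 * (r * b ^ 3)) * r ^ 4 := by ring
      _ ≤ 3 * (K ^ 3 * (b * b ^ 3)) * r ^ 4 := by gcongr
      _ = 3 * (K ^ 3 * b ^ 4) * r ^ 4 := by ring
      _ ≤ 3 * (K ^ 3 * b ^ 5) * r ^ 4 := by gcongr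
  have hE : |F₁ ^ 3 / (r ^ 4) ^ 2| ≤ K ^ 3 * b ^ 5 := by
    rw [abs_div, abs_pow, abs_of_pos (by positivity : 0 < (r ^ 4) ^ 2),
      div_le_iff₀ (by positivity)]
    calc |F₁| ^ 3 ≤ (K * r ^ 3 * b) ^ 3 := by gcongr
      _ = K ^ 3 * (r * b ^ 3) * (r ^ 4) ^ 2 := by ring
      _ ≤ K ^ 3 * (b * b ^ 3) * (r ^ 4) ^ 2 := by gcongr
      _ = K ^ 3 * b ^ 4 * (r ^ 4) ^ 2 := by ring
      _ ≤ K ^ 3 * b ^ 5 * (r ^ 4) ^ 2 := by gcongr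
  have h0 : 0 ≤ K ^ 3 * b ^ 5 := by positivity
  refine ⟨by linarith, ?_, ?_⟩
  · have := abs_add_le (F₂ * (1 + Real.log (r ^ 4))) (F₁ ^ 2 / r ^ 4)
    linarith [hB F₂ hF2]
  · have h4 := abs_sub (F₃ * (1 + Real.log (r ^ 4)) + 3 * F₁ * F₂ / r ^ 4) (F₁ ^ 3 / (r ^ 4) ^ 2)
    have h5 := abs_add_le (F₃ * (1 + Real.log (r ^ 4))) (3 * F₁ * F₂ / r ^ 4)
    linarith [hB F₃ hF3]

/-! ### Differentiation in the uniform norm from pointwise derivatives. -/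

section Pointwise

variable {X : Type*} [TopologicalSpace X] [DiscreteTopology X]

open scoped Classical in
/-- A bounded function as an element of the space of bounded functions; `0` if it is unbounded. -/
def boundedFn (u : X → ℝ) : X →ᵇ ℝ :=
  if h : ∃ C, ∀ x, ‖u x‖ ≤ C then
    BoundedContinuousFunction.ofNormedAddCommGroupDiscrete u h.choose h.choose_spec else 0

theorem boundedFn_apply {u : X → ℝ} {C : ℝ} (h : ∀ x, |u x| ≤ C) (x : X) :
    boundedFn u x = u x := by
  rw [boundedFn, dif_pos ⟨C, h⟩]
  rfl

/-- A family of bounded functions that is pointwise twice differentiable, with uniformly bounded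
second derivatives, is differentiable for the uniform norm. -/
theorem hasDerivAt_of_pointwise {v v₁ : ℝ → (X →ᵇ ℝ)} {v₂ : ℝ → X → ℝ} {p q C : ℝ}
    (h₁ : ∀ t ∈ Set.Ioo p q, ∀ x, HasDerivAt (fun t => v t x) (v₁ t x) t)
    (h₂ : ∀ t ∈ Set.Ioo p q, ∀ x, HasDerivAt (fun t => v₁ t x) (v₂ t x) t)
    (hC : ∀ t ∈ Set.Ioo p q, ∀ x, |v₂ t x| ≤ C) {t : ℝ} (ht : t ∈ Set.Ioo p q) :
    HasDerivAt v (v₁ t) t := by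
  -- A second-order remainder estimate at each point x, with a constant that does not depend on x.
  have key : ∀ s ∈ Set.Ioo p q, ‖v s - v t - (s - t) • v₁ t‖ ≤ |C| * ‖s - t‖ * ‖s - t‖ := by
    intro s hs
    refine (BoundedContinuousFunction.norm_le (by positivity)).2 fun x => ?_
    have hsub : Set.uIcc t s ⊆ Set.Ioo p q := Set.ordConnected_Ioo.uIcc_subset ht hs
    have hA : ∀ r ∈ Set.uIcc t s, ‖v₁ r x - v₁ t x‖ ≤ |C| * ‖s - t‖ := by
      intro r hr
      have := (convex_uIcc t s).norm_image_sub_le_of_norm_hasDerivWithin_le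
        (f := fun r => v₁ r x) (f' := fun r => v₂ r x) (C := |C|)
        (fun r hr => (h₂ r (hsub hr) x).hasDerivWithinAt)
        (fun r hr => (hC r (hsub hr) x).trans (le_abs_self C)) Set.left_mem_uIcc hr
      refine this.trans (mul_le_mul_of_nonneg_left ?_ (abs_nonneg _))
      simpa [Real.norm_eq_abs, abs_sub_comm] using Set.abs_sub_left_of_mem_uIcc hr
    have hB := (convex_uIcc t s).norm_image_sub_le_of_norm_hasDerivWithin_le
      (f := fun r => v r x - r * v₁ t x) (f' := fun r => v₁ r x - v₁ t x) (C := |C| * ‖s - t‖)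
      (fun r hr => by
        have hd := (h₁ r (hsub hr) x).sub ((hasDerivAt_id r).mul_const (v₁ t x))
        rw [one_mul] at hd
        exact hd.hasDerivWithinAt)
      hA Set.left_mem_uIcc Set.right_mem_uIcc
    refine le_of_eq_of_le ?_ hB
    congr 1
    simp
    ring
  rw [hasDerivAt_iff_isLittleO, Asymptotics.isLittleO_iff]
  intro ε hε
  have h0 : Tendsto (fun s => |C| * ‖s - t‖) (𝓝 t) (𝓝 (|C| * ‖t - t‖)) :=
    (Continuous.tendsto (by fun_prop) t)
  rw [sub_self, norm_zero, mul_zero] at h0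
  filter_upwards [h0.eventually_lt_const hε, Ioo_mem_nhds ht.1 ht.2] with s hs1 hs2
  exact (key s hs2).trans (mul_le_mul_of_nonneg_right hs1.le (norm_nonneg _))

end Pointwise

section EntropyPath

variable {X : Type*} [TopologicalSpace X] [DiscreteTopology X] {a : X → X → ℝ} {lam : ℝ}

/-- The function `v log v`. -/
def entFn (v : X →ᵇ ℝ) : X →ᵇ ℝ := boundedFn fun x => v x * Real.log (v x)

theorem entFn_apply (v : X →ᵇ ℝ) (x : X) : entFn v x = v x * Real.log (v x) := by
  refine boundedFn_apply (C := 1 + ‖v‖ ^ 2) (fun x => (abs_mul_log_le _).trans ?_) x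
  have := v.norm_coe_le_norm x
  rw [Real.norm_eq_abs] at this
  have h2 := pow_le_pow_left₀ (abs_nonneg _) this 2
  rw [sq_abs] at h2
  linarith

/-- r log r is uniformly continuous on compact intervals, the point 0 included. Continuity up to
time 0 needs this, because f may vanish. -/
theorem continuous_entFn : Continuous (entFn : (X →ᵇ ℝ) → (X →ᵇ ℝ)) := by
  rw [Metric.continuous_iff]
  intro v ε hε
  have huc : UniformContinuousOn (fun r : ℝ => r * Real.log r) (Set.Icc (-(‖v‖ + 1)) (‖v‖ + 1)) :=
    isCompact_Icc.uniformContinuousOn_of_continuous Real.continuous_mul_log.continuousOn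
  obtain ⟨δ, hδ, h⟩ := Metric.uniformContinuousOn_iff.1 huc (ε / 2) (by positivity)
  refine ⟨min δ 1, by positivity, fun w hw => ?_⟩
  refine lt_of_le_of_lt ((BoundedContinuousFunction.dist_le (by positivity)).2 fun x => ?_)
    (half_lt_self hε)
  have hd := (BoundedContinuousFunction.dist_coe_le_dist (f := w) (g := v) x).trans_lt hw
  have hv := v.norm_coe_le_norm x
  rw [Real.norm_eq_abs] at hv
  have hd1 := hd.trans_le (min_le_right _ _)
  rw [Real.dist_eq] at hd1
  rw [entFn_apply, entFn_apply]
  refine (h _ ?_ _ ?_ (hd.trans_le (min_le_left _ _))).le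
  · rw [Set.mem_Icc, ← abs_le]
    have := abs_sub_abs_le_abs_sub (w x) (v x)
    linarith
  · rw [Set.mem_Icc, ← abs_le]
    linarith

/-- The first derivative of `entFn` along `t ↦ v` when `v' = T v`. -/
def entFn₁ (T : (X →ᵇ ℝ) →L[ℝ] (X →ᵇ ℝ)) (v : X →ᵇ ℝ) : X →ᵇ ℝ :=
  boundedFn fun x => T v x * (1 + Real.log (v x))

/-- The second derivative of `entFn` along `t ↦ v` when `v' = T v`. -/
def entFn₂ (T : (X →ᵇ ℝ) →L[ℝ] (X →ᵇ ℝ)) (v : X →ᵇ ℝ) : X →ᵇ ℝ :=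
  boundedFn fun x => T (T v) x * (1 + Real.log (v x)) + T v x ^ 2 / v x

theorem hasDerivAt_expOp_eval (T : (X →ᵇ ℝ) →L[ℝ] (X →ᵇ ℝ)) (f : X →ᵇ ℝ) (t : ℝ) (x : X) :
    HasDerivAt (fun t => expOp T t f x) (T (expOp T t f) x) t :=
  HasFDerivAt.comp_hasDerivAt (f := fun t => expOp T t f) t
    (BoundedContinuousFunction.evalCLM ℝ x : (X →ᵇ ℝ) →L[ℝ] ℝ).hasFDerivAt
    (hasDerivAt_expOp_apply T f t)

theorem hasDerivAt_op_expOp (T : (X →ᵇ ℝ) →L[ℝ] (X →ᵇ ℝ)) (f : X →ᵇ ℝ) (t : ℝ) (x : X) :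
    HasDerivAt (fun t => T (expOp T t f) x) (T (T (expOp T t f)) x) t := by
  simpa only [← commute_expOp_apply] using hasDerivAt_expOp_eval T (T f) t x

theorem continuous_expOp_apply (T : (X →ᵇ ℝ) →L[ℝ] (X →ᵇ ℝ)) (f : X →ᵇ ℝ) :
    Continuous fun t => expOp T t f :=
  continuous_iff_continuousAt.2 fun t => (hasDerivAt_expOp_apply T f t).continuousAt

variable {f : X →ᵇ ℝ}

/-- F = e^{tT}f may come arbitrarily close to 0, so log F is unbounded and has to be compensated by
powers of F. `abs_deriv_mul_log_le` does this with D = F(2t): the moment inequalities bound the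
derivatives of F by F(2t), and F(2t)² by F(t)F(4t). -/
theorem IsPositiveKernel.exists_abs_deriv_le (h : IsPositiveKernel a lam) (hf : ∀ x, 0 ≤ f x)
    (hpos : ∀ t, 0 < t → ∀ x, 0 < expOp h.op t f x) {p : ℝ} (hp : 0 < p) (q : ℝ) :
    ∃ C, ∀ t ∈ Set.Ioo p q, ∀ x,
      |h.op (expOp h.op t f) x * (1 + Real.log (expOp h.op t f x))| ≤ C ∧
      |h.op (h.op (expOp h.op t f)) x * (1 + Real.log (expOp h.op t f x)) +
        h.op (expOp h.op t f) x ^ 2 / expOp h.op t f x| ≤ C ∧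
      |h.op (h.op (h.op (expOp h.op t f))) x * (1 + Real.log (expOp h.op t f x)) +
        3 * h.op (expOp h.op t f) x * h.op (h.op (expOp h.op t f)) x / expOp h.op t f x -
        h.op (expOp h.op t f) x ^ 3 / expOp h.op t f x ^ 2| ≤ C := by
  -- The interval extends to 4q because F(4t) enters.
  obtain ⟨B, hB⟩ := (isCompact_Icc (a := p) (b := 4 * q)).exists_bound_of_continuousOn
    (continuous_expOp_apply h.op f).continuousOn
  set b := max B 1
  have hb : 1 ≤ b := le_max_right _ _
  have hbound : ∀ t ∈ Set.Icc p (4 * q), ∀ x, expOp h.op t f x ≤ b ^ 4 := by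
    intro t ht x
    calc expOp h.op t f x ≤ ‖expOp h.op t f x‖ := le_abs_self _
      _ ≤ ‖expOp h.op t f‖ := BoundedContinuousFunction.norm_coe_le_norm _ _
      _ ≤ B := hB t ht
      _ ≤ b := le_max_left _ _
      _ ≤ b ^ 4 := le_self_pow₀ hb (by norm_num)
  -- `5 / p ^ 2` covers the constant 3 in the bound of F₁² and the constant 2! in that of F₂; `6 / p
  -- ^ 3` covers 3! in that of F₃.
  set K := 1 + 5 / p ^ 2 + 6 / p ^ 3
  have hK : 1 ≤ K := by
    have : 0 ≤ 5 / p ^ 2 + 6 / p ^ 3 := by positivity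
    simp only [K]; linarith
  have hK2 : 5 / p ^ 2 ≤ K := by
    have : 0 ≤ 6 / p ^ 3 := by positivity
    simp only [K]; linarith
  have hK3 : 6 / p ^ 3 ≤ K := by
    have : 0 ≤ 5 / p ^ 2 := by positivity
    simp only [K]; linarith
  refine ⟨13 * K ^ 3 * b ^ 5, fun t ht x => ?_⟩
  have ht0 : 0 < t := hp.trans ht.1
  have hD0 : 0 ≤ expOp h.op (2 * t) f x := h.expOp_nonneg hf (by positivity) x
  have hF0 := hpos t ht0 x
  have e1 := h.pow_op_expOp_le hf ht0.le x 1
  have e2 := h.pow_op_expOp_le hf ht0.le x 2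
  have e3 := h.pow_op_expOp_le hf ht0.le x 3
  have p1 := h.pow_op_nonneg (h.expOp_nonneg hf ht0.le) 1 x
  have p2 := h.pow_op_nonneg (h.expOp_nonneg hf ht0.le) 2 x
  have p3 := h.pow_op_nonneg (h.expOp_nonneg hf ht0.le) 3 x
  simp only [pow_one, Nat.factorial_one, Nat.cast_one, one_mul] at e1 p1
  simp only [pow_succ' h.op, pow_zero, mul_one, mul_apply_eq_comp] at e2 e3 p2 p3
  norm_num [Nat.factorial] at e2 e3
  have hsq := h.sq_op_expOp_le hf ht0.le x
  have hlog := h.sq_expOp_two_mul_le hf ht0.le x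
  have hQ := hbound (4 * t) ⟨by linarith [ht.1], by linarith [ht.2]⟩ x
  refine abs_deriv_mul_log_le (D := expOp h.op (2 * t) f x) hF0 hD0 hK hb
    (hbound t ⟨ht.1.le, by linarith [ht.2]⟩ x) (hlog.trans (by gcongr)) ?_ ?_ ?_
  · have h3 : t ^ 2 * h.op (expOp h.op t f) x ^ 2 ≤
        3 * (expOp h.op t f x * expOp h.op (2 * t) f x) := by
      have := mul_le_mul_of_nonneg_left (add_le_add e2 e1) hF0.le
      linarith
    have h4 : p ^ 2 * h.op (expOp h.op t f) x ^ 2 ≤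
        5 * (expOp h.op t f x * expOp h.op (2 * t) f x) := by
      have h5 : p ^ 2 ≤ t ^ 2 := pow_le_pow_left₀ hp.le ht.1.le 2
      have h6 := mul_le_mul_of_nonneg_right h5 (sq_nonneg (h.op (expOp h.op t f) x))
      have h7 : 0 ≤ expOp h.op t f x * expOp h.op (2 * t) f x := by positivity
      linarith
    calc h.op (expOp h.op t f) x ^ 2
        ≤ 5 / p ^ 2 * (expOp h.op t f x * expOp h.op (2 * t) f x) := by
          rw [div_mul_eq_mul_div, le_div_iff₀ (by positivity)]; linarith
      _ ≤ _ := by gcongr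
  · rw [abs_of_nonneg p2]
    have h5 : p ^ 2 ≤ t ^ 2 := pow_le_pow_left₀ hp.le ht.1.le 2
    have h6 := mul_le_mul_of_nonneg_right h5 p2
    calc h.op (h.op (expOp h.op t f)) x ≤ 5 / p ^ 2 * expOp h.op (2 * t) f x := by
          rw [div_mul_eq_mul_div, le_div_iff₀ (by positivity)]; linarith
      _ ≤ _ := by gcongr
  · rw [abs_of_nonneg p3]
    have h5 : p ^ 3 ≤ t ^ 3 := pow_le_pow_left₀ hp.le ht.1.le 3
    have h6 := mul_le_mul_of_nonneg_right h5 p3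
    calc h.op (h.op (h.op (expOp h.op t f))) x ≤ 6 / p ^ 3 * expOp h.op (2 * t) f x := by
          rw [div_mul_eq_mul_div, le_div_iff₀ (by positivity)]; linarith
      _ ≤ _ := by gcongr

theorem IsPositiveKernel.entFn₁_apply (h : IsPositiveKernel a lam) (hf : ∀ x, 0 ≤ f x)
    (hpos : ∀ t, 0 < t → ∀ x, 0 < expOp h.op t f x) {t : ℝ} (ht : 0 < t) (x : X) :
    entFn₁ h.op (expOp h.op t f) x =
      h.op (expOp h.op t f) x * (1 + Real.log (expOp h.op t f x)) := by
  obtain ⟨C, hC⟩ := h.exists_abs_deriv_le hf hpos (half_pos ht) (2 * t)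
  exact boundedFn_apply (fun x => (hC t ⟨by linarith, by linarith⟩ x).1) x

theorem IsPositiveKernel.entFn₂_apply (h : IsPositiveKernel a lam) (hf : ∀ x, 0 ≤ f x)
    (hpos : ∀ t, 0 < t → ∀ x, 0 < expOp h.op t f x) {t : ℝ} (ht : 0 < t) (x : X) :
    entFn₂ h.op (expOp h.op t f) x =
      h.op (h.op (expOp h.op t f)) x * (1 + Real.log (expOp h.op t f x)) +
        h.op (expOp h.op t f) x ^ 2 / expOp h.op t f x := by
  obtain ⟨C, hC⟩ := h.exists_abs_deriv_le hf hpos (half_pos ht) (2 * t)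
  exact boundedFn_apply (fun x => (hC t ⟨by linarith, by linarith⟩ x).2.1) x

/-- The derivatives are taken in norm because a bounded operator and a functional are applied
afterwards. Two derivatives in norm cost three pointwise bounds. -/
theorem IsPositiveKernel.hasDerivAt_entFn (h : IsPositiveKernel a lam) (hf : ∀ x, 0 ≤ f x)
    (hpos : ∀ t, 0 < t → ∀ x, 0 < expOp h.op t f x) {t : ℝ} (ht : 0 < t) :
    HasDerivAt (fun t => entFn (expOp h.op t f)) (entFn₁ h.op (expOp h.op t f)) t ∧
    HasDerivAt (fun t => entFn₁ h.op (expOp h.op t f)) (entFn₂ h.op (expOp h.op t f)) t := by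
  obtain ⟨C, hC⟩ := h.exists_abs_deriv_le hf hpos (half_pos ht) (2 * t)
  have hmem : t ∈ Set.Ioo (t / 2) (2 * t) := ⟨by linarith, by linarith⟩
  have hp : ∀ s ∈ Set.Ioo (t / 2) (2 * t), 0 < s := fun s hs => (half_pos ht).trans hs.1
  have hd0 : ∀ s ∈ Set.Ioo (t / 2) (2 * t), ∀ x,
      HasDerivAt (fun t => entFn (expOp h.op t f) x) (entFn₁ h.op (expOp h.op s f) x) s := by
    intro s hs x
    simp only [entFn_apply]
    rw [h.entFn₁_apply hf hpos (hp s hs)]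
    have hF := hpos s (hp s hs) x
    have h1 := hasDerivAt_expOp_eval h.op f s x
    refine (h1.mul (h1.log hF.ne')).congr_deriv ?_
    field_simp
    ring
  have hd1 : ∀ s ∈ Set.Ioo (t / 2) (2 * t), ∀ x,
      HasDerivAt (fun t => entFn₁ h.op (expOp h.op t f) x)
        (entFn₂ h.op (expOp h.op s f) x) s := by
    intro s hs x
    rw [h.entFn₂_apply hf hpos (hp s hs)]
    have hF := hpos s (hp s hs) x
    have h1 := hasDerivAt_expOp_eval h.op f s x
    have h2 := hasDerivAt_op_expOp h.op f s x
    refine ((h2.mul ((h1.log hF.ne').const_add 1)).congr_deriv ?_).congr_of_eventuallyEq ?_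
    · field_simp
    · filter_upwards [Ioo_mem_nhds hs.1 hs.2] with r hr
      exact h.entFn₁_apply hf hpos (hp r hr) x
  have hd2 : ∀ s ∈ Set.Ioo (t / 2) (2 * t), ∀ x,
      HasDerivAt (fun t => entFn₂ h.op (expOp h.op t f) x)
        (h.op (h.op (h.op (expOp h.op s f))) x * (1 + Real.log (expOp h.op s f x)) +
        3 * h.op (expOp h.op s f) x * h.op (h.op (expOp h.op s f)) x / expOp h.op s f x -
        h.op (expOp h.op s f) x ^ 3 / expOp h.op s f x ^ 2) s := by
    intro s hs x
    have hF := hpos s (hp s hs) x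
    have h1 := hasDerivAt_expOp_eval h.op f s x
    have h2 := hasDerivAt_op_expOp h.op f s x
    have h3 : HasDerivAt (fun t => h.op (h.op (expOp h.op t f)) x)
        (h.op (h.op (h.op (expOp h.op s f))) x) s := by
      simpa only [← commute_expOp_apply] using hasDerivAt_op_expOp h.op (h.op f) s x
    refine (((h3.mul ((h1.log hF.ne').const_add 1)).add
      ((h2.pow 2).div h1 hF.ne')).congr_deriv ?_).congr_of_eventuallyEq ?_
    · simp only [Pi.pow_apply]
      field_simp
      ring
    · filter_upwards [Ioo_mem_nhds hs.1 hs.2] with r hr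
      exact h.entFn₂_apply hf hpos (hp r hr) x
  have hd2' : ∀ s ∈ Set.Ioo (t / 2) (2 * t), ∀ x, |entFn₂ h.op (expOp h.op s f) x| ≤ C := by
    intro s hs x
    rw [h.entFn₂_apply hf hpos (hp s hs)]
    exact (hC s hs x).2.1
  refine ⟨hasDerivAt_of_pointwise (v₁ := fun t => entFn₁ h.op (expOp h.op t f))
      (v₂ := fun t => entFn₂ h.op (expOp h.op t f)) hd0 hd1 hd2' hmem,
    hasDerivAt_of_pointwise (v₁ := fun t => entFn₂ h.op (expOp h.op t f)) hd1 hd2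
      (fun s hs x => (hC s hs x).2.2) hmem⟩

end EntropyPath

/-! ### The second derivative of the entropy along an interpolation -/

/-- This is 1 - 1/s ≤ log s at s = rp/q², multiplied by r. It serves with p, q, r the values of F at
three successive points x, y, z of the kernel. -/
theorem three_point_log_inequality {p q r : ℝ} (hp : 0 < p) (hq : 0 < q) (hr : 0 < r) :
    0 ≤ r * Real.log r + r * (Real.log p - 2 * Real.log q) - r + q ^ 2 / p := by
  have h := Real.one_sub_inv_le_log_of_pos (x := r * p / q ^ 2) (by positivity)
  rw [Real.log_div (by positivity) (by positivity), Real.log_mul hr.ne' hp.ne', Real.log_pow] at h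
  have h2 := mul_le_mul_of_nonneg_left h hr.le
  have h3 : r * (1 - (r * p / q ^ 2)⁻¹) = r - q ^ 2 / p := by field_simp
  rw [h3] at h2
  push_cast at h2
  linarith

section ExpOp

variable {E : Type*} [NormedAddCommGroup E] [NormedSpace ℝ E] [CompleteSpace E]

/-- Differentiating the backward semigroup contributes -T. Two applications produce the expression
u₂ - 2Tu₁ + TTu for u = F log F. -/
theorem hasDerivAt_expOp_sub (T : E →L[ℝ] E) {v : ℝ → E} {v' : E}
    {t : ℝ} (hv : HasDerivAt v v' t) :
    HasDerivAt (fun t => expOp T (1 - t) (v t)) (expOp T (1 - t) (v' - T (v t))) t := by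
  have h1 := HasDerivAt.scomp t (hasDerivAt_expOp T (1 - t)) ((hasDerivAt_id t).const_sub 1)
  refine (h1.clm_apply hv).congr_deriv ?_
  rw [map_sub, ← commute_expOp_apply]
  simp only [neg_one_smul, neg_apply, mul_apply_eq_comp, Function.comp_apply]
  abel

theorem continuous_expOp (T : E →L[ℝ] E) : Continuous (expOp T) :=
  continuous_iff_continuousAt.2 fun t => (hasDerivAt_expOp T t).continuousAt

end ExpOp

section Interpolation

variable {X : Type*} [TopologicalSpace X] [DiscreteTopology X] {a : X → X → ℝ} {lam : ℝ}
  {f : X →ᵇ ℝ}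

/-- Summed against a(x,y)a(y,z), the three-point inequality absorbs all the logarithms and leaves -λ
times the sum over y of a(x,y)F(y)²/F(x). The comparison of a with a² makes this at least
-κ(TF(x))²/F(x). The second moment inequality then replaces the quotient by a bound linear in F. -/
theorem IsPositiveKernel.neg_le_second_deriv (h : IsPositiveKernel a lam) (hf : ∀ x, 0 ≤ f x)
    (hpos : ∀ t, 0 < t → ∀ x, 0 < expOp h.op t f x) {κ : ℝ} (hκ0 : 0 ≤ κ)
    (hκ : ∀ x y, lam * a x y ≤ κ * a x y ^ 2) {t : ℝ} (ht : 0 < t) (x : X) :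
    -(κ * (h.op (h.op (expOp h.op t f)) x + h.op (expOp h.op t f) x / t)) ≤
      h.op (h.op (entFn (expOp h.op t f))) x - 2 * h.op (entFn₁ h.op (expOp h.op t f)) x +
        entFn₂ h.op (expOp h.op t f) x := by
  have hsq := h.sq_op_expOp_le hf ht.le x
  have hF := hpos t ht
  have hu1 := h.entFn₁_apply hf hpos ht
  have hu2 := h.entFn₂_apply hf hpos ht x
  set F := expOp h.op t f
  set u₁ := entFn₁ h.op F
  have hF1 : ∀ y, 0 ≤ h.op F y := h.op_nonneg fun y => (hF y).le
  have hinner : ∀ y, -(lam * (F y ^ 2 / F x)) ≤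
      h.op (entFn F) y - 2 * u₁ y + h.op F y * (1 + Real.log (F x)) := by
    intro y
    have hs := ((h.hasSum_op (entFn F) y).add ((h.hasSum_op F y).mul_right
      (Real.log (F x) - 2 * Real.log (F y) - 1))).add ((h.hasSum y).mul_right (F y ^ 2 / F x))
    have h0 := hs.nonneg fun z => by
      rw [entFn_apply]
      have := mul_nonneg (h.nonneg y z) (three_point_log_inequality (hF x) (hF y) (hF z))
      linarith
    rw [hu1 y]
    linarith
  have hsum := (((h.hasSum_op (h.op (entFn F)) x).sub ((h.hasSum_op u₁ x).mul_left 2)).add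
    ((h.hasSum_op (h.op F) x).mul_right (1 + Real.log (F x))))
  have hlow : -(κ * (h.op F x ^ 2 / F x)) ≤ h.op (h.op (entFn F)) x - 2 * h.op u₁ x +
      h.op (h.op F) x * (1 + Real.log (F x)) := by
    have hneg := ((h.hasSum_op F x).mul_left (-(κ * (h.op F x / F x))))
    have e : -(κ * (h.op F x / F x)) * h.op F x = -(κ * (h.op F x ^ 2 / F x)) := by ring
    rw [e] at hneg
    refine hasSum_le (fun y => ?_) hneg hsum
    have h1 := mul_le_mul_of_nonneg_left (hinner y) (h.nonneg x y)
    -- One of the two factors a(x,y)F(y) will be enlarged to the whole sum TF(x).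
    have h2 : a x y * F y ≤ h.op F x :=
      le_hasSum (h.hasSum_op F x) y fun z _ => mul_nonneg (h.nonneg x z) (hF z).le
    have h3 : lam * a x y * (F y ^ 2 / F x) ≤ κ * a x y ^ 2 * (F y ^ 2 / F x) :=
      mul_le_mul_of_nonneg_right (hκ x y) (div_nonneg (sq_nonneg _) (hF x).le)
    have h4 : κ * a x y ^ 2 * (F y ^ 2 / F x) ≤ κ * (h.op F x / F x) * (a x y * F y) := by
      have : κ * a x y ^ 2 * (F y ^ 2 / F x) = κ * (a x y * F y / F x) * (a x y * F y) := by ring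
      rw [this]
      have h5 : 0 ≤ a x y * F y := mul_nonneg (h.nonneg x y) (hF y).le
      have h6 := hF x
      gcongr
    linarith
  have hdiv : h.op F x ^ 2 / F x ≤ h.op (h.op F) x + h.op F x / t := by
    rw [div_le_iff₀ (hF x)]
    have : t ^ 2 * h.op F x ^ 2 ≤ t ^ 2 * ((h.op (h.op F) x + h.op F x / t) * F x) := by
      refine le_of_eq_of_le (by ring) (hsq.trans_eq ?_)
      field_simp
    exact le_of_mul_le_mul_left this (by positivity)
  have h7 := mul_le_mul_of_nonneg_left hdiv hκ0
  have h8 : 0 ≤ h.op F x ^ 2 / F x := div_nonneg (sq_nonneg _) (hF x).le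
  rw [hu2]
  linarith

/-- The entropic functional `t ↦ ℓ (e^{(1-t)T} (F_t log F_t))` with `F_t = e^{tT} f`. -/
def interpEntropy (T : (X →ᵇ ℝ) →L[ℝ] (X →ᵇ ℝ)) (ℓ : (X →ᵇ ℝ) →L[ℝ] ℝ) (f : X →ᵇ ℝ) (t : ℝ) : ℝ :=
  ℓ (expOp T (1 - t) (entFn (expOp T t f)))

theorem continuous_interpEntropy (T : (X →ᵇ ℝ) →L[ℝ] (X →ᵇ ℝ)) (ℓ : (X →ᵇ ℝ) →L[ℝ] ℝ)
    (f : X →ᵇ ℝ) : Continuous (interpEntropy T ℓ f) := by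
  exact ℓ.continuous.comp (((continuous_expOp T).comp (continuous_sub_left 1)).clm_apply
    (continuous_entFn.comp (continuous_expOp_apply T f)))

/-- The entropic functional is twice differentiable, with a lower bound of the second
derivative. -/
theorem IsPositiveKernel.exists_hasDerivAt_interpEntropy (h : IsPositiveKernel a lam)
    (hf : ∀ x, 0 ≤ f x) (hpos : ∀ t, 0 < t → ∀ x, 0 < expOp h.op t f x) {κ : ℝ} (hκ0 : 0 ≤ κ)
    (hκ : ∀ x y, lam * a x y ≤ κ * a x y ^ 2) (ℓ : (X →ᵇ ℝ) →L[ℝ] ℝ)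
    (hℓ : ∀ u : X →ᵇ ℝ, (∀ x, 0 ≤ u x) → 0 ≤ ℓ u) :
    ∃ φ₁ φ₂ : ℝ → ℝ, (∀ t, 0 < t → HasDerivAt (interpEntropy h.op ℓ f) (φ₁ t) t) ∧
      (∀ t, 0 < t → HasDerivAt φ₁ (φ₂ t) t) ∧
      ∀ t, 0 < t → t < 1 → -(κ * (ℓ (h.op (h.op (expOp h.op 1 f))) +
        ℓ (h.op (expOp h.op 1 f)) / t)) ≤ φ₂ t := by
  set T := h.op with hT
  set F := fun t => expOp T t f
  refine ⟨fun t => ℓ (expOp T (1 - t) (entFn₁ T (F t) - T (entFn (F t)))),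
    fun t => ℓ (expOp T (1 - t) (entFn₂ T (F t) - T (entFn₁ T (F t)) -
      T (entFn₁ T (F t) - T (entFn (F t))))), fun t ht => ?_, fun t ht => ?_, fun t ht ht1 => ?_⟩
  · have := hasDerivAt_expOp_sub T (h.hasDerivAt_entFn hf hpos ht).1
    exact HasFDerivAt.comp_hasDerivAt (f := fun t => expOp T (1 - t) (entFn (F t))) t
      ℓ.hasFDerivAt this
  · obtain ⟨h0, h1⟩ := h.hasDerivAt_entFn hf hpos ht
    have h2 := T.hasFDerivAt.comp_hasDerivAt t h0
    have h3 := hasDerivAt_expOp_sub T (h1.sub h2)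
    exact HasFDerivAt.comp_hasDerivAt
      (f := fun t => expOp T (1 - t) (entFn₁ T (F t) - T (entFn (F t)))) t ℓ.hasFDerivAt h3
  · have hsemi : ∀ u : X →ᵇ ℝ, expOp T (1 - t) (expOp T t u) = expOp T 1 u := by
      intro u
      rw [← mul_apply_eq_comp, ← expOp_add, sub_add_cancel]
    -- The lower bound is linear in F, so the backward semigroup carries it to time 1, and t
    -- survives only in the factor 1/t.
    have e : -(κ * (ℓ (T (T (expOp T 1 f))) + ℓ (T (expOp T 1 f)) / t)) =
        ℓ (expOp T (1 - t) (-(κ • (T (T (F t)) + t⁻¹ • T (F t))))) := by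
      have e1 : expOp T (1 - t) (T (T (F t))) = T (T (expOp T 1 f)) := by
        rw [← commute_expOp_apply, ← commute_expOp_apply, hsemi]
      have e2 : expOp T (1 - t) (T (F t)) = T (expOp T 1 f) := by
        rw [← commute_expOp_apply, hsemi]
      simp only [map_neg, map_smul, map_add, e1, e2, smul_eq_mul]
      ring
    rw [e, ← sub_nonneg, ← map_sub, ← map_sub]
    refine hℓ _ (h.expOp_nonneg (fun x => ?_) (by linarith))
    have := h.neg_le_second_deriv hf hpos hκ0 hκ ht x
    simp only [map_sub, BoundedContinuousFunction.coe_sub, BoundedContinuousFunction.coe_neg,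
      BoundedContinuousFunction.coe_smul, BoundedContinuousFunction.coe_add, Pi.sub_apply,
      Pi.neg_apply, Pi.add_apply, smul_eq_mul]
    rw [← hT] at this
    simp only [F]
    rw [inv_mul_eq_div]
    linarith

end Interpolation

/-! ### Duality with respect to a reversible measure -/

section DoubleSums

variable {β ι : Type*}

theorem summable_prod_of_hasSum {F : β × ι → ℝ} (hF : ∀ p, 0 ≤ F p) {r : β → ℝ}
    (hr : ∀ b, HasSum (fun c => F (b, c)) (r b)) (hs : Summable r) : Summable F :=
  (summable_prod_of_nonneg hF).2
    ⟨fun b => (hr b).summable, hs.congr fun b => ((hr b).tsum_eq).symm⟩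

theorem hasSum_fiberwise {F : β × ι → ℝ} (hF : Summable F) {r : β → ℝ} {q : ι → ℝ}
    (hr : ∀ b, HasSum (fun c => F (b, c)) (r b)) (hq : ∀ c, HasSum (fun b => F (b, c)) (q c)) :
    HasSum r (∑' p, F p) ∧ HasSum q (∑' p, F p) := by
  refine ⟨hF.hasSum.prod_fiberwise hr, ?_⟩
  have h1 : HasSum (fun p : ι × β => F p.swap) (∑' p, F p) :=
    (Equiv.prodComm ι β).hasSum_iff.2 hF.hasSum
  exact h1.prod_fiberwise hq

end DoubleSums

section Countable

variable {X : Type*} [Countable X] [MeasurableSpace X] [MeasurableSingletonClass X]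
  {m : Measure X}

theorem integrable_iff_summable (hm : ∀ x, m {x} ≠ ⊤) (u : X → ℝ) :
    Integrable u m ↔ Summable fun x => m.real {x} * |u x| := by
  have hmeas : AEStronglyMeasurable u m := (measurable_of_countable u).aestronglyMeasurable
  have e : ∀ x, ‖u x‖ₑ * m {x} = ENNReal.ofReal (m.real {x} * |u x|) := by
    intro x
    rw [ENNReal.ofReal_mul measureReal_nonneg, ofReal_measureReal (hm x), mul_comm,
      ← Real.norm_eq_abs, ofReal_norm]
  rw [Integrable, and_iff_right hmeas, HasFiniteIntegral, lintegral_countable']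
  simp only [e]
  constructor
  · intro h
    have := ENNReal.summable_toReal h.ne
    refine this.congr fun x => ?_
    rw [ENNReal.toReal_ofReal (by positivity)]
  · intro h
    exact h.tsum_ofReal_lt_top

theorem hasSum_integral_of_integrable (hm : ∀ x, m {x} ≠ ⊤) {u : X → ℝ} (hu : Integrable u m) :
    HasSum (fun x => m.real {x} * u x) (∫ x, u x ∂m) := by
  rw [integral_countable hu]
  refine Summable.hasSum (Summable.of_norm ?_)
  simpa [abs_mul, abs_of_nonneg measureReal_nonneg] using (integrable_iff_summable hm u).1 hu

end Countable

section Duality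

variable {X : Type*} [Countable X] [TopologicalSpace X] [DiscreteTopology X] [MeasurableSpace X]
  [BorelSpace X] {m : Measure X} {a : X → X → ℝ} {lam : ℝ}

theorem integrable_mul_bounded {v : X → ℝ} (hv : Integrable v m) (u : X →ᵇ ℝ) :
    Integrable (fun x => v x * u x) m :=
  hv.mul_bdd (measurable_of_countable u).aestronglyMeasurable
    (ae_of_all _ fun x => u.norm_coe_le_norm x)

/-- Both integrals are the sum of m(y)v(y)a(y,x)u(x), taken in the two orders. Integrability of v
and boundedness of u make the double sum absolutely convergent. -/
theorem IsPositiveKernel.integral_op_mul (h : IsPositiveKernel a lam) (hm : ∀ x, m {x} ≠ ⊤)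
    (hrev : ∀ x y, m.real {x} * a x y = m.real {y} * a y x) {v : X →ᵇ ℝ} (hv : Integrable v m) :
    Integrable (h.op v) m ∧ ∀ u : X →ᵇ ℝ, ∫ x, h.op v x * u x ∂m = ∫ x, v x * h.op u x ∂m := by
  have hbase : ∀ C : ℝ, 0 ≤ C →
      Summable fun p : X × X => m.real {p.1} * |v p.1| * (a p.1 p.2 * C) := by
    intro C hC
    refine summable_prod_of_hasSum (r := fun y => m.real {y} * |v y| * (lam * C)) (fun p => ?_)
      (fun y => ((h.hasSum y).mul_right C).mul_left _)
      (((integrable_iff_summable hm v).1 hv).mul_right _)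
    exact mul_nonneg (mul_nonneg measureReal_nonneg (abs_nonneg _))
      (mul_nonneg (h.nonneg p.1 p.2) hC)
  have hsum : ∀ u : X →ᵇ ℝ,
      Summable fun p : X × X => m.real {p.1} * (v p.1 * (a p.1 p.2 * u p.2)) := by
    intro u
    refine Summable.of_norm_bounded (hbase ‖u‖ (norm_nonneg u)) fun p => ?_
    have h1 := u.norm_coe_le_norm p.2
    have h2 := h.nonneg p.1 p.2
    rw [norm_mul, norm_mul, norm_mul, Real.norm_of_nonneg measureReal_nonneg,
      Real.norm_of_nonneg h2, Real.norm_eq_abs (v p.1), ← mul_assoc]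
    exact mul_le_mul_of_nonneg_left (mul_le_mul_of_nonneg_left h1 h2)
      (mul_nonneg measureReal_nonneg (abs_nonneg _))
  have hswap : ∀ x y, m.real {y} * a y x = m.real {x} * a x y := fun x y => hrev y x
  have hint : Integrable (h.op v) m := by
    rw [integrable_iff_summable hm]
    have hs := (hbase 1 zero_le_one).prod_symm.prod
    refine Summable.of_nonneg_of_le (fun x => by positivity) (fun x => ?_) hs
    have hx : Summable fun y => a x y * |v y| := by
      refine (h.isBounded.summable_mul v x).abs.congr fun y => ?_
      rw [abs_mul, abs_of_nonneg (h.nonneg x y)]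
    have e : ∀ y, m.real {y} * |v y| * (a y x * 1) = m.real {x} * (a x y * |v y|) := by
      intro y
      rw [mul_one, mul_right_comm, hswap x y, mul_assoc]
    simp only [Prod.swap, e, tsum_mul_left]
    refine mul_le_mul_of_nonneg_left ?_ measureReal_nonneg
    rw [← Real.norm_eq_abs, ← (h.hasSum_op v x).tsum_eq]
    refine tsum_of_norm_bounded hx.hasSum fun y => ?_
    rw [norm_mul, Real.norm_eq_abs, Real.norm_eq_abs, abs_of_nonneg (h.nonneg x y)]
  refine ⟨hint, fun u => ?_⟩
  obtain ⟨h1, h2⟩ := hasSum_fiberwise (hsum u)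
    (r := fun y => m.real {y} * (v y * h.op u y)) (q := fun x => m.real {x} * (h.op v x * u x))
    (fun y => ((h.hasSum_op u y).mul_left _).mul_left _) (fun x => by
      have e : ∀ y, m.real {y} * (v y * (a y x * u x)) = m.real {x} * (a x y * v y * u x) :=
        fun y => by linear_combination v y * u x * hswap x y
      simp only [e]
      exact ((h.hasSum_op v x).mul_right (u x)).mul_left (m.real {x}))
  have h3 := hasSum_integral_of_integrable hm (integrable_mul_bounded hint u)
  have h4 := hasSum_integral_of_integrable hm (integrable_mul_bounded hv (h.op u))
  rw [h3.unique h2, h4.unique h1]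

theorem IsPositiveKernel.integral_pow_op_mul (h : IsPositiveKernel a lam) (hm : ∀ x, m {x} ≠ ⊤)
    (hrev : ∀ x y, m.real {x} * a x y = m.real {y} * a y x) {v : X →ᵇ ℝ} (hv : Integrable v m)
    (k : ℕ) : Integrable ((h.op ^ k) v) m ∧
      ∀ u : X →ᵇ ℝ, ∫ x, (h.op ^ k) v x * u x ∂m = ∫ x, v x * (h.op ^ k) u x ∂m := by
  induction k with
  | zero => exact ⟨hv, fun u => rfl⟩
  | succ k ih =>
    have h1 := h.integral_op_mul hm hrev ih.1
    simp only [pow_succ' h.op, mul_apply_eq_comp]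
    refine ⟨h1.1, fun u => ?_⟩
    rw [h1.2, ih.2, ← mul_apply_eq_comp, ← mul_apply_eq_comp, ← pow_succ, ← pow_succ']

/-- The functional `u ↦ ∑_z m(z) g(z) u(z)`, for `g` carried by the finite set `s`. -/
def pairing (m : Measure X) (s : Finset X) (g : X → ℝ) : (X →ᵇ ℝ) →L[ℝ] ℝ :=
  ∑ z ∈ s, (m.real {z} * g z) • (BoundedContinuousFunction.evalCLM ℝ z : (X →ᵇ ℝ) →L[ℝ] ℝ)

theorem pairing_apply (s : Finset X) (g : X → ℝ) (u : X →ᵇ ℝ) :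
    pairing m s g u = ∑ z ∈ s, m.real {z} * g z * u z := by
  simp [pairing, BoundedContinuousFunction.evalCLM_apply]

theorem pairing_nonneg (s : Finset X) {g : X → ℝ} (hg : ∀ x, 0 ≤ g x) (u : X →ᵇ ℝ)
    (hu : ∀ x, 0 ≤ u x) : 0 ≤ pairing m s g u := by
  rw [pairing_apply]
  exact Finset.sum_nonneg fun z _ => mul_nonneg (mul_nonneg measureReal_nonneg (hg z)) (hu z)

theorem integrable_of_finset (hm : ∀ x, m {x} ≠ ⊤) {s : Finset X} {g : X → ℝ}
    (hs : ∀ x ∉ s, g x = 0) : Integrable g m := by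
  rw [integrable_iff_summable hm]
  exact summable_of_ne_finset_zero (s := s) fun x hx => by simp [hs x hx]

theorem integral_mul_eq_pairing (hm : ∀ x, m {x} ≠ ⊤) {s : Finset X} {g : X → ℝ}
    (hs : ∀ x ∉ s, g x = 0) (u : X →ᵇ ℝ) : ∫ x, g x * u x ∂m = pairing m s g u := by
  have hi : Integrable (fun x => g x * u x) m := integrable_mul_bounded
    (integrable_of_finset hm hs) u
  refine (hasSum_integral_of_integrable hm hi).unique ?_
  rw [pairing_apply]
  simp only [← mul_assoc]
  exact hasSum_sum_of_ne_finset_zero fun x hx => by simp [hs x hx]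

/-- Duality for the powers, summed over the exponential series. Since g ≥ 0, the case u = 1 already
gives absolute convergence of the double series. -/
theorem IsPositiveKernel.integral_expOp_mul (h : IsPositiveKernel a lam) (hm : ∀ x, m {x} ≠ ⊤)
    (hrev : ∀ x y, m.real {x} * a x y = m.real {y} * a y x) {g : X →ᵇ ℝ} {s : Finset X}
    (hg : ∀ x, 0 ≤ g x) (hs : ∀ x ∉ s, g x = 0) {t : ℝ} (ht : 0 ≤ t) :
    Integrable (expOp h.op t g) m ∧
      ∀ u : X →ᵇ ℝ, ∫ x, expOp h.op t g x * u x ∂m = pairing m s g (expOp h.op t u) := by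
  have hgi : Integrable g m := integrable_of_finset hm hs
  have hk := fun k => h.integral_pow_op_mul hm hrev hgi k
  have hks : ∀ (k : ℕ) (u : X →ᵇ ℝ),
      ∫ x, (h.op ^ k) g x * u x ∂m = pairing m s g ((h.op ^ k) u) := fun k u => by
    rw [(hk k).2, integral_mul_eq_pairing hm hs]
  have hpair : ∀ u, HasSum (fun k : ℕ => t ^ k / (k.factorial : ℝ) *
      pairing m s g ((h.op ^ k) u)) (pairing m s g (expOp h.op t u)) := by
    intro u
    simpa using (hasSum_expOp_apply h.op t u).mapL (pairing m s g)
  have hint1 : ∀ k, ∫ x, (h.op ^ k) g x ∂m = pairing m s g ((h.op ^ k) 1) := by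
    intro k
    simpa using hks k 1
  have hprod : Summable fun p : ℕ × X => m.real {p.2} *
      (t ^ p.1 / (p.1.factorial : ℝ) * (h.op ^ p.1) g p.2) := by
    refine summable_prod_of_hasSum
      (r := fun k => t ^ k / (k.factorial : ℝ) * pairing m s g ((h.op ^ k) 1)) (fun p => ?_)
      (fun k => ?_) (hpair 1).summable
    · have := h.pow_op_nonneg hg p.1 p.2
      positivity
    · have := (hasSum_integral_of_integrable hm (hk k).1).mul_left (t ^ k / (k.factorial : ℝ))
      rw [hint1] at this
      simpa only [mul_left_comm] using this
  have hpos := h.expOp_nonneg hg ht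
  have hint : Integrable (expOp h.op t g) m := by
    rw [integrable_iff_summable hm]
    refine hprod.prod_symm.prod.congr fun x => ?_
    simp only [Prod.swap]
    rw [tsum_mul_left, (hasSum_expOp_eval h.op t g x).tsum_eq, abs_of_nonneg (hpos x)]
  refine ⟨hint, fun u => ?_⟩
  have hsum : Summable fun p : ℕ × X => m.real {p.2} *
      (t ^ p.1 / (p.1.factorial : ℝ) * (h.op ^ p.1) g p.2) * u p.2 := by
    refine Summable.of_norm_bounded (hprod.mul_right ‖u‖) fun p => ?_
    have h0 := h.pow_op_nonneg hg p.1 p.2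
    rw [norm_mul, Real.norm_of_nonneg (by positivity)]
    exact mul_le_mul_of_nonneg_left (u.norm_coe_le_norm _) (by positivity)
  obtain ⟨h1, h2⟩ := hasSum_fiberwise hsum
    (r := fun k : ℕ => t ^ k / (k.factorial : ℝ) * pairing m s g ((h.op ^ k) u))
    (q := fun x => m.real {x} * (expOp h.op t g x * u x)) (fun k => by
      have := (hasSum_integral_of_integrable hm (integrable_mul_bounded (hk k).1 u)).mul_left
        (t ^ k / (k.factorial : ℝ))
      rw [hks] at this
      simpa only [mul_left_comm, mul_assoc] using this)
    (fun x => by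
      have := ((hasSum_expOp_eval h.op t g x).mul_right (u x)).mul_left (m.real {x})
      simpa only [mul_assoc] using this)
  rw [(hasSum_integral_of_integrable hm (integrable_mul_bounded hint u)).unique h2,
    (hpair u).unique h1]

end Duality

/-! ### The uniformized kernel of a nearest-neighbour generator -/

/-- `n` is a non-negative, reversible, irreducible nearest-neighbour kernel with row sums `lam`,
whose non-zero entries are bounded below by `lam / κ`. -/
structure IsUniformizedKernel {X : Type*} [DecidableEq X] [MeasurableSpace X] (G : SimpleGraph X)
    (m : Measure X) (n : X → X → ℝ) (lam κ : ℝ) : Prop where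
  toPos : IsPositiveKernel n lam
  connected : G.Connected
  mass_ne_zero : ∀ x, m {x} ≠ 0
  mass_ne_top : ∀ x, m {x} ≠ ⊤
  lam_pos : 0 < lam
  κ_nonneg : 0 ≤ κ
  lam_mul_le : ∀ x y, lam * n x y ≤ κ * n x y ^ 2
  pos_of_adj : ∀ x y, G.Adj x y → 0 < n x y
  eq_zero : ∀ x y, x ≠ y → ¬ G.Adj x y → n x y = 0
  reversible : ∀ x y, m.real {x} * n x y = m.real {y} * n y x

/-- `A` is the generator `γ (n - lam)`. -/
def IsGeneratorOf {X : Type*} [DecidableEq X] (A n : X → X → ℝ) (lam γ : ℝ) : Prop :=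
  ∀ x y, A x y = γ * n x y - if x = y then γ * lam else 0

section Uniformization

variable {X : Type*} [DecidableEq X] [MeasurableSpace X] {G : SimpleGraph X} {m : Measure X}
  {L : X → X → ℝ}

theorem IsGraphSpace.eq_zero (h : IsGraphSpace G m L) {x y : X} (hxy : x ≠ y)
    (hadj : ¬ G.Adj x y) : L x y = 0 :=
  le_antisymm (not_lt.1 fun h0 => hadj ((h.pos_iff_adj x y).1 h0)) (h.offDiag_nonneg x y hxy)

theorem IsGraphSpace.finite_neighborSet (h : IsGraphSpace G m L) (x : X) :
    (G.neighborSet x).Finite := by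
  obtain ⟨D, hD⟩ := h.bounded_degree
  exact Set.finite_of_encard_le_coe (hD x)

theorem IsGraphSpace.hasSum_row (h : IsGraphSpace G m L) (x : X) : HasSum (L x) 0 := by
  have hs : Summable fun y => if y = x then 0 else L x y := by
    refine summable_of_ne_finset_zero (s := (h.finite_neighborSet x).toFinset) fun y hy => ?_
    split_ifs with hyx
    · rfl
    · exact h.eq_zero (Ne.symm hyx) (by simpa using hy)
  have h1 := hs.hasSum.add (hasSum_ite_eq x (L x x))
  rw [h.diag x, add_neg_cancel] at h1
  refine (funext fun y => ?_ : L x = _) ▸ h1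
  split_ifs with hyx
  · rw [zero_add, hyx, h.diag x]
  · rw [add_zero]

/-- L is carried by the edges, where the distance is 1, so each power of γ is γ itself. -/
theorem IsGraphSpace.slowGenerator_eq (h : IsGraphSpace G m L) (γ : ℝ) (x y : X) :
    slowGenerator G L γ x y = γ * L x y := by
  have e : ∀ z, x ≠ z → γ ^ G.dist x z * L x z = γ * L x z := by
    intro z hz
    by_cases hadj : G.Adj x z
    · rw [SimpleGraph.dist_eq_one_iff_adj.2 hadj, pow_one]
    · rw [h.eq_zero hz hadj, mul_zero, mul_zero]
  rw [slowGenerator]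
  split_ifs with hxy
  · rw [← hxy, h.diag x, mul_neg, ← tsum_mul_left]
    congr 1
    refine tsum_congr fun z => ?_
    split_ifs with hz
    · rw [mul_zero]
    · exact e z (Ne.symm hz)
  · exact e y hxy

/-- Adding 2S on the diagonal makes the diagonal entries at least S ≥ I, so that every non-zero
entry is at least I. Adding S alone could leave a diagonal entry that is positive but arbitrarily
small. -/
theorem IsGraphSpace.exists_isUniformizedKernel (h : IsGraphSpace G m L)
    (hb : IsUniformlyBounded G m L) : ∃ (n : X → X → ℝ) (lam κ : ℝ),
      IsUniformizedKernel G m n lam κ ∧ ∀ γ, IsGeneratorOf (slowGenerator G L γ) n lam γ := by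
  obtain ⟨S, hS1, hS⟩ := hb.diag_le
  obtain ⟨I, hI0, hI1, hI⟩ := hb.le_rate
  have hpos : ∀ x y, 0 ≤ (if x = y then 2 * S else 0) + L x y := by
    intro x y
    split_ifs with hxy
    · subst hxy
      have := (abs_le.1 (hS x)).1
      linarith
    · rw [zero_add]
      exact h.offDiag_nonneg x y hxy
  refine ⟨fun x y => (if x = y then 2 * S else 0) + L x y, 2 * S, 2 * S / I, ⟨⟨hpos, ?_⟩,
    h.connected, h.mass_ne_zero, h.mass_ne_top, by linarith, by positivity, ?_, ?_, ?_, ?_⟩, ?_⟩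
  · intro x
    have := (hasSum_ite_eq x (2 * S)).add (h.hasSum_row x)
    simpa only [add_zero, eq_comm] using this
  · intro x y
    have hcase : (if x = y then 2 * S else 0) + L x y = 0 ∨
        I ≤ (if x = y then 2 * S else 0) + L x y := by
      split_ifs with hxy
      · subst hxy
        have := (abs_le.1 (hS x)).1
        right
        linarith
      · by_cases hadj : G.Adj x y
        · right
          rw [zero_add]
          exact hI x y hadj
        · left
          rw [zero_add]
          exact h.eq_zero hxy hadj
    rcases hcase with h0 | h0
    · rw [h0]; simp
    · have h1 := hpos x y
      generalize (if x = y then 2 * S else 0) + L x y = r at *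
      rw [div_mul_eq_mul_div, le_div_iff₀ hI0]
      have : r * I ≤ r * r := mul_le_mul_of_nonneg_left h0 h1
      have h2 := mul_le_mul_of_nonneg_left this (by linarith : 0 ≤ 2 * S)
      linarith
  · intro x y hadj
    rw [if_neg hadj.ne, zero_add]
    exact (h.pos_iff_adj x y).2 hadj
  · intro x y hxy hadj
    rw [if_neg hxy, zero_add]
    exact h.eq_zero hxy hadj
  · intro x y
    rw [mul_add, mul_add, h.reversible x y]
    congr 1
    by_cases hxy : x = y
    · rw [hxy]
    · rw [if_neg hxy, if_neg (Ne.symm hxy), mul_zero, mul_zero]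
  · intro γ x y
    rw [h.slowGenerator_eq]
    beta_reduce
    by_cases hxy : x = y
    · rw [if_pos hxy, if_pos hxy]; ring
    · rw [if_neg hxy, if_neg hxy]; ring

end Uniformization

/-! ### Positivity and locality of the semigroup of the uniformized kernel. -/

section Semigroup

variable {X : Type*} [DecidableEq X] [TopologicalSpace X] [DiscreteTopology X]
  [MeasurableSpace X] {G : SimpleGraph X} {m : Measure X} {n A : X → X → ℝ} {lam κ γ : ℝ}

/-- k steps of a nearest-neighbour kernel cannot cover a distance larger than k. This is why the
transition weight from x to z is at most of order γ^{d(x,z)}. -/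
theorem IsUniformizedKernel.pow_op_pointFn_eq_zero (h : IsUniformizedKernel G m n lam κ)
    (y : X) (k : ℕ) : ∀ x, k < G.dist x y → (h.toPos.op ^ k) (pointFn y) x = 0 := by
  induction k with
  | zero =>
    intro x hx
    change pointFn y x = 0
    rw [pointFn_apply, if_neg]
    rintro rfl
    simp at hx
  | succ k ih =>
    intro x hx
    rw [pow_succ', mul_apply_eq_comp]
    refine (h.toPos.hasSum_op _ x).unique ?_
    convert hasSum_zero using 2 with z
    by_cases hxz : x = z
    · subst hxz
      rw [ih x (by omega), mul_zero]
    · by_cases hadj : G.Adj x z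
      · have h1 := h.connected.dist_triangle (u := x) (v := z) (w := y)
        rw [SimpleGraph.dist_eq_one_iff_adj.2 hadj] at h1
        rw [ih z (by omega), mul_zero]
      · rw [h.eq_zero x z hxz hadj, zero_mul]

theorem IsUniformizedKernel.exists_pow_op_pointFn_pos (h : IsUniformizedKernel G m n lam κ)
    (x y : X) : ∃ k, 0 < (h.toPos.op ^ k) (pointFn y) x := by
  obtain ⟨w⟩ := h.connected.preconnected x y
  induction w with
  | nil => exact ⟨0, by change 0 < pointFn _ _; simp [pointFn_apply]⟩
  | cons hadj w ih =>
    rename_i u v z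
    obtain ⟨k, hk⟩ := ih
    refine ⟨k + 1, ?_⟩
    rw [pow_succ', mul_apply_eq_comp]
    have hnn : ∀ x, 0 ≤ (h.toPos.op ^ k) (pointFn z) x :=
      h.toPos.pow_op_nonneg (fun x => by rw [pointFn_apply]; split_ifs <;> norm_num) k
    exact (mul_pos (h.pos_of_adj u v hadj) hk).trans_le
      (le_hasSum (h.toPos.hasSum_op _ u) v fun j _ => mul_nonneg (h.toPos.nonneg u j) (hnn j))

theorem pointFn_nonneg (y x : X) : 0 ≤ pointFn y x := by
  rw [pointFn_apply]; split_ifs <;> norm_num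

theorem IsUniformizedKernel.expOp_pointFn_pos (h : IsUniformizedKernel G m n lam κ) {t : ℝ}
    (ht : 0 < t) (x y : X) : 0 < expOp h.toPos.op t (pointFn y) x := by
  obtain ⟨k, hk⟩ := h.exists_pow_op_pointFn_pos x y
  refine lt_of_lt_of_le ?_ (le_hasSum (hasSum_expOp_eval h.toPos.op t (pointFn y) x) k
    fun j _ => mul_nonneg (by positivity) (h.toPos.pow_op_nonneg (pointFn_nonneg y) j x))
  positivity

theorem IsUniformizedKernel.expOp_pos (h : IsUniformizedKernel G m n lam κ) {u : X →ᵇ ℝ}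
    (hu : ∀ x, 0 ≤ u x) {y : X} (hy : 0 < u y) {t : ℝ} (ht : 0 < t) (x : X) :
    0 < expOp h.toPos.op t u x := by
  have h1 := h.toPos.expOp_mono (u := u y • pointFn y) (v := u) (fun z => by
    rw [BoundedContinuousFunction.smul_apply, pointFn_apply, smul_eq_mul]
    split_ifs with hz
    · rw [hz, mul_one]
    · rw [mul_zero]; exact hu z) ht.le x
  refine lt_of_lt_of_le ?_ h1
  rw [map_smul]
  exact mul_pos hy (h.expOp_pointFn_pos ht x y)

theorem IsPositiveKernel.smul {a : X → X → ℝ} (h : IsPositiveKernel a lam) (hγ : 0 ≤ γ) :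
    IsPositiveKernel (fun x y => γ * a x y) (γ * lam) where
  nonneg x y := mul_nonneg hγ (h.nonneg x y)
  hasSum x := (h.hasSum x).mul_left γ

theorem IsPositiveKernel.smul_op {a : X → X → ℝ} (h : IsPositiveKernel a lam) (hγ : 0 ≤ γ) :
    (h.smul hγ).op = γ • h.op := by
  ext u x
  refine ((h.smul hγ).hasSum_op u x).unique ?_
  simp only [mul_assoc]
  exact (h.hasSum_op u x).mul_left γ

theorem IsUniformizedKernel.isBounded_generator (h : IsUniformizedKernel G m n lam κ)
    (hA : IsGeneratorOf A n lam γ) : IsBoundedKernel A (|γ| * lam + |γ * lam|) := by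
  have hbase : ∀ x, HasSum (fun y => |γ| * n x y + if y = x then |γ * lam| else 0)
      (|γ| * lam + |γ * lam|) := fun x =>
    ((h.toPos.hasSum x).mul_left |γ|).add (hasSum_ite_eq x _)
  have hle : ∀ x y, |A x y| ≤ |γ| * n x y + if y = x then |γ * lam| else 0 := by
    intro x y
    rw [hA x y]
    refine (abs_sub _ _).trans ?_
    rw [abs_mul, abs_of_nonneg (h.toPos.nonneg x y)]
    simp only [eq_comm (a := x)]
    split_ifs <;> simp
  exact ⟨fun x => Summable.of_nonneg_of_le (fun y => abs_nonneg _) (hle x) (hbase x).summable,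
    fun x => tsum_le_of_sum_le' (by have := h.lam_pos; positivity) fun s =>
      (Finset.sum_le_sum fun y _ => hle x y).trans (sum_le_hasSum s (fun y _ => by
        have := h.toPos.nonneg x y; positivity) (hbase x))⟩

theorem IsUniformizedKernel.op_generator (h : IsUniformizedKernel G m n lam κ)
    (hA : IsGeneratorOf A n lam γ) :
    (h.isBounded_generator hA).op = γ • h.toPos.op - (γ * lam) • 1 := by
  ext u x
  refine ((h.isBounded_generator hA).summable_mul u x).hasSum.unique ?_
  have := ((h.toPos.hasSum_op u x).mul_left γ).sub (hasSum_ite_eq x (γ * lam * u x))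
  have e : ∀ y, A x y * u y = γ * (n x y * u y) - if y = x then γ * lam * u x else 0 := by
    intro y
    rw [hA x y]
    by_cases hyx : x = y
    · rw [if_pos hyx, if_pos hyx.symm, hyx]; ring
    · rw [if_neg hyx, if_neg (Ne.symm hyx)]; ring
  rw [funext e]
  exact this

theorem IsUniformizedKernel.expOp_generator (h : IsUniformizedKernel G m n lam κ)
    (hA : IsGeneratorOf A n lam γ) (t : ℝ) : expOp (h.isBounded_generator hA).op t =
      Real.exp (-(γ * lam * t)) • expOp h.toPos.op (γ * t) := by
  rw [h.op_generator hA, expOp_sub_smul_one, expOp_smul]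

theorem IsUniformizedKernel.semigroup_eq (h : IsUniformizedKernel G m n lam κ)
    (hA : IsGeneratorOf A n lam γ) (t : ℝ) (x y : X) : semigroup A t x y =
      Real.exp (-(γ * lam * t)) * expOp h.toPos.op (γ * t) (pointFn y) x := by
  rw [(h.isBounded_generator hA).semigroup_eq, h.expOp_generator hA]
  rfl

theorem IsUniformizedKernel.semigroupApply_eq (h : IsUniformizedKernel G m n lam κ)
    (hA : IsGeneratorOf A n lam γ) (t : ℝ) {f : X → ℝ} (hf : f.support.Finite) (x : X) :
    semigroupApply A t f x =
      Real.exp (-(γ * lam * t)) * expOp h.toPos.op (γ * t) (finiteFn f hf) x := by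
  rw [(h.isBounded_generator hA).semigroupApply_eq t f hf, h.expOp_generator hA]
  rfl

theorem IsUniformizedKernel.semigroup_pos (h : IsUniformizedKernel G m n lam κ)
    (hA : IsGeneratorOf A n lam γ) (hγ : 0 < γ) {t : ℝ} (ht : 0 < t) (x y : X) :
    0 < semigroup A t x y := by
  rw [h.semigroup_eq hA]
  exact mul_pos (Real.exp_pos _) (h.expOp_pointFn_pos (by positivity) x y)

end Semigroup

/-! ### Consequences of the Schrödinger system -/

section System

variable {X : Type*} [DecidableEq X] [Countable X] [TopologicalSpace X] [DiscreteTopology X]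
  [MeasurableSpace X] [BorelSpace X] {G : SimpleGraph X} {m : Measure X} {n A : X → X → ℝ}
  {lam κ γ : ℝ} {ν₀ ν₁ : Measure X} {f g : X → ℝ}

theorem IsSchrodingerSystem.swap (hs : IsSchrodingerSystem m A ν₀ ν₁ f g) :
    IsSchrodingerSystem m A ν₁ ν₀ g f :=
  ⟨hs.nonneg_right, hs.nonneg_left, hs.summable_right, hs.summable_left, hs.eq_right, hs.eq_left⟩

theorem exists_singleton_ne_zero (ν : Measure X) [IsProbabilityMeasure ν] : ∃ x, ν {x} ≠ 0 := by
  by_contra! h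
  have h0 : ν Set.univ = 0 := (measure_null_iff_singleton Set.countable_univ).2 fun x _ => h x
  rw [measure_univ] at h0
  exact one_ne_zero h0

theorem IsUniformizedKernel.measureReal_pos (h : IsUniformizedKernel G m n lam κ) (x : X) :
    0 < m.real {x} := ENNReal.toReal_pos (h.mass_ne_zero x) (h.mass_ne_top x)

theorem IsSchrodingerSystem.exists_pos (hs : IsSchrodingerSystem m A ν₀ ν₁ f g)
    (h : IsUniformizedKernel G m n lam κ) [IsProbabilityMeasure ν₀] : ∃ x, 0 < f x := by
  obtain ⟨x, hx⟩ := exists_singleton_ne_zero ν₀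
  refine ⟨x, (hs.nonneg_left x).lt_of_ne fun h0 => ?_⟩
  have := hs.eq_left x
  rw [← h0, zero_mul] at this
  have h1 : 0 < ν₀.real {x} := ENNReal.toReal_pos hx (measure_ne_top _ _)
  have h2 := div_pos h1 (h.measureReal_pos x)
  exact h2.ne this

theorem IsSchrodingerSystem.semigroupApply_pos (hs : IsSchrodingerSystem m A ν₀ ν₁ f g)
    (h : IsUniformizedKernel G m n lam κ) (hA : IsGeneratorOf A n lam γ) (hγ : 0 < γ)
    [IsProbabilityMeasure ν₀] (x : X) : 0 < semigroupApply A 1 f x := by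
  obtain ⟨y, hy⟩ := hs.exists_pos h
  have hp := h.semigroup_pos hA hγ one_pos x
  exact (mul_pos hy (hp y)).trans_le
    (le_hasSum (hs.summable_left x).hasSum y fun z _ => mul_nonneg (hs.nonneg_left z) (hp z).le)

/-- The other factor P₁g is positive everywhere by irreducibility, so f vanishes wherever ν₀ does.
-/
theorem IsSchrodingerSystem.eq_zero (hs : IsSchrodingerSystem m A ν₀ ν₁ f g)
    (h : IsUniformizedKernel G m n lam κ) (hA : IsGeneratorOf A n lam γ) (hγ : 0 < γ)
    [IsProbabilityMeasure ν₁] {x : X} (hx : ν₀ {x} = 0) : f x = 0 := by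
  have := hs.eq_left x
  rw [measureReal_def, hx, ENNReal.toReal_zero, zero_div] at this
  exact (mul_eq_zero.1 this).resolve_right (hs.swap.semigroupApply_pos h hA hγ x).ne'

theorem IsSchrodingerSystem.finite_support (hs : IsSchrodingerSystem m A ν₀ ν₁ f g)
    (h : IsUniformizedKernel G m n lam κ) (hA : IsGeneratorOf A n lam γ) (hγ : 0 < γ)
    [IsProbabilityMeasure ν₁] {s : Finset X} (hν : ∀ x ∉ s, ν₀ {x} = 0) : f.support.Finite :=
  s.finite_toSet.subset fun x hx => by
    by_contra hxs
    exact hx (hs.eq_zero h hA hγ (hν x hxs))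

theorem sum_measureReal_eq_one (ν : Measure X) [IsProbabilityMeasure ν] {s : Finset X}
    (hν : ∀ x ∉ s, ν {x} = 0) : ∑ x ∈ s, ν.real {x} = 1 := by
  have h0 : ν (s : Set X)ᶜ = 0 :=
    (measure_null_iff_singleton (Set.to_countable _)).2 fun x hx => hν x (by simpa using hx)
  have h1 : ν.real (s : Set X) = 1 := by
    rw [measureReal_def, (prob_compl_eq_zero_iff s.measurableSet).1 h0, ENNReal.toReal_one]
  rw [← h1, sum_measureReal_singleton]

/-- The sum of the second equation of the system, that is, the total mass of ν₁. It normalizes the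
estimates uniformly in γ. -/
theorem IsSchrodingerSystem.pairing_expOp (hs : IsSchrodingerSystem m A ν₀ ν₁ f g)
    (h : IsUniformizedKernel G m n lam κ) (hA : IsGeneratorOf A n lam γ)
    [IsProbabilityMeasure ν₁] (hf : f.support.Finite) {s : Finset X}
    (hν : ∀ x ∉ s, ν₁ {x} = 0) :
    Real.exp (-(γ * lam)) * pairing m s g (expOp h.toPos.op γ (finiteFn f hf)) = 1 := by
  rw [pairing_apply, Finset.mul_sum, ← sum_measureReal_eq_one ν₁ hν]
  refine Finset.sum_congr rfl fun z _ => ?_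
  have h1 := hs.eq_right z
  rw [h.semigroupApply_eq hA 1 hf, mul_one, mul_one, eq_div_iff (h.measureReal_pos z).ne'] at h1
  rw [← h1]
  ring

theorem entropyPsi_eq (t : ℝ) : entropyPsi m A f g t = entropyPhi m A g f (1 - t) := by
  simp only [entropyPsi, entropyPhi, sub_sub_cancel]

theorem exp_mul_log_mul (c t r q : ℝ) :
    Real.log (Real.exp (-(c * t)) * r) * (Real.exp (-(c * t)) * r) *
      (Real.exp (-(c * (1 - t))) * q) =
      Real.exp (-c) * (q * (r * Real.log r)) - c * t * (Real.exp (-c) * (q * r)) := by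
  have e : Real.exp (-c) = Real.exp (-(c * t)) * Real.exp (-(c * (1 - t))) := by
    rw [← Real.exp_add]; ring_nf
  rcases eq_or_ne r 0 with rfl | hr
  · simp
  · rw [Real.log_mul (Real.exp_pos _).ne' hr, Real.log_exp, e]
    ring

/-- Reversibility moves the semigroup from g to F log F and leaves a pairing with a finitely
supported function. By `pairing_expOp`, the logarithm of the scalar factor e^{-γλt} contributes only
an affine term, invisible in second derivatives. -/
theorem IsSchrodingerSystem.entropyPhi_eq (hs : IsSchrodingerSystem m A ν₀ ν₁ f g)
    (h : IsUniformizedKernel G m n lam κ) (hA : IsGeneratorOf A n lam γ) (hγ : 0 < γ)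
    [IsProbabilityMeasure ν₀] [IsProbabilityMeasure ν₁] (hf : f.support.Finite) {s : Finset X}
    (hν : ∀ x ∉ s, ν₁ {x} = 0) {t : ℝ} (ht : t ∈ Set.Icc (0 : ℝ) 1) :
    Integrable (fun z => Real.log (semigroupApply A t f z) * semigroupApply A t f z *
      semigroupApply A (1 - t) g z) m ∧
    entropyPhi m A f g t = Real.exp (-(γ * lam)) * interpEntropy (h.toPos.smul hγ.le).op
      (pairing m s g) (finiteFn f hf) t - γ * lam * t := by
  have hg : g.support.Finite := hs.swap.finite_support h hA hγ hν
  have hg0 : ∀ x ∉ s, finiteFn g hg x = 0 := fun x hx => by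
    rw [finiteFn_apply]; exact hs.swap.eq_zero h hA hγ (hν x hx)
  have hgn : ∀ x, 0 ≤ finiteFn g hg x := fun x => by
    rw [finiteFn_apply]; exact hs.nonneg_right x
  obtain ⟨hi, hd⟩ := h.toPos.integral_expOp_mul h.mass_ne_top h.reversible hgn hg0
    (t := γ * (1 - t)) (mul_nonneg hγ.le (by linarith [ht.2]))
  have hpair : pairing m s (finiteFn g hg) = pairing m s g := by
    rw [funext (finiteFn_apply g hg)]
  rw [hpair] at hd
  set F := expOp h.toPos.op (γ * t) (finiteFn f hf)
  set H := expOp h.toPos.op (γ * (1 - t)) (finiteFn g hg)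
  have e : (fun z => Real.log (semigroupApply A t f z) * semigroupApply A t f z *
      semigroupApply A (1 - t) g z) = fun z => Real.exp (-(γ * lam)) * (H z * entFn F z) -
        γ * lam * t * (Real.exp (-(γ * lam)) * (H z * F z)) := by
    funext z
    rw [h.semigroupApply_eq hA t hf, h.semigroupApply_eq hA (1 - t) hg, entFn_apply]
    exact exp_mul_log_mul _ _ _ _
  have i1 := integrable_mul_bounded hi (entFn F)
  have i2 := integrable_mul_bounded hi F
  have hFH : expOp h.toPos.op (γ * (1 - t)) F = expOp h.toPos.op γ (finiteFn f hf) := by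
    rw [← mul_apply_eq_comp, ← expOp_add]
    congr 2
    ring
  rw [entropyPhi, e]
  refine ⟨(i1.const_mul _).sub ((i2.const_mul _).const_mul _), ?_⟩
  rw [integral_sub (i1.const_mul _) ((i2.const_mul _).const_mul _), integral_const_mul,
    integral_const_mul, integral_const_mul, hd, hd, hFH, hs.pairing_expOp h hA hf hν, mul_one,
    interpEntropy, h.toPos.smul_op hγ.le, expOp_smul, expOp_smul]

end System

/-! ### A uniform lower bound of the second derivatives -/

section LowerBound

variable {X : Type*} [DecidableEq X] [Countable X] [TopologicalSpace X] [DiscreteTopology X]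
  [MeasurableSpace X] [BorelSpace X] {G : SimpleGraph X} {m : Measure X} {n : X → X → ℝ}
  {lam κ : ℝ}

/-- Let d be a number of steps in which the kernel can lead from x to y; the series on the right
dominates a multiple of γ^d. On the left, the terms with k ≤ d gain at most a factor d^j, and those
with k ≥ d are at most γ^d times their value at γ = 1. So the ratio stays bounded as γ → 0. -/
theorem IsUniformizedKernel.exists_pow_op_le (h : IsUniformizedKernel G m n lam κ) (x y : X)
    (j : ℕ) : ∃ C, ∀ γ, 0 < γ → γ ≤ 1 →
      γ ^ j * (h.toPos.op ^ j) (expOp h.toPos.op γ (pointFn y)) x ≤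
        C * expOp h.toPos.op γ (pointFn y) x := by
  obtain ⟨d, hd⟩ := h.exists_pow_op_pointFn_pos x y
  set T := h.toPos.op
  set c := fun k : ℕ => (T ^ k) (pointFn y) x with hc
  have hcn : ∀ k, 0 ≤ c k := fun k => h.toPos.pow_op_nonneg (pointFn_nonneg y) k x
  set D := 1 ^ j * (T ^ j) (expOp T 1 (pointFn y)) x
  have hD : HasSum (fun k : ℕ => (k.descFactorial j : ℝ) * (1 ^ k / (k.factorial : ℝ) * c k)) D :=
    hasSum_descFactorial_expOp T 1 (pointFn y) x j
  have hD0 : 0 ≤ D := hD.nonneg fun k => mul_nonneg (by positivity)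
    (mul_nonneg (by positivity) (hcn k))
  refine ⟨(d : ℝ) ^ j + D * d.factorial / c d, fun γ hγ hγ1 => ?_⟩
  have hF := hasSum_expOp_eval T γ (pointFn y) x
  have hFj := hasSum_descFactorial_expOp T γ (pointFn y) x j
  have hle : γ ^ j * (T ^ j) (expOp T γ (pointFn y)) x ≤
      (d : ℝ) ^ j * expOp T γ (pointFn y) x + γ ^ d * D := by
    refine hasSum_le (fun k => ?_) hFj ((hF.mul_left _).add (hD.mul_left _))
    have h1 := hcn k
    have hw : 0 ≤ γ ^ k / (k.factorial : ℝ) * c k := by positivity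
    have hw1 : 0 ≤ 1 ^ k / (k.factorial : ℝ) * c k := by positivity
    rcases le_total k d with hk | hk
    · have h2 : (k.descFactorial j : ℝ) ≤ (d : ℝ) ^ j := by
        exact_mod_cast (Nat.descFactorial_le_pow k j).trans (Nat.pow_le_pow_left hk j)
      have h3 := mul_le_mul_of_nonneg_right h2 hw
      have h4 : 0 ≤ γ ^ d * ((k.descFactorial j : ℝ) * (1 ^ k / (k.factorial : ℝ) * c k)) := by
        positivity
      linarith
    · have h2 : γ ^ k ≤ γ ^ d := pow_le_pow_of_le_one hγ.le hγ1 hk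
      have h3 : (k.descFactorial j : ℝ) * (γ ^ k / (k.factorial : ℝ) * c k) ≤
          γ ^ d * ((k.descFactorial j : ℝ) * (1 ^ k / (k.factorial : ℝ) * c k)) := by
        have : γ ^ d * ((k.descFactorial j : ℝ) * (1 ^ k / (k.factorial : ℝ) * c k)) =
          (k.descFactorial j : ℝ) * (γ ^ d / (k.factorial : ℝ) * c k) := by rw [one_pow]; ring
        rw [this]
        gcongr
      have h4 : 0 ≤ (d : ℝ) ^ j * (γ ^ k / (k.factorial : ℝ) * c k) := by positivity
      linarith
  have hlow : γ ^ d / (d.factorial : ℝ) * c d ≤ expOp T γ (pointFn y) x :=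
    le_hasSum hF d fun k _ => mul_nonneg (by positivity) (hcn k)
  have hcd : 0 < c d := hd
  have h5 : γ ^ d * D ≤ D * d.factorial / c d * expOp T γ (pointFn y) x := by
    have := mul_le_mul_of_nonneg_left hlow
      (by positivity : 0 ≤ D * d.factorial / c d)
    refine le_of_eq_of_le ?_ this
    field_simp
  linarith

theorem IsUniformizedKernel.exists_pow_op_le_of_finset (h : IsUniformizedKernel G m n lam κ)
    (s₀ s₁ : Finset X) (j : ℕ) : ∃ C, 0 ≤ C ∧ ∀ γ, 0 < γ → γ ≤ 1 → ∀ y ∈ s₀, ∀ x ∈ s₁,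
      γ ^ j * (h.toPos.op ^ j) (expOp h.toPos.op γ (pointFn y)) x ≤
        C * expOp h.toPos.op γ (pointFn y) x := by
  choose C hC using fun x y => h.exists_pow_op_le x y j
  refine ⟨∑ y ∈ s₀, ∑ x ∈ s₁, |C x y|, by positivity, fun γ hγ hγ1 y hy x hx =>
    (hC x y γ hγ hγ1).trans (mul_le_mul_of_nonneg_right ?_ (h.expOp_pointFn_pos hγ x y).le)⟩
  refine (le_abs_self _).trans ?_
  exact (Finset.single_le_sum (f := fun x => |C x y|) (fun _ _ => abs_nonneg _) hx).trans
    (Finset.single_le_sum (f := fun y => ∑ x ∈ s₁, |C x y|)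
      (fun _ _ => Finset.sum_nonneg fun _ _ => abs_nonneg _) hy)

/-- Expanding f in point functions on s₀ compares the two sides term by term with non-negative
weights, so the constant does not depend on f and g. -/
theorem IsUniformizedKernel.exists_pairing_pow_op_le (h : IsUniformizedKernel G m n lam κ)
    (s₀ s₁ : Finset X) (j : ℕ) : ∃ C, 0 ≤ C ∧ ∀ γ, 0 < γ → γ ≤ 1 → ∀ (f g : X → ℝ)
      (hf : f.support.Finite), (∀ x, 0 ≤ f x) → (∀ x, 0 ≤ g x) → (∀ x ∉ s₀, f x = 0) →
      γ ^ j * pairing m s₁ g ((h.toPos.op ^ j) (expOp h.toPos.op γ (finiteFn f hf))) ≤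
        C * pairing m s₁ g (expOp h.toPos.op γ (finiteFn f hf)) := by
  obtain ⟨C, hC0, hC⟩ := h.exists_pow_op_le_of_finset s₀ s₁ j
  refine ⟨C, hC0, fun γ hγ hγ1 f g hf hfn hgn hf0 => ?_⟩
  have hsum : finiteFn f hf = ∑ y ∈ s₀, f y • pointFn y := by
    ext x
    rw [finiteFn_apply, sum_smul_pointFn_apply]
    split_ifs with hx
    · rfl
    · exact hf0 x hx
  have key : ∀ x ∈ s₁, γ ^ j * (h.toPos.op ^ j) (expOp h.toPos.op γ (finiteFn f hf)) x ≤
      C * expOp h.toPos.op γ (finiteFn f hf) x := by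
    intro x hx
    simp only [hsum, map_sum, map_smul, BoundedContinuousFunction.sum_apply,
      BoundedContinuousFunction.smul_apply, smul_eq_mul, Finset.mul_sum]
    refine Finset.sum_le_sum fun y hy => ?_
    have := mul_le_mul_of_nonneg_left (hC γ hγ hγ1 y hy x hx) (hfn y)
    linarith
  rw [pairing_apply, pairing_apply, Finset.mul_sum, Finset.mul_sum]
  refine Finset.sum_le_sum fun x hx => ?_
  have := mul_le_mul_of_nonneg_left (key x hx)
    (mul_nonneg measureReal_nonneg (hgn x) : 0 ≤ m.real {x} * g x)
  linarith

/-- Regularity of `φ_γ` and a lower bound of its second derivative, uniform in the temperature. -/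
theorem IsUniformizedKernel.exists_entropyPhi_deriv_bound (h : IsUniformizedKernel G m n lam κ)
    (s₀ s₁ : Finset X) : ∃ C, 0 ≤ C ∧ ∀ (γ : ℝ) (A : X → X → ℝ) (ν₀ ν₁ : Measure X) (f g : X → ℝ),
      0 < γ → γ ≤ 1 → IsGeneratorOf A n lam γ → IsProbabilityMeasure ν₀ →
      IsProbabilityMeasure ν₁ → IsSchrodingerSystem m A ν₀ ν₁ f g → (∀ x ∉ s₀, ν₀ {x} = 0) →
      (∀ x ∉ s₁, ν₁ {x} = 0) → ContinuousOn (entropyPhi m A f g) (Set.Icc 0 1) ∧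
      ∃ φ₁ φ₂ : ℝ → ℝ, (∀ t ∈ Set.Ioo (0 : ℝ) 1, HasDerivAt (entropyPhi m A f g) (φ₁ t) t) ∧
        (∀ t ∈ Set.Ioo (0 : ℝ) 1, HasDerivAt φ₁ (φ₂ t) t) ∧
        ∀ t ∈ Set.Ioo (0 : ℝ) 1, -(C * (1 + 1 / t)) ≤ φ₂ t := by
  obtain ⟨C₁, hC₁0, hC₁⟩ := h.exists_pairing_pow_op_le s₀ s₁ 1
  obtain ⟨C₂, hC₂0, hC₂⟩ := h.exists_pairing_pow_op_le s₀ s₁ 2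
  have hκ := h.κ_nonneg
  refine ⟨κ * (C₁ + C₂), by positivity, fun γ A ν₀ ν₁ f g hγ hγ1 hA hp0 hp1 hs hν₀ hν₁ => ?_⟩
  have hf : f.support.Finite := hs.finite_support h hA hγ hν₀
  have hf0 : ∀ x ∉ s₀, f x = 0 := fun x hx => hs.eq_zero h hA hγ (hν₀ x hx)
  have hfn : ∀ x, 0 ≤ finiteFn f hf x := fun x => by rw [finiteFn_apply]; exact hs.nonneg_left x
  have hφ : ∀ t ∈ Set.Icc (0 : ℝ) 1, entropyPhi m A f g t = Real.exp (-(γ * lam)) *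
      interpEntropy (h.toPos.smul hγ.le).op (pairing m s₁ g) (finiteFn f hf) t - γ * lam * t :=
    fun t ht => (hs.entropyPhi_eq h hA hγ hf hν₁ ht).2
  have hpos : ∀ t, 0 < t → ∀ x, 0 < expOp (h.toPos.smul hγ.le).op t (finiteFn f hf) x := by
    intro t ht x
    obtain ⟨y, hy⟩ := hs.exists_pos h
    rw [h.toPos.smul_op hγ.le, expOp_smul]
    exact h.expOp_pos hfn (y := y) (by rwa [finiteFn_apply]) (mul_pos hγ ht) x
  obtain ⟨φ₁, φ₂, h1, h2, h3⟩ := (h.toPos.smul hγ.le).exists_hasDerivAt_interpEntropy hfn hpos hκ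
    (fun x y => by
      have := mul_le_mul_of_nonneg_left (h.lam_mul_le x y) (sq_nonneg γ)
      linarith) (pairing m s₁ g) (pairing_nonneg s₁ hs.nonneg_right)
  refine ⟨?_, fun t => Real.exp (-(γ * lam)) * φ₁ t - γ * lam, fun t => Real.exp (-(γ * lam)) *
    φ₂ t, fun t ht => ?_, fun t ht => ((h2 t ht.1).const_mul _).sub_const _, fun t ht => ?_⟩
  · refine ContinuousOn.congr ?_ hφ
    exact ((continuous_const.mul (continuous_interpEntropy _ _ _)).sub
      (continuous_const.mul continuous_id)).continuousOn
  · have hd := ((h1 t ht.1).const_mul (Real.exp (-(γ * lam)))).sub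
      ((hasDerivAt_id t).const_mul (γ * lam))
    rw [mul_one] at hd
    refine hd.congr_of_eventuallyEq ?_
    filter_upwards [Ioo_mem_nhds ht.1 ht.2] with r hr
    exact hφ r ⟨hr.1.le, hr.2.le⟩
  · have hb := mul_le_mul_of_nonneg_left (h3 t ht.1 ht.2) (Real.exp_pos (-(γ * lam))).le
    -- The normalization reduces the bounds on the first and second powers to the constants C₁ and
    -- C₂.
    have hone := hs.pairing_expOp h hA hf hν₁
    have b1 := mul_le_mul_of_nonneg_left (hC₁ γ hγ hγ1 f g hf hs.nonneg_left hs.nonneg_right hf0)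
      (Real.exp_pos (-(γ * lam))).le
    have b2 := mul_le_mul_of_nonneg_left (hC₂ γ hγ hγ1 f g hf hs.nonneg_left hs.nonneg_right hf0)
      (Real.exp_pos (-(γ * lam))).le
    rw [mul_left_comm _ C₁, hone, mul_one, pow_one, pow_one] at b1
    rw [mul_left_comm _ C₂, hone, mul_one, pow_two h.toPos.op, mul_apply_eq_comp] at b2
    simp only [h.toPos.smul_op hγ.le, expOp_smul, mul_one, smul_apply, map_smul, smul_eq_mul] at hb
    refine le_trans ?_ hb
    generalize pairing m s₁ g (h.toPos.op (h.toPos.op (expOp h.toPos.op γ (finiteFn f hf)))) = p₂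
      at *
    generalize pairing m s₁ g (h.toPos.op (expOp h.toPos.op γ (finiteFn f hf))) = p₁ at *
    have ht0 := ht.1
    have b1' := div_le_div_of_nonneg_right b1 ht0.le
    have b3 : Real.exp (-(γ * lam)) * (γ ^ 2 * p₂) + Real.exp (-(γ * lam)) * (γ * p₁) / t ≤
        (C₁ + C₂) * (1 + 1 / t) := by
      have : 0 ≤ C₂ / t := by positivity
      have e : (C₁ + C₂) * (1 + 1 / t) = C₁ + C₂ + C₁ / t + C₂ / t := by ring
      linarith
    have b4 := mul_le_mul_of_nonneg_left b3 hκ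
    calc -(κ * (C₁ + C₂) * (1 + 1 / t)) ≤ -(κ * (Real.exp (-(γ * lam)) * (γ ^ 2 * p₂) +
          Real.exp (-(γ * lam)) * (γ * p₁) / t)) := by linarith
      _ = _ := by ring

end LowerBound

/-! ### Integrability of second derivatives with a one-sided bound -/

/-- A derivative bounded above by an integrable function is integrable on a compact interval. -/
theorem integrableOn_deriv_of_le {V v χ : ℝ → ℝ} {c d : ℝ} (hcd : c ≤ d)
    (hV : ∀ u ∈ Set.Icc c d, HasDerivAt V (v u) u) (hv : Measurable v)
    (hχ : IntegrableOn χ (Set.Icc c d)) (hle : ∀ u ∈ Set.Ioo c d, v u ≤ χ u) :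
    IntegrableOn v (Set.Ioc c d) ∧ ∫ u in c..d, v u = V d - V c := by
  have hcont : ContinuousOn V (Set.Icc c d) := fun u hu => (hV u hu).continuousAt.continuousWithinAt
  set μ := volume.restrict (Set.Ioo c d)
  have hχμ : Integrable χ μ := hχ.mono_set Set.Ioo_subset_Icc_self
  set B := (∫ u in c..d, χ u) - (V d - V c)
  have hmeas : AEStronglyMeasurable (fun u => χ u - v u) (volume.restrict (Set.Icc c d)) :=
    hχ.aestronglyMeasurable.sub hv.aestronglyMeasurable
  -- χ - v is truncated at level k: χ minus the truncation is integrable and still dominates v. The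
  -- one-sided mean value inequality then bounds the integral of the truncation by B for every k,
  -- and Fatou's lemma removes the truncation.
  have hmin : ∀ k : ℕ, IntegrableOn (fun u => min (χ u - v u) k ⊔ 0) (Set.Icc c d) := by
    intro k
    refine Integrable.of_bound ?_ (k : ℝ) (ae_of_all _ fun u => ?_)
    · exact (hmeas.inf aestronglyMeasurable_const).sup aestronglyMeasurable_const
    · rw [Real.norm_of_nonneg le_sup_right]
      exact sup_le (min_le_right _ _) (Nat.cast_nonneg k)
  have hbound : ∀ k : ℕ, ∫⁻ u, ENNReal.ofReal (min (χ u - v u) k) ∂μ ≤ ENNReal.ofReal B := by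
    intro k
    have h1 := intervalIntegral.sub_le_integral_of_hasDeriv_right_of_le hcd hcont
      (fun u hu => (hV u (Set.Ioo_subset_Icc_self hu)).hasDerivWithinAt)
      (hχ.sub (hmin k)) (fun u hu => by
        have h2 := hle u hu
        have h3 : min (χ u - v u) k ⊔ 0 ≤ χ u - v u := sup_le (min_le_left _ _) (by linarith)
        simp only [Pi.sub_apply]
        linarith)
    have hi1 : IntervalIntegrable χ volume c d :=
      (intervalIntegrable_iff_integrableOn_Icc_of_le hcd).2 hχ
    have hi2 : IntervalIntegrable (fun u => min (χ u - v u) k ⊔ 0) volume c d :=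
      (intervalIntegrable_iff_integrableOn_Icc_of_le hcd).2 (hmin k)
    have h4 : ∫ u in c..d, (χ - fun u => min (χ u - v u) k ⊔ 0) u =
        (∫ u in c..d, χ u) - ∫ u in c..d, min (χ u - v u) k ⊔ 0 :=
      intervalIntegral.integral_sub hi1 hi2
    rw [h4] at h1
    have h5 : ∫ u in c..d, min (χ u - v u) k ⊔ 0 = ∫ u, min (χ u - v u) k ⊔ 0 ∂μ := by
      rw [intervalIntegral.integral_of_le hcd, integral_Ioc_eq_integral_Ioo]
    have h6 : ∫⁻ u, ENNReal.ofReal (min (χ u - v u) k) ∂μ =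
        ENNReal.ofReal (∫ u, min (χ u - v u) k ⊔ 0 ∂μ) := by
      rw [ofReal_integral_eq_lintegral_ofReal ((hmin k).mono_set Set.Ioo_subset_Icc_self)
        (ae_of_all _ fun u => le_sup_right)]
      refine lintegral_congr fun u => ?_
      rcases le_total (min (χ u - v u) (k : ℝ)) 0 with h0 | h0
      · rw [sup_eq_right.2 h0, ENNReal.ofReal_of_nonpos h0, ENNReal.ofReal_zero]
      · rw [sup_eq_left.2 h0]
    rw [h6, ← h5]
    refine ENNReal.ofReal_le_ofReal ?_
    simp only [B]
    linarith
  have hmeasμ : AEStronglyMeasurable (fun u => χ u - v u) μ :=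
    hmeas.mono_measure (Measure.restrict_mono Set.Ioo_subset_Icc_self le_rfl)
  have hfin : ∫⁻ u, ENNReal.ofReal (χ u - v u) ∂μ ≤ ENNReal.ofReal B := by
    have h1 : ∀ u, liminf (fun k : ℕ => ENNReal.ofReal (min (χ u - v u) k)) atTop =
        ENNReal.ofReal (χ u - v u) := by
      intro u
      refine Tendsto.liminf_eq (tendsto_const_nhds.congr' ?_)
      obtain ⟨N, hN⟩ := exists_nat_ge (χ u - v u)
      filter_upwards [eventually_ge_atTop N] with k hk
      rw [min_eq_left (hN.trans (by exact_mod_cast hk))]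
    simp only [← h1]
    refine (lintegral_liminf_le' fun k => ?_).trans ?_
    · exact (hmeasμ.aemeasurable.min aemeasurable_const).ennreal_ofReal
    · exact (liminf_le_liminf (Eventually.of_forall hbound)).trans (by rw [liminf_const])
  have hint : Integrable (fun u => χ u - v u) μ := by
    refine ⟨hmeasμ, ?_⟩
    rw [hasFiniteIntegral_iff_ofReal]
    · exact hfin.trans_lt ENNReal.ofReal_lt_top
    · filter_upwards [self_mem_ae_restrict measurableSet_Ioo] with u hu
      exact sub_nonneg.2 (hle u hu)
  have hvint : IntegrableOn v (Set.Ioo c d) := by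
    have := hχμ.sub hint
    refine this.congr (ae_of_all _ fun u => ?_)
    simp
  have hvint' : IntegrableOn v (Set.Ioc c d) := by
    rwa [integrableOn_Ioc_iff_integrableOn_Ioo]
  refine ⟨hvint', ?_⟩
  exact intervalIntegral.integral_eq_sub_of_hasDerivAt_of_le hcd hcont
    (fun u hu => hV u (Set.Ioo_subset_Icc_self hu))
    ((intervalIntegrable_iff_integrableOn_Ioc_of_le hcd).2 hvint')

/-- The improper version of `integrableOn_deriv_of_le`: it is enough that `V` has a limit along
some sequence tending to the left end point. -/
theorem intervalIntegrable_deriv_of_le {V v χ : ℝ → ℝ} {b ℓ : ℝ} {ξ : ℕ → ℝ}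
    (hV : ∀ u ∈ Set.Ioc 0 b, HasDerivAt V (v u) u) (hv : Measurable v)
    (hχ : IntegrableOn χ (Set.Icc 0 b)) (hle : ∀ u ∈ Set.Ioo 0 b, v u ≤ χ u)
    (hξ : ∀ k, ξ k ∈ Set.Ioc 0 b) (hξ0 : Tendsto ξ atTop (𝓝 0))
    (hVξ : Tendsto (fun k => V (ξ k)) atTop (𝓝 ℓ)) :
    IntervalIntegrable v volume 0 b ∧ ∫ u in 0..b, v u = V b - ℓ := by
  have hb : 0 ≤ b := (hξ 0).1.le.trans (hξ 0).2
  have hsub : ∀ k, Set.Icc (ξ k) b ⊆ Set.Icc 0 b := fun k =>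
    Set.Icc_subset_Icc_left (hξ k).1.le
  have hk : ∀ k, IntegrableOn v (Set.Ioc (ξ k) b) ∧ ∫ u in ξ k..b, v u = V b - V (ξ k) := fun k =>
    integrableOn_deriv_of_le (hξ k).2 (fun u hu => hV u ⟨(hξ k).1.trans_le hu.1, hu.2⟩) hv
      (hχ.mono_set (hsub k)) fun u hu => hle u ⟨(hξ k).1.trans hu.1, hu.2⟩
  have hχ' : IntegrableOn χ (Set.Ioc 0 b) := hχ.mono_set Set.Ioc_subset_Icc_self
  have hχk : ∀ k, IntegrableOn χ (Set.Ioc (ξ k) b) := fun k =>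
    hχ'.mono_set (Set.Ioc_subset_Ioc_left (hξ k).1.le)
  set M := ∫ u in Set.Ioc 0 b, ‖χ u‖
  have hM : ∀ k, ∫ u in Set.Ioc (ξ k) b, ‖χ u - v u‖ ≤ M - (V b - V (ξ k)) := by
    intro k
    have h1 : ∫ u in Set.Ioc (ξ k) b, ‖χ u - v u‖ = ∫ u in Set.Ioc (ξ k) b, (χ u - v u) := by
      rw [integral_Ioc_eq_integral_Ioo, integral_Ioc_eq_integral_Ioo]
      refine setIntegral_congr_fun measurableSet_Ioo fun u hu => ?_
      exact Real.norm_of_nonneg (sub_nonneg.2 (hle u ⟨(hξ k).1.trans hu.1, hu.2⟩))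
    rw [h1, integral_sub (hχk k) (hk k).1, ← intervalIntegral.integral_of_le (hξ k).2 (f := v),
      (hk k).2]
    refine sub_le_sub_right ?_ _
    calc ∫ u in Set.Ioc (ξ k) b, χ u ≤ ∫ u in Set.Ioc (ξ k) b, ‖χ u‖ :=
          integral_mono (hχk k) (hχk k).norm fun u => le_abs_self _
      _ ≤ M := setIntegral_mono_set hχ'.norm (ae_of_all _ fun u => norm_nonneg _)
          (Set.Ioc_subset_Ioc_left (hξ k).1.le).eventuallyLE
  have hlim : Tendsto (fun k => M - (V b - V (ξ k))) atTop (𝓝 (M - (V b - ℓ))) :=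
    (hVξ.const_sub _).const_sub _
  have hint : IntegrableOn (fun u => χ u - v u) (Set.Ioc 0 b) := by
    refine integrableOn_Ioc_of_intervalIntegral_norm_bounded_left
      (I := M - (V b - ℓ) + 1) (fun k => (hχk k).sub (hk k).1) hξ0 ?_
    filter_upwards [hlim.eventually_lt_const (lt_add_one _)] with k hk1
    exact (hM k).trans hk1.le
  have hvint : IntegrableOn v (Set.Ioc 0 b) := by
    refine (hχ'.sub hint).congr (ae_of_all _ fun u => ?_)
    simp
  have hvi : IntervalIntegrable v volume 0 b :=
    (intervalIntegrable_iff_integrableOn_Ioc_of_le hb).2 hvint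
  refine ⟨hvi, ?_⟩
  have hprim : ContinuousOn (fun c => ∫ u in c..b, v u) (Set.uIcc 0 b) :=
    intervalIntegral.continuousOn_primitive_interval_left (by
      rwa [Set.uIcc_of_le hb, integrableOn_Icc_iff_integrableOn_Ioc])
  have hc := hprim 0 Set.left_mem_uIcc
  have h1 : Tendsto (fun k => ∫ u in ξ k..b, v u) atTop (𝓝 (∫ u in 0..b, v u)) := by
    refine hc.tendsto.comp (tendsto_nhdsWithin_iff.2 ⟨hξ0, Eventually.of_forall fun k => ?_⟩)
    rw [Set.uIcc_of_le hb]
    exact Set.Ioc_subset_Icc_self (hξ k)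
  simp only [(hk _).2] at h1
  exact tendsto_nhds_unique h1 (hVξ.const_sub _)

/-- uF'' is the derivative of uF' - F. Nothing is known of F' near 0, but the mean value theorem on
(ε/2, ε) gives a point ξ with |ξF'(ξ)| ≤ 2|F(ε) - F(ε/2)|, which tends to 0 with ε. A limit along
such a sequence is enough. -/
theorem intervalIntegrable_id_mul_deriv_deriv {F χ : ℝ → ℝ} {b : ℝ} (hb : 0 < b)
    (hF : ContinuousOn F (Set.Icc 0 b))
    (hd : ∀ u ∈ Set.Ioc 0 b, DifferentiableAt ℝ F u ∧ DifferentiableAt ℝ (deriv F) u)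
    (hχ : IntegrableOn χ (Set.Icc 0 b)) (hle : ∀ u ∈ Set.Ioo 0 b, u * deriv (deriv F) u ≤ χ u) :
    IntervalIntegrable (fun u => u * deriv (deriv F) u) volume 0 b ∧
      ∫ u in 0..b, u * deriv (deriv F) u = b * deriv F b - F b + F 0 := by
  have hmv : ∀ k : ℕ, ∃ c ∈ Set.Ioo (b / (k + 1) / 2) (b / (k + 1)),
      deriv F c = (F (b / (k + 1)) - F (b / (k + 1) / 2)) / (b / (k + 1) - b / (k + 1) / 2) := by
    intro k
    have h1 : b / (k + 1) ≤ b := div_le_self hb.le (by linarith [(Nat.cast_nonneg k : (0 : ℝ) ≤ k)])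
    have h0 : 0 < b / ((k : ℝ) + 1) := by positivity
    refine exists_deriv_eq_slope F (by linarith) (hF.mono ?_) ?_
    · exact Set.Icc_subset_Icc (by linarith) h1
    · intro u hu
      exact (hd u ⟨by linarith [hu.1], by linarith [hu.2]⟩).1.differentiableWithinAt
  choose ξ hξm hξd using hmv
  have hε : Tendsto (fun k : ℕ => b / ((k : ℝ) + 1)) atTop (𝓝 0) :=
    tendsto_const_div_atTop_nhds_zero_nat b |>.comp (tendsto_add_atTop_nat 1) |>.congr fun k => by
      simp
  have hε0 : ∀ k : ℕ, 0 < b / ((k : ℝ) + 1) := fun k => by positivity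
  have hεb : ∀ k : ℕ, b / ((k : ℝ) + 1) ≤ b := fun k =>
    div_le_self hb.le (by linarith [(Nat.cast_nonneg k : (0 : ℝ) ≤ k)])
  have hξ : ∀ k, ξ k ∈ Set.Ioc 0 b := fun k =>
    ⟨by linarith [(hξm k).1, hε0 k], by linarith [(hξm k).2, hεb k]⟩
  have hξ0 : Tendsto ξ atTop (𝓝 0) :=
    squeeze_zero (fun k => (hξ k).1.le) (fun k => (hξm k).2.le) hε
  have hlim0 : ∀ {s : ℕ → ℝ}, (∀ k, s k ∈ Set.Icc 0 b) → Tendsto s atTop (𝓝 0) →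
      Tendsto (fun k => F (s k)) atTop (𝓝 (F 0)) := fun hs hs0 =>
    (hF 0 (Set.left_mem_Icc.2 hb.le)).tendsto.comp
      (tendsto_nhdsWithin_iff.2 ⟨hs0, Eventually.of_forall hs⟩)
  have hF1 := hlim0 (s := fun k => b / ((k : ℝ) + 1)) (fun k => ⟨(hε0 k).le, hεb k⟩) hε
  have hF2 := hlim0 (s := fun k => b / ((k : ℝ) + 1) / 2)
    (fun k => ⟨(half_pos (hε0 k)).le, by linarith [hεb k, hε0 k]⟩) (by simpa using hε.div_const 2)
  have hξF : Tendsto (fun k => ξ k * deriv F (ξ k)) atTop (𝓝 0) := by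
    have h3 := (hF1.sub hF2).abs.const_mul 2
    rw [sub_self, abs_zero, mul_zero] at h3
    refine squeeze_zero_norm (fun k => ?_) h3
    rw [hξd k, Real.norm_eq_abs, abs_mul, abs_div, sub_half, abs_of_pos (hξ k).1,
      abs_of_pos (half_pos (hε0 k)), mul_div_assoc', div_le_iff₀ (half_pos (hε0 k))]
    have h4 := (hξm k).2.le
    have h5 := mul_le_mul_of_nonneg_right h4
      (abs_nonneg (F (b / ((k : ℝ) + 1)) - F (b / ((k : ℝ) + 1) / 2)))
    linarith
  have hmain := intervalIntegrable_deriv_of_le (V := fun u => u * deriv F u - F u)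
    (v := fun u => u * deriv (deriv F) u) (ℓ := 0 - F 0) (fun u hu => by
      have h1 := ((hasDerivAt_id u).mul (hd u hu).2.hasDerivAt).sub (hd u hu).1.hasDerivAt
      refine h1.congr_deriv ?_
      simp) (measurable_id.mul (measurable_deriv _)) hχ hle hξ hξ0
      (hξF.sub (hlim0 (fun k => Set.Ioc_subset_Icc_self (hξ k)) hξ0))
  refine ⟨hmain.1, hmain.2.trans ?_⟩
  ring

theorem tent_of_lt {t u : ℝ} (h : u < t) : tent t u = 2 * u / t := by
  rw [tent, if_pos h.le, if_neg (not_le.2 h), add_zero]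

theorem tent_of_gt {t u : ℝ} (h : t < u) : tent t u = 2 * (1 - u) / (1 - t) := by
  rw [tent, if_neg (not_le.2 h), if_pos h.le, zero_add]

/-- Taylor formula with the tent kernel, under a one-sided bound. -/
theorem intervalIntegrable_deriv_deriv_mul_tent {F χ : ℝ → ℝ} {t : ℝ} (ht : t ∈ Set.Ioo (0 : ℝ) 1)
    (hF : ContinuousOn F (Set.Icc 0 1))
    (hd : ∀ u ∈ Set.Ioo (0 : ℝ) 1, DifferentiableAt ℝ F u ∧ DifferentiableAt ℝ (deriv F) u)
    (hχ : IntegrableOn χ (Set.Ioo 0 1))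
    (hle : ∀ u ∈ Set.Ioo (0 : ℝ) 1, deriv (deriv F) u * tent t u ≤ χ u) :
    IntervalIntegrable (fun u => deriv (deriv F) u * tent t u) volume 0 1 ∧
      ∫ u in (0 : ℝ)..1, deriv (deriv F) u * tent t u =
        2 / (t * (1 - t)) * ((1 - t) * F 0 + t * F 1 - F t) := by
  have ht0 := ht.1
  have ht1 : 0 < 1 - t := by linarith [ht.2]
  have hχI : IntervalIntegrable χ volume 0 1 :=
    (intervalIntegrable_iff_integrableOn_Ioo_of_le zero_le_one).2 hχ
  have hχ0 : IntervalIntegrable χ volume 0 t := hχI.mono_set (by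
    rw [Set.uIcc_of_le ht0.le, Set.uIcc_of_le zero_le_one]
    exact Set.Icc_subset_Icc_right ht.2.le)
  have hχ1 : IntervalIntegrable χ volume t 1 := hχI.mono_set (by
    rw [Set.uIcc_of_le ht.2.le, Set.uIcc_of_le zero_le_one]
    exact Set.Icc_subset_Icc_left ht0.le)
  obtain ⟨hl1, hl2⟩ := intervalIntegrable_id_mul_deriv_deriv (χ := fun u => t / 2 * χ u) ht0
    (hF.mono (Set.Icc_subset_Icc_right ht.2.le))
    (fun u hu => hd u ⟨hu.1, hu.2.trans_lt ht.2⟩)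
    ((intervalIntegrable_iff_integrableOn_Icc_of_le ht0.le).1 (hχ0.const_mul _))
    (fun u hu => by
      have h1 := hle u ⟨hu.1, hu.2.trans ht.2⟩
      rw [tent_of_lt hu.2] at h1
      have h2 := mul_le_mul_of_nonneg_left h1 (half_pos ht0).le
      refine le_of_eq_of_le ?_ h2
      field_simp)
  -- The right half of the tent is reduced to the left half by the reflection u ↦ 1 - u.
  have hdF : deriv (fun u => F (1 - u)) = fun u => -deriv F (1 - u) := by
    funext u
    exact deriv_comp_const_sub (f := F) (a := 1) (x := u)
  have hddF : deriv (deriv fun u => F (1 - u)) = fun u => deriv (deriv F) (1 - u) := by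
    rw [hdF]
    funext u
    rw [deriv.fun_neg, deriv_comp_const_sub (f := deriv F) (a := 1) (x := u), neg_neg]
  obtain ⟨hr1, hr2⟩ := intervalIntegrable_id_mul_deriv_deriv (F := fun u => F (1 - u))
    (χ := fun u => (1 - t) / 2 * χ (1 - u)) ht1
    (hF.comp (continuousOn_const.sub continuousOn_id) fun u hu => by
      show 1 - u ∈ Set.Icc (0 : ℝ) 1
      exact ⟨by linarith [hu.2], by linarith [hu.1]⟩)
    (fun u hu => by
      have hm := hd (1 - u) ⟨by linarith [hu.2], by linarith [hu.1]⟩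
      rw [hdF]
      exact ⟨hm.1.comp u ((differentiableAt_const _).sub differentiableAt_id),
        (hm.2.comp u ((differentiableAt_const _).sub differentiableAt_id)).neg⟩)
    ((intervalIntegrable_iff_integrableOn_Icc_of_le ht1.le).1 (by
      have := (hχ1.comp_sub_left 1).symm.const_mul ((1 - t) / 2)
      simpa using this))
    (fun u hu => by
      have h1 := hle (1 - u) ⟨by linarith [hu.2], by linarith [hu.1]⟩
      rw [tent_of_gt (by linarith [hu.2]), sub_sub_cancel] at h1
      have h2 := mul_le_mul_of_nonneg_left h1 (half_pos ht1).le
      rw [hddF]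
      refine le_of_eq_of_le ?_ h2
      field_simp)
  rw [hddF] at hr1 hr2
  rw [hdF] at hr2
  simp only [sub_sub_cancel, sub_zero] at hr2
  have hr1' : IntervalIntegrable (fun u => (1 - u) * deriv (deriv F) u) volume t 1 := by
    have := (hr1.comp_sub_left 1).symm
    simpa using this
  have hr2' : ∫ u in t..1, (1 - u) * deriv (deriv F) u =
      (1 - t) * -deriv F t - F t + F 1 := by
    rw [← hr2]
    have := intervalIntegral.integral_comp_sub_left
      (fun u => (1 - u) * deriv (deriv F) u) (a := 0) (b := 1 - t) 1
    simp only [sub_sub_cancel, sub_zero] at this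
    exact this.symm
  -- At u = t both indicators equal 1 and the two terms add up, so the identity holds only almost
  -- everywhere.
  have hE1 : ∀ᵐ u ∂volume, u ∈ Set.uIoc 0 t →
      2 / t * (u * deriv (deriv F) u) = deriv (deriv F) u * tent t u := by
    filter_upwards [Measure.ae_ne volume t] with u hu hu1
    rw [Set.uIoc_of_le ht0.le] at hu1
    rw [tent_of_lt (lt_of_le_of_ne hu1.2 hu)]
    ring
  have hE2 : ∀ᵐ u ∂volume, u ∈ Set.uIoc t 1 →
      2 / (1 - t) * ((1 - u) * deriv (deriv F) u) = deriv (deriv F) u * tent t u := by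
    refine ae_of_all _ fun u hu1 => ?_
    rw [Set.uIoc_of_le ht.2.le] at hu1
    rw [tent_of_gt hu1.1]
    ring
  have hi1 : IntervalIntegrable (fun u => deriv (deriv F) u * tent t u) volume 0 t :=
    (hl1.const_mul (2 / t)).congr_ae ((ae_restrict_iff' measurableSet_uIoc).2 hE1)
  have hi2 : IntervalIntegrable (fun u => deriv (deriv F) u * tent t u) volume t 1 :=
    (hr1'.const_mul (2 / (1 - t))).congr_ae ((ae_restrict_iff' measurableSet_uIoc).2 hE2)
  refine ⟨hi1.trans hi2, ?_⟩
  rw [← intervalIntegral.integral_add_adjacent_intervals hi1 hi2,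
    ← intervalIntegral.integral_congr_ae hE1, ← intervalIntegral.integral_congr_ae hE2,
    intervalIntegral.integral_const_mul, intervalIntegral.integral_const_mul, hl2, hr2']
  field_simp
  ring

/-! ### Passing to the limit in the convexity inequality -/

/-- The right-hand side of the Taylor formula with the tent kernel. -/
def tentDefect (F : ℝ → ℝ) (t : ℝ) : ℝ := 2 / (t * (1 - t)) * ((1 - t) * F 0 + t * F 1 - F t)

/-- `F` is continuous on `[0, 1]` and twice differentiable on `(0, 1)`. -/
def IsTwiceDiff (F : ℝ → ℝ) : Prop :=
  ContinuousOn F (Set.Icc 0 1) ∧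
    ∀ u ∈ Set.Ioo (0 : ℝ) 1, DifferentiableAt ℝ F u ∧ DifferentiableAt ℝ (deriv F) u

theorem measurable_tent (t : ℝ) : Measurable (tent t) := by
  unfold tent
  refine Measurable.add (Measurable.ite measurableSet_Iic ?_ measurable_const)
    (Measurable.ite measurableSet_Ici ?_ measurable_const)
  · exact (measurable_id.const_mul 2).div_const t
  · exact ((measurable_const.sub measurable_id).const_mul 2).div_const (1 - t)

theorem tent_pos {t u : ℝ} (ht : t ∈ Set.Ioo (0 : ℝ) 1) (hu : u ∈ Set.Ioo (0 : ℝ) 1) :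
    0 < tent t u := by
  have h1 : 0 < 2 * u / t := div_pos (by linarith [hu.1]) ht.1
  have h2 : 0 < 2 * (1 - u) / (1 - t) := div_pos (by linarith [hu.2]) (by linarith [ht.2])
  unfold tent
  split_ifs with h3 h4 h4
  · linarith
  · linarith
  · linarith
  · exact absurd (not_le.1 h3).le h4

/-- Transfers the hypothesis on extended real liminfs to the shifted integrands with values in
`ENNReal`, the form that Fatou's lemma takes. -/
theorem ofReal_mul_tent_le_liminf {d : ℕ → ℝ} {r K B : ℝ} (hK : 0 < K)
    (h : (r : EReal) ≤ liminf (fun k => (d k : EReal)) atTop) :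
    ENNReal.ofReal (r * K + B) ≤ liminf (fun k => ENNReal.ofReal (d k * K + B)) atTop := by
  refine le_of_forall_lt fun b hb => ?_
  obtain ⟨b', hb1, hb2⟩ := exists_between hb
  refine hb1.trans_le ?_
  have hb'top : b' ≠ ⊤ := (hb2.trans ENNReal.ofReal_lt_top).ne
  have hb3 : b'.toReal < r * K + B := (ENNReal.lt_ofReal_iff_toReal_lt hb'top).1 hb2
  have hq : (b'.toReal - B) / K < r := by rw [div_lt_iff₀ hK]; linarith
  have hev := eventually_lt_of_lt_liminf ((EReal.coe_lt_coe_iff.2 hq).trans_le h)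
  refine le_liminf_of_le (by isBoundedDefault) ?_
  filter_upwards [hev] with k hk
  have hk' := EReal.coe_lt_coe_iff.1 hk
  rw [div_lt_iff₀ hK] at hk'
  rw [← ENNReal.ofReal_toReal hb'top]
  exact ENNReal.ofReal_le_ofReal (by linarith)

/-- The Taylor formula for a function with a lower bound of the second derivative. -/
theorem integral_eq_tentDefect {F : ℝ → ℝ} {t B : ℝ} (ht : t ∈ Set.Ioo (0 : ℝ) 1)
    (hF : IsTwiceDiff F) (hB : ∀ u ∈ Set.Ioo (0 : ℝ) 1, -B ≤ deriv (deriv F) u * tent t u) :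
    IntegrableOn (fun u => deriv (deriv F) u * tent t u) (Set.Ioo 0 1) ∧
      (∫ u in Set.Ioo (0 : ℝ) 1, deriv (deriv F) u * tent t u) = tentDefect F t ∧
      -B ≤ tentDefect F t := by
  -- A lower bound of F'' is an upper bound of (-F)'', so the one-sided Taylor formula is applied to
  -- -F.
  have hneg1 : deriv (fun u => -F u) = fun u => -deriv F u := funext fun u => deriv.fun_neg
  have hneg : deriv (deriv fun u => -F u) = fun u => -deriv (deriv F) u := by
    rw [hneg1]
    exact funext fun u => deriv.fun_neg
  have h1 := intervalIntegrable_deriv_deriv_mul_tent (F := fun u => -F u) (χ := fun _ => B) ht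
    hF.1.neg (fun u hu => by
      rw [hneg1]
      exact ⟨(hF.2 u hu).1.neg, (hF.2 u hu).2.neg⟩) (integrable_const B) (fun u hu => by
      rw [hneg]
      linarith [hB u hu])
  rw [hneg] at h1
  have hi : IntegrableOn (fun u => deriv (deriv F) u * tent t u) (Set.Ioo 0 1) := by
    have := h1.1.neg
    simp only [neg_mul, Pi.neg_def, neg_neg] at this
    exact (intervalIntegrable_iff_integrableOn_Ioo_of_le zero_le_one).1 this
  have hval : (∫ u in Set.Ioo (0 : ℝ) 1, deriv (deriv F) u * tent t u) = tentDefect F t := by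
    have h2 := h1.2
    simp only [neg_mul, intervalIntegral.integral_neg] at h2
    rw [intervalIntegral.integral_of_le zero_le_one, integral_Ioc_eq_integral_Ioo] at h2
    rw [tentDefect]
    linarith
  refine ⟨hi, hval, ?_⟩
  rw [← hval]
  have h3 := setIntegral_mono_on (integrable_const (-B)) hi measurableSet_Ioo hB
  simpa using h3

/-- Fatou's lemma for the second derivatives against the tent kernel. -/
theorem exists_tentDefect_le {Φ : ℕ → ℝ → ℝ} {φ₀ : ℝ → ℝ} {t B M : ℝ}
    (ht : t ∈ Set.Ioo (0 : ℝ) 1)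
    (hΦ : ∀ᶠ k in atTop, IsTwiceDiff (Φ k) ∧
      ∀ u ∈ Set.Ioo (0 : ℝ) 1, -B ≤ deriv (deriv (Φ k)) u * tent t u)
    (hM : ∀ᶠ k in atTop, tentDefect (Φ k) t ≤ M) (hφ₀ : IsTwiceDiff φ₀)
    (hlim : ∀ u ∈ Set.Ioo (0 : ℝ) 1, ((deriv (deriv φ₀) u : ℝ) : EReal) ≤
      liminf (fun k => ((deriv (deriv (Φ k)) u : ℝ) : EReal)) atTop) :
    IntervalIntegrable (fun u => deriv (deriv φ₀) u * tent t u) volume 0 1 ∧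
      (∫ u in (0 : ℝ)..1, deriv (deriv φ₀) u * tent t u) = tentDefect φ₀ t ∧
      ∀ ε > 0, ∀ᶠ k in atTop, tentDefect φ₀ t ≤ tentDefect (Φ k) t + ε := by
  set μ := volume.restrict (Set.Ioo (0 : ℝ) 1) with hμ
  have hμuniv : μ.real Set.univ = 1 := by
    simp [hμ, measureReal_def]
  have hfin : IsFiniteMeasure μ := by rw [hμ]; exact ⟨by simp⟩
  set a : ℕ → ℝ → ENNReal := fun k u => ENNReal.ofReal (deriv (deriv (Φ k)) u * tent t u + B)
  have hameas : ∀ k, Measurable (a k) := fun k =>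
    (((measurable_deriv _).mul (measurable_tent t)).add_const B).ennreal_ofReal
  have haint : ∀ᶠ k in atTop, 0 ≤ tentDefect (Φ k) t + B ∧
      ∫⁻ u, a k u ∂μ = ENNReal.ofReal (tentDefect (Φ k) t + B) := by
    filter_upwards [hΦ] with k hk
    obtain ⟨hi, hval, -⟩ := integral_eq_tentDefect ht hk.1 hk.2
    have hval2 : ∫ u, (deriv (deriv (Φ k)) u * tent t u + B) ∂μ = tentDefect (Φ k) t + B := by
      rw [integral_add hi (integrable_const B), hval, integral_const, hμuniv, one_smul]
    have hnn : 0 ≤ᵐ[μ] fun u => deriv (deriv (Φ k)) u * tent t u + B := by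
      filter_upwards [self_mem_ae_restrict measurableSet_Ioo] with u hu
      have := hk.2 u hu
      simp only [Pi.zero_apply]
      linarith
    refine ⟨hval2 ▸ integral_nonneg_of_ae hnn, ?_⟩
    rw [← hval2]
    exact (ofReal_integral_eq_lintegral_ofReal (hi.add (integrable_const B)) hnn).symm
  set c : ℝ → ENNReal := fun u => liminf (fun k => a k u) atTop with hc
  have hcmeas : Measurable c := Measurable.liminf hameas
  have hα : ∫⁻ u, c u ∂μ ≤ liminf (fun k => ENNReal.ofReal (tentDefect (Φ k) t + B)) atTop := by
    refine (lintegral_liminf_le hameas).trans (le_of_eq (liminf_congr ?_))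
    filter_upwards [haint] with k hk
    exact hk.2
  have hαtop : ∫⁻ u, c u ∂μ ≠ ⊤ := by
    refine ne_top_of_le_ne_top (b := ENNReal.ofReal (M + B)) ENNReal.ofReal_ne_top (hα.trans ?_)
    refine liminf_le_of_le (by isBoundedDefault) fun b hb => ?_
    obtain ⟨k, hk1, hk2⟩ := (hb.and hM).exists
    exact hk1.trans (ENNReal.ofReal_le_ofReal (by linarith))
  have hcint : Integrable (fun u => (c u).toReal) μ :=
    integrable_toReal_of_lintegral_ne_top hcmeas.aemeasurable hαtop
  have hcfin : ∀ᵐ u ∂μ, c u ≠ ⊤ := by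
    filter_upwards [ae_lt_top hcmeas hαtop] with u hu using hu.ne
  classical
  -- The Taylor formula needs its upper bound at every point. On the null set where the liminf is
  -- infinite, χ is set equal to the function to be bounded.
  set χ : ℝ → ℝ := fun u =>
    if c u = ⊤ then deriv (deriv φ₀) u * tent t u else (c u).toReal - B with hχ
  have hχae : χ =ᵐ[μ] fun u => (c u).toReal - B := by
    filter_upwards [hcfin] with u hu
    simp only [hχ, if_neg hu]
  have hχint : Integrable χ μ := (hcint.sub (integrable_const B)).congr hχae.symm
  have hle : ∀ u ∈ Set.Ioo (0 : ℝ) 1, deriv (deriv φ₀) u * tent t u ≤ χ u := by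
    intro u hu
    simp only [hχ]
    split_ifs with hcu
    · exact le_rfl
    · have h1 : ENNReal.ofReal (deriv (deriv φ₀) u * tent t u + B) ≤ c u :=
        ofReal_mul_tent_le_liminf (tent_pos ht hu) (hlim u hu)
      have h2 := (ENNReal.ofReal_le_iff_le_toReal hcu).1 h1
      linarith
  obtain ⟨h1, h2⟩ := intervalIntegrable_deriv_deriv_mul_tent ht hφ₀.1 hφ₀.2 hχint hle
  refine ⟨h1, h2, fun ε hε => ?_⟩
  have h3 : tentDefect φ₀ t + B ≤ (∫⁻ u, c u ∂μ).toReal := by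
    have hi : IntegrableOn (fun u => deriv (deriv φ₀) u * tent t u) (Set.Ioo 0 1) :=
      (intervalIntegrable_iff_integrableOn_Ioo_of_le zero_le_one).1 h1
    have h4 : ∫ u, deriv (deriv φ₀) u * tent t u ∂μ = tentDefect φ₀ t := by
      rw [tentDefect, ← h2, intervalIntegral.integral_of_le zero_le_one,
        integral_Ioc_eq_integral_Ioo]
    have h5 : ∫ u, deriv (deriv φ₀) u * tent t u ∂μ ≤ ∫ u, χ u ∂μ := by
      refine integral_mono_ae hi hχint ?_
      filter_upwards [self_mem_ae_restrict measurableSet_Ioo] with u hu using hle u hu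
    rw [h4, integral_congr_ae hχae, integral_sub hcint (integrable_const B), integral_const,
      hμuniv, one_smul, integral_toReal hcmeas.aemeasurable (ae_lt_top hcmeas hαtop)] at h5
    linarith
  -- `ENNReal.ofReal` does not see negative thresholds. In that case the bound -B on the defect of Φ
  -- k suffices.
  rcases le_or_gt (tentDefect φ₀ t - ε + B) 0 with hneg | hpos
  · filter_upwards [haint] with k hk
    linarith [hk.1]
  · have h6 : ENNReal.ofReal (tentDefect φ₀ t - ε + B) <
        liminf (fun k => ENNReal.ofReal (tentDefect (Φ k) t + B)) atTop := by
      refine lt_of_lt_of_le ?_ hα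
      rw [ENNReal.ofReal_lt_iff_lt_toReal hpos.le hαtop]
      linarith
    filter_upwards [eventually_lt_of_lt_liminf h6] with k hk
    have := (ENNReal.ofReal_lt_ofReal_iff_of_nonneg hpos.le).1 hk
    linarith

/-- The tent vanishes linearly at both ends, which absorbs the singularity of C(1 + 1/u) and that of
its mirror image. -/
theorem inv_mul_tent_le {t u : ℝ} (ht : t ∈ Set.Ioo (0 : ℝ) 1) (hu : u ∈ Set.Ioo (0 : ℝ) 1) :
    (1 + 1 / u) * tent t u ≤ 8 / (t * (1 - t)) ∧
      (1 + 1 / (1 - u)) * tent t u ≤ 8 / (t * (1 - t)) := by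
  have ht0 := ht.1
  have ht1 : 0 < 1 - t := by linarith [ht.2]
  have hu0 := hu.1
  have hu1 : 0 < 1 - u := by linarith [hu.2]
  -- Each of the two terms is at most half of this bound; the factor 4 allows for u = t, where both
  -- are present.
  have hle : tent t u ≤ 4 * (u * (1 - u)) / (t * (1 - t)) := by
    have h1 : u ≤ t → 2 * u / t ≤ 2 * (u * (1 - u)) / (t * (1 - t)) := by
      intro h
      rw [div_le_div_iff₀ ht0 (by positivity)]
      have := mul_le_mul_of_nonneg_left (by linarith : 1 - t ≤ 1 - u) (by positivity : 0 ≤ u * t)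
      linarith
    have h2 : t ≤ u → 2 * (1 - u) / (1 - t) ≤ 2 * (u * (1 - u)) / (t * (1 - t)) := by
      intro h
      rw [div_le_div_iff₀ ht1 (by positivity)]
      have := mul_le_mul_of_nonneg_left h (by positivity : 0 ≤ (1 - u) * (1 - t))
      linarith
    have h3 : 4 * (u * (1 - u)) / (t * (1 - t)) = 2 * (u * (1 - u)) / (t * (1 - t)) +
        2 * (u * (1 - u)) / (t * (1 - t)) := by ring
    have h4 : 0 ≤ 2 * (u * (1 - u)) / (t * (1 - t)) := by positivity
    rw [h3]
    unfold tent
    refine add_le_add ?_ ?_ <;> split_ifs with h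
    · exact h1 h
    · exact h4
    · exact h2 h
    · exact h4
  have hpos : 0 < t * (1 - t) := by positivity
  constructor
  · refine (mul_le_mul_of_nonneg_left hle (by positivity)).trans ?_
    rw [mul_div_assoc']
    refine div_le_div_of_nonneg_right ?_ hpos.le
    have : (1 + 1 / u) * (4 * (u * (1 - u))) = 4 * (1 - u) * (1 + u) := by field_simp; ring
    rw [this]
    nlinarith
  · refine (mul_le_mul_of_nonneg_left hle (by positivity)).trans ?_
    rw [mul_div_assoc']
    refine div_le_div_of_nonneg_right ?_ hpos.le
    have : (1 + 1 / (1 - u)) * (4 * (u * (1 - u))) = 4 * u * (2 - u) := by field_simp; ring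
    rw [this]
    nlinarith

/-- The limit of the convexity inequality. -/
theorem cost_le_of_tendsto {Φ Ψ : ℕ → ℝ → ℝ} {φ₀ ψ₀ : ℝ → ℝ} {t B J : ℝ}
    (ht : t ∈ Set.Ioo (0 : ℝ) 1)
    (hΦ : ∀ᶠ k in atTop, IsTwiceDiff (Φ k) ∧
      ∀ u ∈ Set.Ioo (0 : ℝ) 1, -B ≤ deriv (deriv (Φ k)) u * tent t u)
    (hΨ : ∀ᶠ k in atTop, IsTwiceDiff (Ψ k) ∧
      ∀ u ∈ Set.Ioo (0 : ℝ) 1, -B ≤ deriv (deriv (Ψ k)) u * tent t u)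
    (hJ : Tendsto (fun k => tentDefect (Φ k) t + tentDefect (Ψ k) t) atTop (𝓝 J))
    (hφ₀ : IsTwiceDiff φ₀) (hψ₀ : IsTwiceDiff ψ₀)
    (hφ : ∀ u ∈ Set.Ioo (0 : ℝ) 1, ((deriv (deriv φ₀) u : ℝ) : EReal) ≤
      liminf (fun k => ((deriv (deriv (Φ k)) u : ℝ) : EReal)) atTop)
    (hψ : ∀ u ∈ Set.Ioo (0 : ℝ) 1, ((deriv (deriv ψ₀) u : ℝ) : EReal) ≤
      liminf (fun k => ((deriv (deriv (Ψ k)) u : ℝ) : EReal)) atTop) :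
    IntervalIntegrable (fun u => deriv (deriv φ₀) u * tent t u) volume 0 1 ∧
      IntervalIntegrable (fun u => deriv (deriv ψ₀) u * tent t u) volume 0 1 ∧
      cost φ₀ ψ₀ t = tentDefect φ₀ t + tentDefect ψ₀ t ∧ cost φ₀ ψ₀ t ≤ J := by
  have hJ1 := hJ.eventually_lt_const (lt_add_one J)
  -- Only the sum of the two defects is known to converge. Each is bounded above all the same,
  -- because the other is at least -B.
  obtain ⟨a1, a2, a3⟩ := exists_tentDefect_le (M := J + 1 + B) ht hΦ (by
    filter_upwards [hJ1, hΨ] with k h1 h2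
    linarith [(integral_eq_tentDefect ht h2.1 h2.2).2.2]) hφ₀ hφ
  obtain ⟨b1, b2, b3⟩ := exists_tentDefect_le (M := J + 1 + B) ht hΨ (by
    filter_upwards [hJ1, hΦ] with k h1 h2
    linarith [(integral_eq_tentDefect ht h2.1 h2.2).2.2]) hψ₀ hψ
  have hcost : cost φ₀ ψ₀ t = tentDefect φ₀ t + tentDefect ψ₀ t := by rw [cost, a2, b2]
  refine ⟨a1, b1, hcost, ?_⟩
  rw [hcost]
  refine le_of_forall_pos_le_add fun ε hε => ?_
  obtain ⟨k, ⟨h1, h2⟩, h3⟩ := (((a3 (ε / 3) (by positivity)).and (b3 (ε / 3) (by positivity))).and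
    (hJ.eventually_lt_const (lt_add_of_pos_right J (by positivity : 0 < ε / 3)))).exists
  linarith

/-! ### The Schrödinger bridge has density `f(X₀) g(X₁)` -/

section FiniteDimensional

variable {X : Type*} [DecidableEq X] [MeasurableSpace X] {m : Measure X} {A : X → X → ℝ}
  {R : Measure (PathSpace X)}

theorem IsMarkovPathMeasure.apply_zero (hR : IsMarkovPathMeasure m A R) (x : X) :
    R {ω | ω.1 0 = x} = m {x} := by
  have := hR 0 (fun _ => 0) (fun _ => x) (fun a b hab => by
    have := Fin.lt_def.1 hab
    omega) rfl
  simpa using this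

theorem IsMarkovPathMeasure.apply_zero_one (hR : IsMarkovPathMeasure m A R) (x y : X) :
    R {ω | ω.1 0 = x ∧ ω.1 1 = y} = m {x} * ENNReal.ofReal (semigroup A 1 x y) := by
  have := hR 1 ![0, 1] ![x, y] (by
    rw [Fin.strictMono_iff_lt_succ]
    intro i
    fin_cases i
    simp) rfl
  simpa [Fin.forall_fin_two] using this

theorem IsMarkovPathMeasure.apply_zero_mid_one (hR : IsMarkovPathMeasure m A R) {t : unitInterval}
    (ht : (t : ℝ) ∈ Set.Ioo (0 : ℝ) 1) (x z y : X) :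
    R {ω | ω.1 0 = x ∧ ω.1 t = z ∧ ω.1 1 = y} = m {x} *
      (ENNReal.ofReal (semigroup A t x z) * ENNReal.ofReal (semigroup A (1 - t) z y)) := by
  have := hR 2 ![0, t, 1] ![x, z, y] (by
    rw [Fin.strictMono_iff_lt_succ]
    intro i
    fin_cases i
    · exact Subtype.coe_lt_coe.1 ht.1
    · exact Subtype.coe_lt_coe.1 ht.2) rfl
  simpa [Fin.forall_fin_succ, Fin.prod_univ_succ] using this

end FiniteDimensional

/-! ### Uniqueness of the entropic projection. -/

section RelEntropy

variable {Y : Type*} [MeasurableSpace Y] {R Q P : Measure Y}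

theorem llr_withDensity_ofReal [SigmaFinite R] {ρ : Y → ℝ} (hρ : Measurable ρ)
    (hρ0 : ∀ y, 0 ≤ ρ y) :
    llr (R.withDensity fun y => ENNReal.ofReal (ρ y)) R =ᵐ[R] fun y => Real.log (ρ y) := by
  filter_upwards [Measure.rnDeriv_withDensity R hρ.ennreal_ofReal] with y hy
  rw [llr, hy, ENNReal.toReal_ofReal (hρ0 y)]

/-- The entropic projection is unique: a probability measure which gives the same mean to `log ρ`
as `ρ R`, and whose entropy is not larger, is equal to `ρ R`. -/
theorem eq_withDensity_of_relEntropy_le [SigmaFinite R] [IsProbabilityMeasure Q]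
    [IsProbabilityMeasure P] {ρ : Y → ℝ} (hP : P = R.withDensity fun y => ENNReal.ofReal (ρ y))
    (hρ : Measurable ρ) (hρ0 : ∀ y, 0 ≤ ρ y) (hQρ : ∀ᵐ y ∂Q, 0 < ρ y)
    (hPi : Integrable (fun y => Real.log (ρ y)) P) (hQi : Integrable (fun y => Real.log (ρ y)) Q)
    (heq : ∫ y, Real.log (ρ y) ∂Q = ∫ y, Real.log (ρ y) ∂P)
    (hle : relEntropy Q R ≤ relEntropy P R) : Q = P := by
  have hPR : P ≪ R := hP ▸ withDensity_absolutelyContinuous R _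
  have hderiv : P.rnDeriv R =ᵐ[R] fun y => ENNReal.ofReal (ρ y) :=
    hP ▸ Measure.rnDeriv_withDensity R hρ.ennreal_ofReal
  have hllrP : llr P R =ᵐ[R] fun y => Real.log (ρ y) := hP ▸ llr_withDensity_ofReal hρ hρ0
  have hllrP' : llr P R =ᵐ[P] fun y => Real.log (ρ y) := hPR.ae_le hllrP
  have e1 : relEntropy P R = ((∫ y, Real.log (ρ y) ∂P : ℝ) : EReal) := by
    rw [relEntropy, if_pos ⟨hPR, hPi.congr hllrP'.symm⟩, integral_congr_ae hllrP']
  have hQfin : Q ≪ R ∧ Integrable (llr Q R) Q := by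
    by_contra h
    rw [e1, relEntropy, if_neg h] at hle
    exact absurd hle (not_le.2 (EReal.coe_lt_top _))
  obtain ⟨hQR, hQint⟩ := hQfin
  rw [e1, relEntropy, if_pos ⟨hQR, hQint⟩, EReal.coe_le_coe_iff] at hle
  have hQP : Q ≪ P := by
    refine Measure.AbsolutelyContinuous.mk fun s _ hPs => ?_
    rw [hP, withDensity_apply_eq_zero hρ.ennreal_ofReal] at hPs
    refine measure_mono_null (t := ({y | ENNReal.ofReal (ρ y) ≠ 0} ∩ s) ∪ {y | ¬ 0 < ρ y}) ?_
      (measure_union_null (hQR hPs) (ae_iff.1 hQρ))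
    intro y hy
    by_cases h : 0 < ρ y
    · exact Or.inl ⟨(ENNReal.ofReal_pos.2 h).ne', hy⟩
    · exact Or.inr h
  -- The chain rule H(Q|R) = H(Q|P) + ∫ log ρ dQ. The last integral equals H(P|R), so the hypothesis
  -- forces H(Q|P) ≤ 0, hence Q = P.
  have hllr : llr Q R =ᵐ[Q] fun y => llr Q P y + Real.log (ρ y) := by
    filter_upwards [hQR.ae_le (Measure.rnDeriv_mul_rnDeriv (κ := R) hQP), hQρ,
      hQR.ae_le hderiv, Measure.rnDeriv_pos hQP, hQP.ae_le (Measure.rnDeriv_lt_top Q P)]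
      with y h1 h2 h3 h4 h5
    rw [llr, llr, ← h1, Pi.mul_apply, h3, ENNReal.toReal_mul, ENNReal.toReal_ofReal h2.le,
      Real.log_mul (ENNReal.toReal_pos h4.ne' h5.ne).ne' h2.ne']
  have hint : Integrable (llr Q P) Q := by
    refine (hQint.sub hQi).congr ?_
    filter_upwards [hllr] with y hy
    rw [Pi.sub_apply, hy, add_sub_cancel_right]
  rw [integral_congr_ae hllr, integral_add hint hQi, heq] at hle
  have hkl := InformationTheory.toReal_klDiv hQP hint
  simp only [probReal_univ, add_sub_cancel_right] at hkl
  have h0 : (InformationTheory.klDiv Q P).toReal = 0 :=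
    le_antisymm (by rw [hkl]; linarith) ENNReal.toReal_nonneg
  rw [ENNReal.toReal_eq_zero_iff, or_iff_left
    (InformationTheory.klDiv_ne_top hQP hint)] at h0
  exact InformationTheory.klDiv_eq_zero_iff.1 h0

end RelEntropy

/-! ### Marginals of f(X₀)g(X₁)R and its identification with the minimizer. -/

section Bridge

variable {X : Type*} [DecidableEq X] [Countable X] [TopologicalSpace X] [DiscreteTopology X]
  [MeasurableSpace X] [BorelSpace X] {G : SimpleGraph X} {m : Measure X} {n A : X → X → ℝ}
  {lam κ γ : ℝ} {ν₀ ν₁ : Measure X} {f g : X → ℝ} {R : Measure (PathSpace X)}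

theorem measurableSet_eval_eq (t : unitInterval) (x : X) :
    MeasurableSet {ω : PathSpace X | ω.1 t = x} :=
  measurable_eval t (measurableSet_singleton x)

/-- R may have infinite mass, but the paths with a given starting point have finite mass. Densities
with respect to R require this. -/
theorem IsMarkovPathMeasure.sigmaFinite (hR : IsMarkovPathMeasure m A R)
    (hm : ∀ x, m {x} ≠ ⊤) : SigmaFinite R := by
  refine Measure.sigmaFinite_of_countable
    (S := Set.range fun x : X => {ω : PathSpace X | ω.1 0 = x}) (Set.countable_range _) ?_ ?_
  · rintro _ ⟨x, rfl⟩
    change R {ω | ω.1 0 = x} < ⊤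
    rw [hR.apply_zero]
    exact (hm x).lt_top
  · exact Set.eq_univ_of_forall fun ω => ⟨_, ⟨ω.1 0, rfl⟩, rfl⟩

/-- The path measure `f(X₀) g(X₁) R`. -/
def bridgeMeasure (R : Measure (PathSpace X)) (f g : X → ℝ) : Measure (PathSpace X) :=
  R.withDensity fun ω => ENNReal.ofReal (f (ω.1 0) * g (ω.1 1))

theorem bridgeMeasure_apply {s : Set (PathSpace X)} (hs : MeasurableSet s) :
    bridgeMeasure R f g s = ∑' x, ∑' y, ENNReal.ofReal (f x * g y) *
      R ({ω | ω.1 0 = x ∧ ω.1 1 = y} ∩ s) := by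
  have hev : Measurable fun ω : PathSpace X => (ω.1 0, ω.1 1) :=
    (measurable_eval 0).prodMk (measurable_eval 1)
  rw [bridgeMeasure, withDensity_apply _ hs, ← lintegral_map
    (f := fun p : X × X => ENNReal.ofReal (f p.1 * g p.2)) (measurable_of_countable _) hev,
    lintegral_countable', ENNReal.tsum_prod']
  refine tsum_congr fun x => tsum_congr fun y => ?_
  rw [Measure.map_apply hev (measurableSet_singleton _), Measure.restrict_apply
    (hev (measurableSet_singleton _))]
  congr 3
  ext ω
  simp

theorem IsUniformizedKernel.semigroup_comm (h : IsUniformizedKernel G m n lam κ)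
    (hA : IsGeneratorOf A n lam γ) (hγ : 0 < γ) {t : ℝ} (ht : 0 ≤ t) (x y : X) :
    m.real {x} * semigroup A t x y = m.real {y} * semigroup A t y x := by
  have hz : ∀ a : X, ∀ z ∉ ({a} : Finset X), pointFn a z = 0 := fun a z hz => by
    rw [pointFn_apply, if_neg (by simpa using hz)]
  have h1 := (h.toPos.integral_expOp_mul h.mass_ne_top h.reversible (pointFn_nonneg y) (hz y)
    (mul_nonneg hγ.le ht)).2 (pointFn x)
  have h2 := integral_mul_eq_pairing h.mass_ne_top (hz x)
    (expOp h.toPos.op (γ * t) (pointFn y))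
  simp only [mul_comm (pointFn x _)] at h2
  rw [h2] at h1
  simp only [pairing_apply, Finset.sum_singleton, pointFn_apply, if_true, mul_one] at h1
  rw [h.semigroup_eq hA, h.semigroup_eq hA, mul_left_comm, h1]
  ring

theorem ofReal_semigroupApply {t : ℝ} {u : X → ℝ} (hu : ∀ x, 0 ≤ u x) (x : X)
    (hp : ∀ y, 0 ≤ semigroup A t x y) (hs : Summable fun y => u y * semigroup A t x y) :
    ENNReal.ofReal (semigroupApply A t u x) = ∑' y, ENNReal.ofReal (u y * semigroup A t x y) :=
  ENNReal.ofReal_tsum_of_nonneg (fun y => mul_nonneg (hu y) (hp y)) hs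

/-- The Markov property factors the weight of (x, z, y). Reversibility turns m(x)P_t(x,z) into
m(z)P_t(z,x), so that the sums over x and y are P_t f(z) and P_{1-t} g(z). -/
theorem IsSchrodingerSystem.bridgeMeasure_mid (hs : IsSchrodingerSystem m A ν₀ ν₁ f g)
    (h : IsUniformizedKernel G m n lam κ) (hA : IsGeneratorOf A n lam γ) (hγ : 0 < γ)
    (hR : IsMarkovPathMeasure m A R) (hf : f.support.Finite) (hg : g.support.Finite)
    {t : unitInterval} (ht : (t : ℝ) ∈ Set.Ioo (0 : ℝ) 1) (z : X) :
    bridgeMeasure R f g {ω | ω.1 t = z} = ENNReal.ofReal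
      (m.real {z} * semigroupApply A t f z * semigroupApply A (1 - t) g z) := by
  have hp0 := h.semigroup_pos hA hγ ht.1
  have hp1 := h.semigroup_pos hA hγ (sub_pos.2 ht.2)
  have hsf : Summable fun y => f y * semigroup A t z y := summable_of_hasFiniteSupport
    (hf.subset fun y hy => by
      rw [Function.mem_support] at hy ⊢
      exact left_ne_zero_of_mul hy)
  have hsg : Summable fun y => g y * semigroup A (1 - t) z y := summable_of_hasFiniteSupport
    (hg.subset fun y hy => by
      rw [Function.mem_support] at hy ⊢
      exact left_ne_zero_of_mul hy)
  have hterm : ∀ x y, ENNReal.ofReal (f x * g y) *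
      R ({ω | ω.1 0 = x ∧ ω.1 1 = y} ∩ {ω | ω.1 t = z}) =
      m {z} * (ENNReal.ofReal (f x * semigroup A t z x) *
        ENNReal.ofReal (g y * semigroup A (1 - t) z y)) := by
    intro x y
    have e : ({ω | ω.1 0 = x ∧ ω.1 1 = y} ∩ {ω | ω.1 t = z} : Set (PathSpace X)) =
        {ω | ω.1 0 = x ∧ ω.1 t = z ∧ ω.1 1 = y} := by
      ext ω
      simp only [Set.mem_inter_iff, Set.mem_ofPred_eq]
      tauto
    have hfx := hs.nonneg_left x
    have hgy := hs.nonneg_right y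
    have q1 := (hp0 x z).le
    have q2 := (hp1 z y).le
    have q3 := (hp0 z x).le
    rw [e, hR.apply_zero_mid_one ht, ← ofReal_measureReal (h.mass_ne_top x),
      ← ofReal_measureReal (h.mass_ne_top z), ← ENNReal.ofReal_mul (by positivity),
      ← ENNReal.ofReal_mul (by positivity), ← ENNReal.ofReal_mul (by positivity),
      ← ENNReal.ofReal_mul (by positivity), ← ENNReal.ofReal_mul (by positivity)]
    congr 1
    have := h.semigroup_comm hA hγ ht.1.le x z
    linear_combination f x * g y * semigroup A (1 - t) z y * this
  rw [bridgeMeasure_apply (measurableSet_eval_eq t z)]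
  simp only [hterm, ENNReal.tsum_mul_left, ENNReal.tsum_mul_right]
  rw [← ofReal_semigroupApply hs.nonneg_left z (fun y => (hp0 z y).le) hsf,
    ← ofReal_semigroupApply hs.nonneg_right z (fun y => (hp1 z y).le) hsg,
    ← ofReal_measureReal (h.mass_ne_top z)]
  have n1 : 0 ≤ semigroupApply A t f z :=
    tsum_nonneg fun y => mul_nonneg (hs.nonneg_left y) (hp0 z y).le
  rw [← ENNReal.ofReal_mul n1, ← ENNReal.ofReal_mul (by positivity), mul_assoc]

/-- Two forms of one weight: summing the first over y, or the second over x, brings in one equation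
of the Schrödinger system. -/
theorem IsSchrodingerSystem.bridgeMeasure_zero_one (hs : IsSchrodingerSystem m A ν₀ ν₁ f g)
    (h : IsUniformizedKernel G m n lam κ) (hA : IsGeneratorOf A n lam γ) (hγ : 0 < γ)
    (hR : IsMarkovPathMeasure m A R) (x y : X) :
    ENNReal.ofReal (f x * g y) * R {ω | ω.1 0 = x ∧ ω.1 1 = y} =
      ENNReal.ofReal (m.real {x} * f x) * ENNReal.ofReal (g y * semigroup A 1 x y) ∧
    ENNReal.ofReal (f x * g y) * R {ω | ω.1 0 = x ∧ ω.1 1 = y} =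
      ENNReal.ofReal (m.real {y} * g y) * ENNReal.ofReal (f x * semigroup A 1 y x) := by
  have hfx := hs.nonneg_left x
  have hgy := hs.nonneg_right y
  have q1 := (h.semigroup_pos hA hγ one_pos x y).le
  have hc := h.semigroup_comm hA hγ zero_le_one x y
  rw [hR.apply_zero_one, ← ofReal_measureReal (h.mass_ne_top x),
    ← ENNReal.ofReal_mul (by positivity), ← ENNReal.ofReal_mul (by positivity),
    ← ENNReal.ofReal_mul (by positivity), ← ENNReal.ofReal_mul (by positivity)]
  constructor
  · congr 1
    ring
  · congr 1
    linear_combination f x * g y * hc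

theorem IsSchrodingerSystem.bridgeMeasure_zero (hs : IsSchrodingerSystem m A ν₀ ν₁ f g)
    (h : IsUniformizedKernel G m n lam κ) (hA : IsGeneratorOf A n lam γ) (hγ : 0 < γ)
    (hR : IsMarkovPathMeasure m A R) [IsFiniteMeasure ν₀] (z : X) :
    bridgeMeasure R f g {ω | ω.1 0 = z} = ν₀ {z} := by
  have hp := h.semigroup_pos hA hγ one_pos
  rw [bridgeMeasure_apply (measurableSet_eval_eq 0 z), tsum_eq_single z]
  · have e : ∀ y, ({ω | ω.1 0 = z ∧ ω.1 1 = y} ∩ {ω | ω.1 0 = z} : Set (PathSpace X)) =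
        {ω | ω.1 0 = z ∧ ω.1 1 = y} := fun y => Set.inter_eq_left.2 fun ω hω => hω.1
    simp only [e, (hs.bridgeMeasure_zero_one h hA hγ hR z _).1, ENNReal.tsum_mul_left]
    rw [← ofReal_semigroupApply hs.nonneg_right z (fun y => (hp z y).le) (hs.summable_right z),
      ← ENNReal.ofReal_mul (mul_nonneg measureReal_nonneg (hs.nonneg_left z)), mul_assoc,
      hs.eq_left z, mul_div_cancel₀ _ (h.measureReal_pos z).ne', ofReal_measureReal]
  · intro x hx
    have e : ∀ y, ({ω | ω.1 0 = x ∧ ω.1 1 = y} ∩ {ω | ω.1 0 = z} : Set (PathSpace X)) = ∅ :=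
      fun y => Set.eq_empty_of_forall_notMem fun ω hω => hx (hω.1.1.symm.trans hω.2)
    simp [e]

theorem IsSchrodingerSystem.bridgeMeasure_one (hs : IsSchrodingerSystem m A ν₀ ν₁ f g)
    (h : IsUniformizedKernel G m n lam κ) (hA : IsGeneratorOf A n lam γ) (hγ : 0 < γ)
    (hR : IsMarkovPathMeasure m A R) [IsFiniteMeasure ν₁] (z : X) :
    bridgeMeasure R f g {ω | ω.1 1 = z} = ν₁ {z} := by
  have hp := h.semigroup_pos hA hγ one_pos
  rw [bridgeMeasure_apply (measurableSet_eval_eq 1 z), ENNReal.tsum_comm, tsum_eq_single z]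
  · have e : ∀ x, ({ω | ω.1 0 = x ∧ ω.1 1 = z} ∩ {ω | ω.1 1 = z} : Set (PathSpace X)) =
        {ω | ω.1 0 = x ∧ ω.1 1 = z} := fun y => Set.inter_eq_left.2 fun ω hω => hω.2
    simp only [e, (hs.bridgeMeasure_zero_one h hA hγ hR _ z).2, ENNReal.tsum_mul_left]
    rw [← ofReal_semigroupApply hs.nonneg_left z (fun y => (hp z y).le) (hs.summable_left z),
      ← ENNReal.ofReal_mul (mul_nonneg measureReal_nonneg (hs.nonneg_right z)), mul_assoc,
      hs.eq_right z, mul_div_cancel₀ _ (h.measureReal_pos z).ne', ofReal_measureReal]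
  · intro y hy
    have e : ∀ x, ({ω | ω.1 0 = x ∧ ω.1 1 = y} ∩ {ω | ω.1 1 = z} : Set (PathSpace X)) = ∅ :=
      fun x => Set.eq_empty_of_forall_notMem fun ω hω => hy (hω.1.2.symm.trans hω.2)
    simp [e]

theorem coe_marginal (Q : ProbabilityMeasure (PathSpace X)) (t : unitInterval) :
    (marginal Q t : Measure X) = (Q : Measure (PathSpace X)).map fun ω => ω.1 t :=
  ProbabilityMeasure.toMeasure_map _ _

theorem coe_marginal_apply_singleton (Q : ProbabilityMeasure (PathSpace X)) (t : unitInterval)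
    (z : X) : (marginal Q t : Measure X) {z} = (Q : Measure (PathSpace X)) {ω | ω.1 t = z} := by
  rw [coe_marginal, Measure.map_apply (measurable_eval t) (measurableSet_singleton z)]
  rfl

theorem integrable_comp_eval {Q : Measure (PathSpace X)} {ν : Measure X} [IsFiniteMeasure ν]
    {t : unitInterval} (hν : Q.map (fun ω => ω.1 t) = ν) {s : Finset X} (hs : ∀ x ∉ s, ν {x} = 0)
    (u : X → ℝ) : Integrable (fun ω => u (ω.1 t)) Q ∧ ∫ ω, u (ω.1 t) ∂Q = ∫ x, u x ∂ν := by
  have hu : AEStronglyMeasurable u (Q.map fun ω => ω.1 t) :=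
    (measurable_of_countable u).aestronglyMeasurable
  have hi : Integrable u ν := (integrable_iff_summable (fun x => measure_ne_top ν _) u).2
    (summable_of_ne_finset_zero (s := s) fun x hx => by
      rw [measureReal_def, hs x hx, ENNReal.toReal_zero, zero_mul])
  subst hν
  exact ⟨(integrable_map_measure hu (measurable_eval t).aemeasurable).1 hi,
    (integral_map (measurable_eval t).aemeasurable hu).symm⟩

/-- The Schrödinger bridge is `f(X₀) g(X₁) R`. -/
theorem IsSchrodingerSystem.minimizer_eq {ν₀ ν₁ : ProbabilityMeasure X}
    (hs : IsSchrodingerSystem m A ν₀ ν₁ f g)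
    (h : IsUniformizedKernel G m n lam κ) (hA : IsGeneratorOf A n lam γ) (hγ : 0 < γ)
    (hR : IsMarkovPathMeasure m A R) {s₀ s₁ : Finset X}
    (h₀ : ∀ x ∉ s₀, (ν₀ : Measure X) {x} = 0) (h₁ : ∀ x ∉ s₁, (ν₁ : Measure X) {x} = 0)
    {Q : ProbabilityMeasure (PathSpace X)} (hQ : IsSchrodingerMinimizer R ν₀ ν₁ Q) :
    (Q : Measure (PathSpace X)) = bridgeMeasure R f g := by
  have := hR.sigmaFinite h.mass_ne_top
  have hm0 : (bridgeMeasure R f g).map (fun ω => ω.1 0) = ν₀ := Measure.ext_of_singleton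
    fun z => by
      rw [Measure.map_apply (measurable_eval 0) (measurableSet_singleton z)]
      exact hs.bridgeMeasure_zero h hA hγ hR z
  have hm1 : (bridgeMeasure R f g).map (fun ω => ω.1 1) = ν₁ := Measure.ext_of_singleton
    fun z => by
      rw [Measure.map_apply (measurable_eval 1) (measurableSet_singleton z)]
      exact hs.bridgeMeasure_one h hA hγ hR z
  have hprob : IsProbabilityMeasure (bridgeMeasure R f g) := by
    constructor
    have := congrArg (fun ν : Measure X => ν Set.univ) hm0
    simpa [Measure.map_apply (measurable_eval (X := X) 0) MeasurableSet.univ] using this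
  have hQ0 : (Q : Measure (PathSpace X)).map (fun ω => ω.1 0) = ν₀ := by
    rw [← coe_marginal, hQ.1]
  have hQ1 : (Q : Measure (PathSpace X)).map (fun ω => ω.1 1) = ν₁ := by
    rw [← coe_marginal, hQ.2.1]
  have hle := hQ.2.2 ⟨bridgeMeasure R f g, hprob⟩
    (Subtype.ext ((coe_marginal ⟨_, hprob⟩ 0).trans hm0)) (Subtype.ext ((coe_marginal ⟨_, hprob⟩ 1).trans hm1))
  have hf0 : ∀ᵐ x ∂(ν₀ : Measure X), 0 < f x := by
    rw [ae_iff, measure_null_iff_singleton (Set.to_countable _)]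
    intro x hx
    by_contra h0
    refine hx ((hs.nonneg_left x).lt_of_ne fun hfx => ?_)
    have e := hs.eq_left x
    rw [← hfx, zero_mul] at e
    exact (div_pos (ENNReal.toReal_pos h0 (measure_ne_top _ _)) (h.measureReal_pos x)).ne e
  have hg0 : ∀ᵐ x ∂(ν₁ : Measure X), 0 < g x := by
    rw [ae_iff, measure_null_iff_singleton (Set.to_countable _)]
    intro x hx
    by_contra h0
    refine hx ((hs.nonneg_right x).lt_of_ne fun hgx => ?_)
    have e := hs.eq_right x
    rw [← hgx, zero_mul] at e
    exact (div_pos (ENNReal.toReal_pos h0 (measure_ne_top _ _)) (h.measureReal_pos x)).ne e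
  -- The logarithm of the density is a sum of functions of the two end points, so its mean depends
  -- only on the end marginals.
  have key : ∀ P : Measure (PathSpace X), P.map (fun ω => ω.1 0) = ν₀ →
      P.map (fun ω => ω.1 1) = ν₁ → (∀ᵐ ω ∂P, 0 < f (ω.1 0) * g (ω.1 1)) ∧
      Integrable (fun ω => Real.log (f (ω.1 0) * g (ω.1 1))) P ∧
      ∫ ω, Real.log (f (ω.1 0) * g (ω.1 1)) ∂P =
        ∫ x, Real.log (f x) ∂(ν₀ : Measure X) + ∫ x, Real.log (g x) ∂(ν₁ : Measure X) := by
    intro P hP0 hP1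
    have a0 : ∀ᵐ ω ∂P, 0 < f (ω.1 0) :=
      ae_of_ae_map (measurable_eval 0).aemeasurable (hP0.symm ▸ hf0)
    have a1 : ∀ᵐ ω ∂P, 0 < g (ω.1 1) :=
      ae_of_ae_map (measurable_eval 1).aemeasurable (hP1.symm ▸ hg0)
    have i0 := integrable_comp_eval hP0 h₀ fun x => Real.log (f x)
    have i1 := integrable_comp_eval hP1 h₁ fun x => Real.log (g x)
    have e : (fun ω : PathSpace X => Real.log (f (ω.1 0) * g (ω.1 1))) =ᵐ[P]
        fun ω => Real.log (f (ω.1 0)) + Real.log (g (ω.1 1)) := by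
      filter_upwards [a0, a1] with ω p0 p1
      rw [Real.log_mul p0.ne' p1.ne']
    refine ⟨?_, (i0.1.add i1.1).congr e.symm, ?_⟩
    · filter_upwards [a0, a1] with ω p0 p1 using mul_pos p0 p1
    · rw [integral_congr_ae e, integral_add i0.1 i1.1, i0.2, i1.2]
  obtain ⟨k1, k2, k3⟩ := key _ hQ0 hQ1
  obtain ⟨-, l2, l3⟩ := key _ hm0 hm1
  exact eq_withDensity_of_relEntropy_le (R := R) rfl
    (((measurable_of_countable f).comp (measurable_eval 0)).mul
      ((measurable_of_countable g).comp (measurable_eval 1)))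
    (fun ω => mul_nonneg (hs.nonneg_left _) (hs.nonneg_right _)) k1 l2 k2 (k3.trans l3.symm) hle

theorem IsSchrodingerSystem.marginal_singleton {ν₀ ν₁ : ProbabilityMeasure X}
    (hs : IsSchrodingerSystem m A ν₀ ν₁ f g)
    (h : IsUniformizedKernel G m n lam κ) (hA : IsGeneratorOf A n lam γ) (hγ : 0 < γ)
    (hR : IsMarkovPathMeasure m A R) {s₀ s₁ : Finset X}
    (h₀ : ∀ x ∉ s₀, (ν₀ : Measure X) {x} = 0) (h₁ : ∀ x ∉ s₁, (ν₁ : Measure X) {x} = 0)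
    {Q : ProbabilityMeasure (PathSpace X)} (hQ : IsSchrodingerMinimizer R ν₀ ν₁ Q)
    {t : unitInterval} (ht : (t : ℝ) ∈ Set.Ioo (0 : ℝ) 1) (z : X) :
    (marginal Q t : Measure X).real {z} =
      m.real {z} * semigroupApply A t f z * semigroupApply A (1 - t) g z := by
  have hf := hs.finite_support h hA hγ h₀
  have hg := hs.swap.finite_support h hA hγ h₁
  rw [measureReal_def, coe_marginal_apply_singleton, hs.minimizer_eq h hA hγ hR h₀ h₁ hQ,
    hs.bridgeMeasure_mid h hA hγ hR hf hg ht, ENNReal.toReal_ofReal]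
  exact mul_nonneg (mul_nonneg measureReal_nonneg
    (tsum_nonneg fun y => mul_nonneg (hs.nonneg_left y) (h.semigroup_pos hA hγ ht.1 z y).le))
    (tsum_nonneg fun y => mul_nonneg (hs.nonneg_right y)
      (h.semigroup_pos hA hγ (sub_pos.2 ht.2) z y).le)

end Bridge

/-! ### Relative entropy on a countable set -/

section CountableEntropy

variable {X : Type*} [DecidableEq X] [Countable X] [TopologicalSpace X] [DiscreteTopology X]
  [MeasurableSpace X] [BorelSpace X] {m : Measure X}

theorem sigmaFinite_of_singleton (hm : ∀ x, m {x} ≠ ⊤) : SigmaFinite m := by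
  refine Measure.sigmaFinite_of_countable (S := Set.range fun x : X => {x})
    (Set.countable_range _) ?_ ?_
  · rintro _ ⟨x, rfl⟩
    exact (hm x).lt_top
  · exact Set.eq_univ_of_forall fun x => ⟨_, ⟨x, rfl⟩, rfl⟩

theorem relEntropy_eq_tsum (hm0 : ∀ x, m {x} ≠ 0) (hm : ∀ x, m {x} ≠ ⊤) (q : Measure X)
    [IsFiniteMeasure q]
    (hs : Summable fun z => |q.real {z} * Real.log (q.real {z} / m.real {z})|) :
    relEntropy q m = ((∑' z, q.real {z} * Real.log (q.real {z} / m.real {z}) : ℝ) : EReal) := by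
  have := sigmaFinite_of_singleton hm
  set ρ : X → ℝ := fun z => q.real {z} / m.real {z} with hρdef
  have hρ0 : ∀ z, 0 ≤ ρ z := fun z => div_nonneg measureReal_nonneg measureReal_nonneg
  have hq : m.withDensity (fun z => ENNReal.ofReal (ρ z)) = q := by
    refine Measure.ext_of_singleton fun z => ?_
    have hz : 0 < m.real {z} := ENNReal.toReal_pos (hm0 z) (hm z)
    rw [withDensity_apply _ (measurableSet_singleton z), Measure.restrict_singleton,
      lintegral_smul_measure, lintegral_dirac, smul_eq_mul, ← ofReal_measureReal (hm z),
      ← ENNReal.ofReal_mul hz.le, mul_div_cancel₀ _ hz.ne', ofReal_measureReal]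
  have hac : q ≪ m := hq ▸ withDensity_absolutelyContinuous m _
  have hllr : llr q m =ᵐ[q] fun z => Real.log (ρ z) := hac.ae_le
    (hq ▸ llr_withDensity_ofReal (measurable_of_countable ρ) hρ0)
  have hi : Integrable (fun z => Real.log (ρ z)) q := by
    rw [integrable_iff_summable fun x => measure_ne_top q _]
    refine hs.congr fun z => ?_
    rw [abs_mul, abs_of_nonneg measureReal_nonneg]
  rw [relEntropy, if_pos ⟨hac, hi.congr hllr.symm⟩, integral_congr_ae hllr,
    (hasSum_integral_of_integrable (fun x => measure_ne_top q _) hi).tsum_eq]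

theorem tendsto_measureReal_singleton {ι : Type*} {l : Filter ι} {q : ι → ProbabilityMeasure X}
    {q₀ : ProbabilityMeasure X} (h : Tendsto q l (𝓝 q₀)) (z : X) :
    Tendsto (fun k => (q k : Measure X).real {z}) l (𝓝 ((q₀ : Measure X).real {z})) := by
  have e : ∀ ν : ProbabilityMeasure X, ∫ x, pointFn z x ∂(ν : Measure X) =
      (ν : Measure X).real {z} := by
    intro ν
    have := integral_mul_eq_pairing (m := (ν : Measure X)) (fun x => measure_ne_top _ _)
      (s := {z}) (g := pointFn z) (fun x hx => by
        rw [pointFn_apply, if_neg (by simpa using hx)]) 1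
    simpa [pairing_apply, pointFn_apply] using this
  have := ProbabilityMeasure.tendsto_iff_forall_integral_tendsto.1 h (pointFn z)
  simpa only [e] using this

/-- p log p = 2√p · (√p log √p), and the second factor is bounded. The entropy is thus dominated by
√p, which is why the decay estimates concern square roots of the marginals. -/
theorem abs_mul_log_div_le {p r c M : ℝ} (hp0 : 0 ≤ p) (hp1 : p ≤ 1) (hc : 0 < c) (hcr : c ≤ r)
    (hrM : r ≤ M) : |p * Real.log (p / r)| ≤ (2 + |Real.log c| + |Real.log M|) * √p := by
  rcases hp0.eq_or_lt with rfl | hp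
  · simp
  have hr : 0 < r := hc.trans_le hcr
  have hsq : 0 < √p := Real.sqrt_pos.2 hp
  have hsq1 : √p ≤ 1 := Real.sqrt_le_one.2 hp1
  have hpp : √p * √p = p := Real.mul_self_sqrt hp0
  have h1 : |p * Real.log p| ≤ 2 * √p := by
    have h := (Real.abs_log_mul_self_lt (√p) hsq hsq1).le
    have e : p * Real.log p = 2 * √p * (Real.log √p * √p) := by
      rw [Real.log_sqrt hp0]
      linear_combination (-Real.log p) * hpp
    rw [e, abs_mul, abs_of_pos (by positivity : 0 < 2 * √p)]
    exact mul_le_of_le_one_right (by positivity) h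
  have h2 : |Real.log r| ≤ |Real.log c| + |Real.log M| := by
    have a1 := Real.log_le_log hc hcr
    have a2 := Real.log_le_log hr hrM
    have a3 := neg_abs_le (Real.log c)
    have a4 := le_abs_self (Real.log M)
    have a5 := abs_nonneg (Real.log c)
    have a6 := abs_nonneg (Real.log M)
    rw [abs_le]
    constructor <;> linarith
  have h3 : |p * Real.log r| ≤ √p * (|Real.log c| + |Real.log M|) := by
    rw [abs_mul, abs_of_pos hp]
    refine mul_le_mul ?_ h2 (abs_nonneg _) hsq.le
    exact hpp.symm.le.trans (mul_le_of_le_one_right hsq.le hsq1)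
  rw [Real.log_div hp.ne' hr.ne', mul_sub]
  have := abs_sub (p * Real.log p) (p * Real.log r)
  linarith

/-- Weak convergence gives convergence at each point, and dominated convergence does the rest. The
domination passes to the limit, so the entropy of q₀ is finite. -/
theorem tendsto_relEntropy {q : ℕ → ProbabilityMeasure X} {q₀ : ProbabilityMeasure X}
    (h : Tendsto q atTop (𝓝 q₀)) {c M : ℝ} (hc : 0 < c) (hcm : ∀ x, c ≤ m.real {x})
    (hmM : ∀ x, m.real {x} ≤ M) {b : X → ℝ} (hb : Summable b)
    (hqb : ∀ᶠ k in atTop, ∀ z, √((q k : Measure X).real {z}) ≤ b z) :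
    ∃ H : ℝ, relEntropy (q₀ : Measure X) m = (H : EReal) ∧
      Tendsto (fun k => ∑' z, (q k : Measure X).real {z} *
        Real.log ((q k : Measure X).real {z} / m.real {z})) atTop (𝓝 H) := by
  have hpos : ∀ x, 0 < m.real {x} := fun x => hc.trans_le (hcm x)
  have hm0 : ∀ x, m {x} ≠ 0 := fun x hx => (hpos x).ne' (by simp [measureReal_def, hx])
  have hm : ∀ x, m {x} ≠ ⊤ := fun x hx => (hpos x).ne' (by simp [measureReal_def, hx])
  set K := 2 + |Real.log c| + |Real.log M|
  have hK : 0 ≤ K := by positivity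
  have hbound : ∀ᶠ k in atTop, ∀ z, ‖(q k : Measure X).real {z} *
      Real.log ((q k : Measure X).real {z} / m.real {z})‖ ≤ K * b z := by
    filter_upwards [hqb] with k hk z
    exact (abs_mul_log_div_le measureReal_nonneg measureReal_le_one hc (hcm z) (hmM z)).trans
      (mul_le_mul_of_nonneg_left (hk z) hK)
  have hlim : ∀ z, Tendsto (fun k => (q k : Measure X).real {z} *
      Real.log ((q k : Measure X).real {z} / m.real {z})) atTop
      (𝓝 ((q₀ : Measure X).real {z} * Real.log ((q₀ : Measure X).real {z} / m.real {z}))) := by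
    intro z
    have e : ∀ p : ℝ, p * Real.log (p / m.real {z}) =
        m.real {z} * (p / m.real {z} * Real.log (p / m.real {z})) := fun p => by
      rw [← mul_assoc, mul_div_cancel₀ _ (hpos z).ne']
    simp only [e]
    exact ((Real.continuous_mul_log.tendsto _).comp
      ((tendsto_measureReal_singleton h z).div_const _)).const_mul _
  refine ⟨_, relEntropy_eq_tsum hm0 hm _ ?_, tendsto_tsum_of_dominated_convergence
    (hb.mul_left K) hlim hbound⟩
  refine Summable.of_nonneg_of_le (fun _ => abs_nonneg _) (fun z => ?_) (hb.mul_left K)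
  exact le_of_tendsto (hlim z).norm (hbound.mono fun k hk => hk z)

end CountableEntropy

/-! ### Uniform decay of the marginals at small temperature -/

section Decay

variable {X : Type*} [DecidableEq X] [Countable X] [TopologicalSpace X] [DiscreteTopology X]
  [MeasurableSpace X] [BorelSpace X] {G : SimpleGraph X} {m : Measure X} {n : X → X → ℝ}
  {lam κ : ℝ}

/-- The terms with k < d(x,z) vanish; in the others s^k ≤ γ^{d(x,z)}. -/
theorem IsUniformizedKernel.expOp_pointFn_le (h : IsUniformizedKernel G m n lam κ) {s γ : ℝ}
    (hs : 0 ≤ s) (hsγ : s ≤ γ) (hγ : γ ≤ 1) (x z : X) :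
    expOp h.toPos.op s (pointFn z) x ≤ γ ^ G.dist x z * Real.exp lam := by
  have hγ0 : 0 ≤ γ := hs.trans hsγ
  have hl := h.lam_pos.le
  have hexp : HasSum (fun k : ℕ => lam ^ k / (k.factorial : ℝ)) (Real.exp lam) := by
    rw [Real.exp_eq_exp_ℝ]
    exact NormedSpace.expSeries_div_hasSum_exp lam
  refine hasSum_le (fun k => ?_) (hasSum_expOp_eval h.toPos.op s (pointFn z) x)
    (hexp.mul_left _)
  rcases lt_or_ge k (G.dist x z) with hk | hk
  · rw [h.pow_op_pointFn_eq_zero z k x hk, mul_zero]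
    positivity
  · have h1 : (h.toPos.op ^ k) (pointFn z) x ≤ lam ^ k * 1 :=
      (le_abs_self _).trans (h.toPos.abs_pow_op_le (fun y => by
        rw [pointFn_apply]; split_ifs <;> simp) k x)
    have h2 : s ^ k ≤ γ ^ G.dist x z :=
      (pow_le_pow_left₀ hs hsγ k).trans (pow_le_pow_of_le_one hγ0 hγ hk)
    have h3 := h.toPos.pow_op_nonneg (pointFn_nonneg z) k x
    calc s ^ k / (k.factorial : ℝ) * (h.toPos.op ^ k) (pointFn z) x
        ≤ γ ^ G.dist x z / (k.factorial : ℝ) * (lam ^ k * 1) := by gcongr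
      _ = _ := by ring

theorem IsUniformizedKernel.exists_le_expOp_pointFn (h : IsUniformizedKernel G m n lam κ)
    (x y : X) : ∃ (k : ℕ) (c : ℝ), 0 < c ∧ ∀ γ, 0 < γ →
      c * γ ^ k ≤ expOp h.toPos.op γ (pointFn y) x := by
  obtain ⟨k, hk⟩ := h.exists_pow_op_pointFn_pos x y
  refine ⟨k, (h.toPos.op ^ k) (pointFn y) x / k.factorial, by positivity, fun γ hγ => ?_⟩
  refine le_of_eq_of_le ?_ (le_hasSum (hasSum_expOp_eval h.toPos.op γ (pointFn y) x) k
    fun j _ => mul_nonneg (by positivity) (h.toPos.pow_op_nonneg (pointFn_nonneg y) j x))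
  ring

/-- P₁(x,y) is at least of order γ^k, so w is at most of order γ^{-k}, while P_t(x,z) is at most of
order γ^d with d = d(x,z). The product γ^{d-k} is at most a^{2d} once d ≥ 2k and γ ≤ a⁴. For d < 2k
the trivial bound 1 is enough. -/
theorem IsUniformizedKernel.exists_mul_semigroup_le (h : IsUniformizedKernel G m n lam κ)
    (x y : X) {a : ℝ} (ha0 : 0 < a) (ha1 : a ≤ 1) : ∃ C, 0 ≤ C ∧ ∀ᶠ γ in 𝓝[>] (0 : ℝ),
      ∀ (A : X → X → ℝ), IsGeneratorOf A n lam γ → ∀ t ∈ Set.Ioo (0 : ℝ) 1, ∀ w, 0 ≤ w →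
        w * semigroup A 1 x y ≤ 1 → ∀ z,
        w * (semigroup A t x z * semigroup A (1 - t) z y) ≤ 1 →
        w * (semigroup A t x z * semigroup A (1 - t) z y) ≤ (C * a ^ G.dist x z) ^ 2 := by
  obtain ⟨k, c, hc, hk⟩ := h.exists_le_expOp_pointFn x y
  set E := Real.exp lam
  have hE : 0 < E := Real.exp_pos lam
  -- The three summands serve the case d ≥ 2k, the inequality C ≤ C², and the case d < 2k.
  refine ⟨E ^ 2 / c + 1 + 1 / a ^ (2 * k), by positivity, ?_⟩
  filter_upwards [Ioc_mem_nhdsGT (by positivity : 0 < a ^ 4)] with γ hγ A hA t ht w hw hw1 z hz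
  have hγ0 : 0 < γ := hγ.1
  have hγ1 : γ ≤ 1 := hγ.2.trans (pow_le_one₀ ha0.le ha1)
  set d := G.dist x z
  rw [mul_pow, ← pow_mul]
  have hC1 : 1 ≤ E ^ 2 / c + 1 + 1 / a ^ (2 * k) := by
    have : 0 ≤ E ^ 2 / c + 1 / a ^ (2 * k) := by positivity
    linarith
  rcases lt_or_ge d (2 * k) with hd | hd
  · refine hz.trans ?_
    have h1 : 1 / a ^ (2 * k) ≤ E ^ 2 / c + 1 + 1 / a ^ (2 * k) := by
      have : 0 ≤ E ^ 2 / c := by positivity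
      linarith
    have h2 : (1 / a ^ (2 * k)) ^ 2 ≤ (E ^ 2 / c + 1 + 1 / a ^ (2 * k)) ^ 2 :=
      pow_le_pow_left₀ (by positivity) h1 2
    have h3 : (a ^ (2 * k)) ^ 2 ≤ a ^ (d * 2) := by
      rw [← pow_mul]
      exact pow_le_pow_of_le_one ha0.le ha1 (by omega)
    calc (1 : ℝ) = (1 / a ^ (2 * k)) ^ 2 * (a ^ (2 * k)) ^ 2 := by field_simp
      _ ≤ _ := mul_le_mul h2 h3 (by positivity) (by positivity)
  · have hlow := hk γ hγ0
    have hup := h.expOp_pointFn_le (mul_nonneg hγ0.le ht.1.le)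
      (mul_le_of_le_one_right hγ0.le ht.2.le) hγ1 x z
    have hup2 : expOp h.toPos.op (γ * (1 - t)) (pointFn y) z ≤ E :=
      (h.expOp_pointFn_le (mul_nonneg hγ0.le (sub_nonneg.2 ht.2.le))
        (mul_le_of_le_one_right hγ0.le (by linarith [ht.1])) hγ1 z y).trans
        (mul_le_of_le_one_left hE.le (pow_le_one₀ hγ0.le hγ1))
    have hnn1 := (h.expOp_pointFn_pos (mul_pos hγ0 ht.1) x z).le
    have hnn2 := (h.expOp_pointFn_pos (mul_pos hγ0 (sub_pos.2 ht.2)) z y).le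
    rw [h.semigroup_eq hA, mul_one, mul_one] at hw1
    have e : w * (semigroup A t x z * semigroup A (1 - t) z y) =
        w * Real.exp (-(γ * lam)) * (expOp h.toPos.op (γ * t) (pointFn z) x *
          expOp h.toPos.op (γ * (1 - t)) (pointFn y) z) := by
      have : Real.exp (-(γ * lam)) =
          Real.exp (-(γ * lam * t)) * Real.exp (-(γ * lam * (1 - t))) := by
        rw [← Real.exp_add]; ring_nf
      rw [h.semigroup_eq hA, h.semigroup_eq hA, this]
      ring
    set w' := w * Real.exp (-(γ * lam))
    have hw' : 0 ≤ w' := mul_nonneg hw (Real.exp_pos _).le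
    have hw2 : w' * (c * γ ^ k) ≤ 1 :=
      (mul_le_mul_of_nonneg_left hlow hw').trans (by rw [mul_assoc]; exact hw1)
    have hdk : γ ^ d = γ ^ (d - k) * γ ^ k := by rw [← pow_add]; congr 1; omega
    have hpow : γ ^ (d - k) ≤ a ^ (d * 2) := by
      refine le_of_sq_le_sq ?_ (by positivity)
      rw [← pow_mul, ← pow_mul]
      calc γ ^ ((d - k) * 2) ≤ γ ^ d := pow_le_pow_of_le_one hγ0.le hγ1 (by omega)
        _ ≤ (a ^ 4) ^ d := pow_le_pow_left₀ hγ0.le hγ.2 d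
        _ = a ^ (d * 2 * 2) := by rw [← pow_mul]; congr 1; omega
    rw [e]
    calc w' * (expOp h.toPos.op (γ * t) (pointFn z) x *
          expOp h.toPos.op (γ * (1 - t)) (pointFn y) z)
        ≤ w' * (γ ^ d * E * E) := by gcongr
      _ = w' * (c * γ ^ k) * (E ^ 2 / c * γ ^ (d - k)) := by rw [hdk]; field_simp
      _ ≤ 1 * (E ^ 2 / c * γ ^ (d - k)) := by gcongr
      _ ≤ (E ^ 2 / c + 1 + 1 / a ^ (2 * k)) ^ 2 * a ^ (d * 2) := by
        rw [one_mul]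
        refine mul_le_mul ?_ hpow (by positivity) (by positivity)
        have h4 : E ^ 2 / c ≤ E ^ 2 / c + 1 + 1 / a ^ (2 * k) := by
          have : 0 ≤ 1 / a ^ (2 * k) := by positivity
          linarith
        exact h4.trans (le_self_pow₀ hC1 two_ne_zero)

theorem semigroupApply_eq_sum {A : X → X → ℝ} {u : X → ℝ} {s : Finset X}
    (hu : ∀ x ∉ s, u x = 0) (t : ℝ) (z : X) :
    semigroupApply A t u z = ∑ x ∈ s, u x * semigroup A t z x :=
  tsum_eq_sum fun x hx => by rw [hu x hx, zero_mul]

/-- At small temperatures the square roots of the marginals of the bridges have a common summable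
bound. -/
theorem IsUniformizedKernel.exists_sqrt_marginal_le (h : IsUniformizedKernel G m n lam κ)
    (hG : ∀ x, ∃ γ₀ : ℝ, 0 < γ₀ ∧ γ₀ ≤ 1 ∧ Summable fun y => γ₀ ^ G.dist x y)
    (s₀ s₁ : Finset X) : ∃ b : X → ℝ, Summable b ∧ ∀ᶠ γ in 𝓝[>] (0 : ℝ),
      ∀ (A : X → X → ℝ) (ν₀ ν₁ q : Measure X) (f g : X → ℝ), IsGeneratorOf A n lam γ →
        IsProbabilityMeasure ν₀ → IsProbabilityMeasure ν₁ → IsProbabilityMeasure q →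
        IsSchrodingerSystem m A ν₀ ν₁ f g → (∀ x ∉ s₀, ν₀ {x} = 0) → (∀ x ∉ s₁, ν₁ {x} = 0) →
        ∀ t ∈ Set.Ioo (0 : ℝ) 1, (∀ z, q.real {z} =
          m.real {z} * semigroupApply A t f z * semigroupApply A (1 - t) g z) →
        ∀ z, √(q.real {z}) ≤ b z := by
  choose a ha0 ha1 has using hG
  choose C hC0 hC using fun x y => h.exists_mul_semigroup_le x y (ha0 x) (ha1 x)
  refine ⟨fun z => ∑ p ∈ s₀ ×ˢ s₁, C p.1 p.2 * a p.1 ^ G.dist p.1 z,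
    summable_sum fun p _ => (has p.1).mul_left _, ?_⟩
  filter_upwards [self_mem_nhdsWithin, (eventually_all_finset (s₀ ×ˢ s₁)).2 fun p _ => hC p.1 p.2]
    with γ hγ hb A ν₀ ν₁ q f g hA hp0 hp1 hpq hs hν₀ hν₁ t ht hq z
  have hγ0 : 0 < γ := hγ
  have hf0 : ∀ x ∉ s₀, f x = 0 := fun x hx => hs.eq_zero h hA hγ0 (hν₀ x hx)
  have hg0 : ∀ x ∉ s₁, g x = 0 := fun x hx => hs.swap.eq_zero h hA hγ0 (hν₁ x hx)
  have hpt := h.semigroup_pos hA hγ0 ht.1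
  have hpt' := h.semigroup_pos hA hγ0 (sub_pos.2 ht.2)
  have hpt1 := h.semigroup_pos hA hγ0 one_pos
  have hdec : q.real {z} = ∑ p ∈ s₀ ×ˢ s₁, m.real {p.1} * f p.1 * g p.2 *
      (semigroup A t p.1 z * semigroup A (1 - t) z p.2) := by
    rw [hq z, semigroupApply_eq_sum hf0, semigroupApply_eq_sum hg0, mul_assoc,
      Finset.sum_mul_sum, Finset.mul_sum, Finset.sum_product]
    refine Finset.sum_congr rfl fun x _ => ?_
    rw [Finset.mul_sum]
    refine Finset.sum_congr rfl fun y _ => ?_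
    linear_combination f x * g y * semigroup A (1 - t) z y *
      h.semigroup_comm hA hγ0 ht.1.le z x
  have hwn : ∀ p : X × X, 0 ≤ m.real {p.1} * f p.1 * g p.2 := fun p =>
    mul_nonneg (mul_nonneg measureReal_nonneg (hs.nonneg_left _)) (hs.nonneg_right _)
  have htn : ∀ p : X × X, 0 ≤ m.real {p.1} * f p.1 * g p.2 *
      (semigroup A t p.1 z * semigroup A (1 - t) z p.2) := fun p =>
    mul_nonneg (hwn p) (mul_nonneg (hpt _ _).le (hpt' _ _).le)
  -- By the first equation of the system the left side is at most ν₀{x}.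
  have hw1 : ∀ p : X × X, m.real {p.1} * f p.1 * g p.2 * semigroup A 1 p.1 p.2 ≤ 1 := by
    intro p
    have h1 : g p.2 * semigroup A 1 p.1 p.2 ≤ semigroupApply A 1 g p.1 :=
      le_hasSum (hs.summable_right p.1).hasSum p.2 fun z _ =>
        mul_nonneg (hs.nonneg_right z) (hpt1 _ z).le
    have h2 := mul_le_mul_of_nonneg_left h1
      (mul_nonneg measureReal_nonneg (hs.nonneg_left p.1) : 0 ≤ m.real {p.1} * f p.1)
    rw [mul_assoc (m.real {p.1}) (f p.1) (semigroupApply A 1 g p.1), hs.eq_left,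
      mul_div_cancel₀ _ (h.measureReal_pos p.1).ne', ← mul_assoc] at h2
    exact h2.trans measureReal_le_one
  have hle : q.real {z} ≤ (∑ p ∈ s₀ ×ˢ s₁, C p.1 p.2 * a p.1 ^ G.dist p.1 z) ^ 2 := by
    rw [hdec]
    refine (Finset.sum_le_sum fun p hp => hb p hp A hA t ht _ (hwn p) (hw1 p) z ?_).trans
      (Finset.sum_sq_le_sq_sum_of_nonneg fun p _ => ?_)
    · refine (Finset.single_le_sum (fun p _ => htn p) hp).trans ?_
      rw [← hdec]
      exact measureReal_le_one
    · exact mul_nonneg (hC0 _ _) (pow_nonneg (ha0 _).le _)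
  exact (Real.sqrt_le_sqrt hle).trans_eq (Real.sqrt_sq (Finset.sum_nonneg fun p _ =>
    mul_nonneg (hC0 _ _) (pow_nonneg (ha0 _).le _)))

end Decay

/-! ### The entropy of the marginals -/

section EntropySum

variable {X : Type*} [DecidableEq X] [Countable X] [TopologicalSpace X] [DiscreteTopology X]
  [MeasurableSpace X] [BorelSpace X] {G : SimpleGraph X} {m : Measure X} {n A : X → X → ℝ}
  {lam κ γ : ℝ} {ν₀ ν₁ : Measure X} {f g : X → ℝ}

theorem mul_log_mul_eq (a b : ℝ) :
    Real.log a * a * b + Real.log b * b * a = a * b * Real.log (a * b) := by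
  rcases eq_or_ne a 0 with rfl | ha
  · simp
  rcases eq_or_ne b 0 with rfl | hb
  · simp
  rw [Real.log_mul ha hb]
  ring

/-- The density of q is P_t f · P_{1-t} g, and the logarithm of the product splits. The closed
interval allows q = ν₀ and q = ν₁ at the ends. -/
theorem IsSchrodingerSystem.entropyPhi_add_entropyPsi (hs : IsSchrodingerSystem m A ν₀ ν₁ f g)
    (h : IsUniformizedKernel G m n lam κ) (hA : IsGeneratorOf A n lam γ) (hγ : 0 < γ)
    [IsProbabilityMeasure ν₀] [IsProbabilityMeasure ν₁] {s₀ s₁ : Finset X}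
    (hν₀ : ∀ x ∉ s₀, ν₀ {x} = 0) (hν₁ : ∀ x ∉ s₁, ν₁ {x} = 0) {t : ℝ}
    (ht : t ∈ Set.Icc (0 : ℝ) 1) (q : Measure X) [IsFiniteMeasure q]
    (hq : ∀ z, q.real {z} =
      m.real {z} * semigroupApply A t f z * semigroupApply A (1 - t) g z) :
    entropyPhi m A f g t + entropyPsi m A f g t =
        ∑' z, q.real {z} * Real.log (q.real {z} / m.real {z}) ∧
      relEntropy q m = ((entropyPhi m A f g t + entropyPsi m A f g t : ℝ) : EReal) := by
  have i1 := (hs.entropyPhi_eq h hA hγ (hs.finite_support h hA hγ hν₀) hν₁ ht).1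
  have i2 := (hs.swap.entropyPhi_eq h hA hγ (hs.swap.finite_support h hA hγ hν₁) hν₀
    (t := 1 - t) ⟨by linarith [ht.2], by linarith [ht.1]⟩).1
  rw [sub_sub_cancel] at i2
  have i3 := i1.add i2
  have e1 : entropyPhi m A f g t + entropyPsi m A f g t = _ := (integral_add i1 i2).symm
  have e : ∀ z, m.real {z} * (Real.log (semigroupApply A t f z) * semigroupApply A t f z *
      semigroupApply A (1 - t) g z + Real.log (semigroupApply A (1 - t) g z) *
      semigroupApply A (1 - t) g z * semigroupApply A t f z) =
      q.real {z} * Real.log (q.real {z} / m.real {z}) := by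
    intro z
    rw [mul_log_mul_eq, hq z, mul_assoc (m.real {z}), mul_div_cancel_left₀ _
      (h.measureReal_pos z).ne', ← mul_assoc]
  have e2 : entropyPhi m A f g t + entropyPsi m A f g t =
      ∑' z, q.real {z} * Real.log (q.real {z} / m.real {z}) := by
    rw [e1]
    refine ((hasSum_integral_of_integrable h.mass_ne_top i3).tsum_eq).symm.trans ?_
    exact tsum_congr e
  refine ⟨e2, ?_⟩
  rw [e2]
  refine relEntropy_eq_tsum h.mass_ne_zero h.mass_ne_top q ?_
  refine ((integrable_iff_summable h.mass_ne_top _).1 i3).congr fun z => ?_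
  rw [← e z, abs_mul, abs_of_pos (h.measureReal_pos z)]
  rfl

theorem IsUniformizedKernel.semigroupApply_zero (h : IsUniformizedKernel G m n lam κ)
    (hA : IsGeneratorOf A n lam γ) (hf : f.support.Finite) (x : X) :
    semigroupApply A 0 f x = f x := by
  rw [h.semigroupApply_eq hA 0 hf, mul_zero, mul_zero, neg_zero, Real.exp_zero, one_mul,
    expOp_zero]
  exact finiteFn_apply f hf x

theorem IsSchrodingerSystem.relEntropy_zero (hs : IsSchrodingerSystem m A ν₀ ν₁ f g)
    (h : IsUniformizedKernel G m n lam κ) (hA : IsGeneratorOf A n lam γ) (hγ : 0 < γ)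
    [IsProbabilityMeasure ν₀] [IsProbabilityMeasure ν₁] {s₀ s₁ : Finset X}
    (hν₀ : ∀ x ∉ s₀, ν₀ {x} = 0) (hν₁ : ∀ x ∉ s₁, ν₁ {x} = 0) :
    relEntropy ν₀ m = ((entropyPhi m A f g 0 + entropyPsi m A f g 0 : ℝ) : EReal) := by
  refine (hs.entropyPhi_add_entropyPsi h hA hγ hν₀ hν₁ ⟨le_rfl, zero_le_one⟩ ν₀ fun z => ?_).2
  rw [h.semigroupApply_zero hA (hs.finite_support h hA hγ hν₀), sub_zero, mul_assoc, hs.eq_left,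
    mul_div_cancel₀ _ (h.measureReal_pos z).ne']

theorem IsSchrodingerSystem.relEntropy_one (hs : IsSchrodingerSystem m A ν₀ ν₁ f g)
    (h : IsUniformizedKernel G m n lam κ) (hA : IsGeneratorOf A n lam γ) (hγ : 0 < γ)
    [IsProbabilityMeasure ν₀] [IsProbabilityMeasure ν₁] {s₀ s₁ : Finset X}
    (hν₀ : ∀ x ∉ s₀, ν₀ {x} = 0) (hν₁ : ∀ x ∉ s₁, ν₁ {x} = 0) :
    relEntropy ν₁ m = ((entropyPhi m A f g 1 + entropyPsi m A f g 1 : ℝ) : EReal) := by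
  refine (hs.entropyPhi_add_entropyPsi h hA hγ hν₀ hν₁ ⟨zero_le_one, le_rfl⟩ ν₁ fun z => ?_).2
  rw [sub_self, h.semigroupApply_zero hA (hs.swap.finite_support h hA hγ hν₁), mul_assoc,
    mul_comm (semigroupApply A 1 f z), hs.eq_right, mul_div_cancel₀ _ (h.measureReal_pos z).ne']

end EntropySum

/-! ### Regularity of the two halves of the entropy -/

theorem isTwiceDiff_of_hasDerivAt {F φ₁ φ₂ : ℝ → ℝ} (hF : ContinuousOn F (Set.Icc 0 1))
    (h₁ : ∀ t ∈ Set.Ioo (0 : ℝ) 1, HasDerivAt F (φ₁ t) t)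
    (h₂ : ∀ t ∈ Set.Ioo (0 : ℝ) 1, HasDerivAt φ₁ (φ₂ t) t) :
    IsTwiceDiff F ∧ ∀ t ∈ Set.Ioo (0 : ℝ) 1, deriv (deriv F) t = φ₂ t := by
  have key : ∀ t ∈ Set.Ioo (0 : ℝ) 1, HasDerivAt (deriv F) (φ₂ t) t := fun t ht =>
    (h₂ t ht).congr_of_eventuallyEq (by
      filter_upwards [Ioo_mem_nhds ht.1 ht.2] with r hr using (h₁ r hr).deriv)
  exact ⟨⟨hF, fun t ht => ⟨(h₁ t ht).differentiableAt, (key t ht).differentiableAt⟩⟩,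
    fun t ht => (key t ht).deriv⟩

theorem one_sub_mem_Ioo {t : ℝ} (ht : t ∈ Set.Ioo (0 : ℝ) 1) : 1 - t ∈ Set.Ioo (0 : ℝ) 1 :=
  ⟨sub_pos.2 ht.2, sub_lt_self 1 ht.1⟩

theorem IsTwiceDiff.comp_one_sub {F : ℝ → ℝ} (hF : IsTwiceDiff F) :
    IsTwiceDiff (fun t => F (1 - t)) ∧ ∀ t ∈ Set.Ioo (0 : ℝ) 1,
      deriv (deriv fun t => F (1 - t)) t = deriv (deriv F) (1 - t) := by
  have hsub : ∀ t : ℝ, HasDerivAt (fun u : ℝ => 1 - u) (-1) t := fun t =>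
    (hasDerivAt_id t).const_sub 1
  refine isTwiceDiff_of_hasDerivAt (φ₁ := fun t => -deriv F (1 - t)) ?_ (fun t ht => ?_)
    fun t ht => ?_
  · refine hF.1.comp (continuous_const.sub continuous_id).continuousOn fun t ht => ?_
    exact ⟨sub_nonneg.2 ht.2, sub_le_self 1 ht.1⟩
  · have := (hF.2 _ (one_sub_mem_Ioo ht)).1.hasDerivAt.comp t (hsub t)
    exact this.congr_deriv (by ring)
  · have := ((hF.2 _ (one_sub_mem_Ioo ht)).2.hasDerivAt.comp t (hsub t)).neg
    exact this.congr_deriv (by ring)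

section Regularity

variable {X : Type*} [DecidableEq X] [Countable X] [TopologicalSpace X] [DiscreteTopology X]
  [MeasurableSpace X] [BorelSpace X] {G : SimpleGraph X} {m : Measure X} {n : X → X → ℝ}
  {lam κ : ℝ}

/-- ψ is φ with f and g exchanged and time reversed, so one estimate serves twice. Multiplication by
the tent makes the lower bounds constant. -/
theorem IsUniformizedKernel.exists_isTwiceDiff (h : IsUniformizedKernel G m n lam κ)
    (s₀ s₁ : Finset X) {t : ℝ} (ht : t ∈ Set.Ioo (0 : ℝ) 1) :
    ∃ B, ∀ (γ : ℝ) (A : X → X → ℝ) (ν₀ ν₁ : Measure X) (f g : X → ℝ), 0 < γ → γ ≤ 1 →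
      IsGeneratorOf A n lam γ → IsProbabilityMeasure ν₀ → IsProbabilityMeasure ν₁ →
      IsSchrodingerSystem m A ν₀ ν₁ f g → (∀ x ∉ s₀, ν₀ {x} = 0) → (∀ x ∉ s₁, ν₁ {x} = 0) →
      (IsTwiceDiff (entropyPhi m A f g) ∧ ∀ u ∈ Set.Ioo (0 : ℝ) 1,
        -B ≤ deriv (deriv (entropyPhi m A f g)) u * tent t u) ∧
      (IsTwiceDiff (entropyPsi m A f g) ∧ ∀ u ∈ Set.Ioo (0 : ℝ) 1,
        -B ≤ deriv (deriv (entropyPsi m A f g)) u * tent t u) := by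
  obtain ⟨C, hC0, hC⟩ := h.exists_entropyPhi_deriv_bound s₀ s₁
  obtain ⟨D, hD0, hD⟩ := h.exists_entropyPhi_deriv_bound s₁ s₀
  have hden : 0 < 8 / (t * (1 - t)) := div_pos (by norm_num) (mul_pos ht.1 (sub_pos.2 ht.2))
  have aux : ∀ {c d K k : ℝ}, 0 ≤ c → c ≤ C + D → 0 < K → (1 + k) * K ≤ 8 / (t * (1 - t)) →
      -(c * (1 + k)) ≤ d → -((C + D) * (8 / (t * (1 - t)))) ≤ d * K := by
    intro c d K k hc hcCD hK hk hd
    have h1 := mul_le_mul_of_nonneg_right hd hK.le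
    have h2 := mul_le_mul_of_nonneg_left hk hc
    have h3 := mul_le_mul_of_nonneg_right hcCD hden.le
    linarith
  refine ⟨(C + D) * (8 / (t * (1 - t))), fun γ A ν₀ ν₁ f g hγ hγ1 hA hp0 hp1 hs hν₀ hν₁ => ?_⟩
  obtain ⟨c1, φ₁, φ₂, c2, c3, c4⟩ := hC γ A ν₀ ν₁ f g hγ hγ1 hA hp0 hp1 hs hν₀ hν₁
  obtain ⟨d1, ψ₁, ψ₂, d2, d3, d4⟩ := hD γ A ν₁ ν₀ g f hγ hγ1 hA hp1 hp0 hs.swap hν₁ hν₀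
  obtain ⟨r1, r2⟩ := isTwiceDiff_of_hasDerivAt c1 c2 c3
  obtain ⟨e1, e2⟩ := isTwiceDiff_of_hasDerivAt d1 d2 d3
  obtain ⟨e3, e4⟩ := e1.comp_one_sub
  have hψ : entropyPsi m A f g = fun t => entropyPhi m A g f (1 - t) := funext entropyPsi_eq
  rw [hψ]
  refine ⟨⟨r1, fun u hu => ?_⟩, e3, fun u hu => ?_⟩
  · rw [r2 u hu]
    exact aux hC0 (le_add_of_nonneg_right hD0) (tent_pos ht hu) (inv_mul_tent_le ht hu).1
      (c4 u hu)
  · rw [e4 u hu, e2 _ (one_sub_mem_Ioo hu)]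
    exact aux hD0 (le_add_of_nonneg_left hC0) (tent_pos ht hu) (inv_mul_tent_le ht hu).2
      (d4 _ (one_sub_mem_Ioo hu))

end Regularity

end SchrodingerBridge

end

/-! ### The convexity inequality at zero temperature. -/

open SchrodingerBridge in
theorem mainTheorem7 {X : Type*} [DecidableEq X] [Countable X] [TopologicalSpace X]
    [DiscreteTopology X] [MeasurableSpace X] [BorelSpace X]
    (G : SimpleGraph X) (m : Measure X) (L : X → X → ℝ)
    (hspace : IsGraphSpace G m L) (hbdd : IsUniformlyBounded G m L)
    -- the end points, with finite support
    (ν₀ ν₁ : ProbabilityMeasure X)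
    (hν₀ : {x | (ν₀ : Measure X) {x} ≠ 0}.Finite) (hν₁ : {x | (ν₁ : Measure X) {x} ≠ 0}.Finite)
    -- the temperatures
    (γ : ℕ → ℝ) (hγ_pos : ∀ k, 0 < γ k) (hγ : Tendsto γ atTop (𝓝 0))
    -- reference path measures, Schrödinger bridges, solutions of the Schrödinger systems
    (R : ℕ → Measure (PathSpace X))
    (hR : ∀ k, IsMarkovPathMeasure m (slowGenerator G L (γ k)) (R k))
    (Q : ℕ → ProbabilityMeasure (PathSpace X))
    (hQ : ∀ k, IsSchrodingerMinimizer (R k) ν₀ ν₁ (Q k))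
    (f g : ℕ → X → ℝ)
    (hfg : ∀ k, IsSchrodingerSystem m (slowGenerator G L (γ k)) ν₀ ν₁ (f k) (g k))
    -- the Schrödinger bridge at zero temperature
    (Q₀ : unitInterval → ProbabilityMeasure X) (hQ₀ : IsZeroTemperatureBridge Q Q₀)
    -- the lower bounds of the second derivatives
    (φ₀ ψ₀ : ℝ → ℝ)
    (hφ₀ : ContinuousOn φ₀ (Set.Icc 0 1)) (hψ₀ : ContinuousOn ψ₀ (Set.Icc 0 1))
    (hφ₀' : ∀ t ∈ Set.Ioo (0 : ℝ) 1, DifferentiableAt ℝ φ₀ t ∧ DifferentiableAt ℝ (deriv φ₀) t)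
    (hψ₀' : ∀ t ∈ Set.Ioo (0 : ℝ) 1, DifferentiableAt ℝ ψ₀ t ∧ DifferentiableAt ℝ (deriv ψ₀) t)
    (hφ : ∀ t ∈ Set.Ioo (0 : ℝ) 1, ((deriv (deriv φ₀) t : ℝ) : EReal) ≤
      liminf (fun k => ((deriv (deriv
        (entropyPhi m (slowGenerator G L (γ k)) (f k) (g k))) t : ℝ) : EReal)) atTop)
    (hψ : ∀ t ∈ Set.Ioo (0 : ℝ) 1, ((deriv (deriv ψ₀) t : ℝ) : EReal) ≤
      liminf (fun k => ((deriv (deriv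
        (entropyPsi m (slowGenerator G L (γ k)) (f k) (g k))) t : ℝ) : EReal)) atTop) :
    ∀ t : unitInterval, (t : ℝ) ∈ Set.Ioo (0 : ℝ) 1 →
      IntervalIntegrable (fun u => deriv (deriv φ₀) u * tent t u) volume 0 1 ∧
      IntervalIntegrable (fun u => deriv (deriv ψ₀) u * tent t u) volume 0 1 ∧
      cost φ₀ ψ₀ t = 2 / (t * (1 - t)) *
        ((1 - t) * φ₀ 0 + t * φ₀ 1 - φ₀ t + (1 - t) * ψ₀ 0 + t * ψ₀ 1 - ψ₀ t) ∧
      relEntropy (Q₀ t : Measure X) m ≤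
        ((1 - t : ℝ) : EReal) * relEntropy (ν₀ : Measure X) m +
          ((t : ℝ) : EReal) * relEntropy (ν₁ : Measure X) m -
          ((t * (1 - t) / 2 * cost φ₀ ψ₀ t : ℝ) : EReal) := by
  intro t ht
  obtain ⟨n, lam, κ, h, hA⟩ := hspace.exists_isUniformizedKernel hbdd
  have h₀ : ∀ x ∉ hν₀.toFinset, (ν₀ : Measure X) {x} = 0 := fun x hx => by simpa using hx
  have h₁ : ∀ x ∉ hν₁.toFinset, (ν₁ : Measure X) {x} = 0 := fun x hx => by simpa using hx
  have hγ' : Tendsto γ atTop (𝓝[>] 0) :=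
    tendsto_nhdsWithin_iff.2 ⟨hγ, Eventually.of_forall hγ_pos⟩
  obtain ⟨c, hc, hcm⟩ := hbdd.le_mass
  obtain ⟨M, hM⟩ := hbdd.mass_le
  have hmarg := fun k z => (hfg k).marginal_singleton h (hA (γ k)) (hγ_pos k) (hR k) h₀ h₁ (hQ k)
    ht z
  obtain ⟨b, hb, hdom⟩ := h.exists_sqrt_marginal_le hbdd.summable_pow_dist hν₀.toFinset
    hν₁.toFinset
  obtain ⟨H, hH, hlim⟩ := tendsto_relEntropy (hQ₀ t) hc hcm hM hb (by
    filter_upwards [hγ'.eventually hdom] with k hk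
    exact hk _ ν₀ ν₁ _ (f k) (g k) (hA (γ k)) inferInstance inferInstance inferInstance (hfg k)
      h₀ h₁ t ht (hmarg k))
  have hent : ∀ k, entropyPhi m (slowGenerator G L (γ k)) (f k) (g k) t +
      entropyPsi m (slowGenerator G L (γ k)) (f k) (g k) t =
      ∑' z, (marginal (Q k) t : Measure X).real {z} *
        Real.log ((marginal (Q k) t : Measure X).real {z} / m.real {z}) := fun k =>
    ((hfg k).entropyPhi_add_entropyPsi h (hA (γ k)) (hγ_pos k) h₀ h₁ ⟨ht.1.le, ht.2.le⟩ _
      (hmarg k)).1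
  have hent0 := fun k => (hfg k).relEntropy_zero h (hA (γ k)) (hγ_pos k) h₀ h₁
  have hent1 := fun k => (hfg k).relEntropy_one h (hA (γ k)) (hγ_pos k) h₀ h₁
  -- The end values of φ + ψ are H(ν₀|m) and H(ν₁|m) at every temperature, hence finite and
  -- independent of k.
  have hconst0 := fun k => EReal.coe_injective ((hent0 k).symm.trans (hent0 0))
  have hconst1 := fun k => EReal.coe_injective ((hent1 k).symm.trans (hent1 0))
  have hr0 := hent0 0
  have hr1 := hent1 0
  set H₀ : ℝ := entropyPhi m (slowGenerator G L (γ 0)) (f 0) (g 0) 0 +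
    entropyPsi m (slowGenerator G L (γ 0)) (f 0) (g 0) 0
  set H₁ : ℝ := entropyPhi m (slowGenerator G L (γ 0)) (f 0) (g 0) 1 +
    entropyPsi m (slowGenerator G L (γ 0)) (f 0) (g 0) 1
  obtain ⟨B, hB⟩ := h.exists_isTwiceDiff hν₀.toFinset hν₁.toFinset ht
  have hreg := (hγ.eventually_le_const one_pos).mono fun k hk => hB (γ k) _ ν₀ ν₁ (f k) (g k)
    (hγ_pos k) hk (hA (γ k)) inferInstance inferInstance (hfg k) h₀ h₁
  -- The sum of the two defects is a multiple of the entropy deficit at time t, which converges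
  -- because the entropies of the marginals do.
  have hJ : Tendsto (fun k => tentDefect (entropyPhi m (slowGenerator G L (γ k)) (f k) (g k)) t +
      tentDefect (entropyPsi m (slowGenerator G L (γ k)) (f k) (g k)) t) atTop
      (𝓝 (2 / (t * (1 - t)) * ((1 - t) * H₀ + t * H₁ - H))) := by
    refine ((hlim.const_sub ((1 - t) * H₀ + t * H₁)).const_mul (2 / (t * (1 - t) : ℝ))).congr
      fun k => ?_
    rw [← hent k, ← hconst0 k, ← hconst1 k, tentDefect, tentDefect]
    ring
  obtain ⟨i1, i2, i3, i4⟩ := cost_le_of_tendsto ht (hreg.mono fun k hk => hk.1)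
    (hreg.mono fun k hk => hk.2) hJ ⟨hφ₀, hφ₀'⟩ ⟨hψ₀, hψ₀'⟩ hφ hψ
  refine ⟨i1, i2, ?_, ?_⟩
  · rw [i3, tentDefect, tentDefect]
    ring
  · rw [hH, hr0, hr1, ← EReal.coe_mul, ← EReal.coe_mul, ← EReal.coe_add, ← EReal.coe_sub,
      EReal.coe_le_coe_iff]
    have hpos : 0 < (t : ℝ) * (1 - t) := mul_pos ht.1 (sub_pos.2 ht.2)
    have i5 := mul_le_mul_of_nonneg_left i4 (by positivity : 0 ≤ (t : ℝ) * (1 - t) / 2)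
    have e : (t : ℝ) * (1 - t) / 2 * (2 / (t * (1 - t)) * ((1 - t) * H₀ + t * H₁ - H)) =
        (1 - t) * H₀ + t * H₁ - H := by
      rw [← mul_assoc, div_mul_div_comm, mul_comm _ (2 : ℝ), div_self (by positivity), one_mul]
    linarith
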